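/- Let $\mathbf{F}$ be a finite field. Let $\mathbf{V}=\mathbf{V}_0\oplus\mathbf{V}_1$ be the graded $\mathbf{F}$-vector space where $\mathbf{V}_0$ has basis $(e_i)_{i\ge 1}$ and $\mathbf{V}_1$ has basis $(f_i)_{i\ge 1}$, with the pairing $\mathbf{V}_0\times\mathbf{V}_1\to\mathbf{F}$ given by $\langle e_i,f_j\rangle=\delta_{ij}$. Let $G$ be the group of linear automorphisms of $\mathbf{V}$ preserving the grading and the pairing (the infinite general linear group), topologized by taking the pointwise stabilizers of finite subsets of $\mathbf{V}$ as a neighbourhood basis of the identity. All $G$-sets are assumed smooth (stabilizers are open). A measure on $G$ valued in a commutative ring $k$ is a rule $\mu$ assigning to each map $f\colon Y\to X$ of transitive $G$-sets an element $\mu(f)\in k$ such that: (i) $\mu(f)=1$ if $f$ is an isomorphism; (ii) $\mu(f\circ g)=\mu(f)\mu(g)$ whenever $f\circ g$ is defined; (iii) if $X'\to X$ is a map of transitive $G$-sets, $Y'_1,\dots,Y'_n$ are the $G$-orbits of $Y\times_X X'$ and $f'_i\colon Y'_i\to X'$ are the projections, then $\mu(f)=\sum_i\mu(f'_i)$. Let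 $\Theta(G)$ be the commutative ring generated by symbols $[f]$ subject to the relations (i)--(iii), so that measures valued in $k$ correspond to ring homomorphisms $\Theta(G)\to k$. Two measures valued in (possibly different) fields are equivalent if the corresponding homomorphisms have the same kernel, i.e. define the same point of $\operatorname{Spec}\Theta(G)$. For an open subgroup $U$ and a point $y$ of a $G$-set, put $\mu(Uy)=\mu(G/(U\cap G_y)\to G/U)$. The integral $\int_Y\varphi$ of a $U$-invariant function $\varphi$ on a $G$-set $Y$ with finitely many orbits is the sum over the $U$-orbits of the value of $\varphi$ times the measure of the orbit, and $\mu(Y)=\int_Y 1$. For a $G$-set $X$ with finitely many orbits, $G$-invariant functions $A\colon X\times X\to k$ are multiplied by $(AB)(z,x)=\int_X A(z,y)B(y,x)\,dy$; these form the endomorphism algebra of the object $\mathcal{C}(X)$ of the category $\underline{\mathrm{Perm}}(G,\mu)$, and the trace of $A$ is $\int_X A(x,x)\,dx$. The measure $\mu$ satisfies (Nil) if, for every such $X$, every nilpotent $G$-invariant $A$ has trace $0$. A transitive $G$-set $\Delta$ is homogeneous if for each transitive $G$-set $X$ the group $\operatorname{Aut}_G(\Delta)$ acts transitively on $\operatorname{Hom}_G(\Delta,X)$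 or the latter is empty. A smooth approximation is a family $(\Delta_n)_{n\ge0}$ of homogeneous transitive $G$-sets such that for each transitive $G$-set $X$ one has $\operatorname{Hom}_G(\Delta_n,X)\ne\emptyset$ for all but finitely many $n$. Given a smooth approximation, fields $(\kappa_n)_{n\ge0}$ and a non-principal ultrafilter $\mathcal{F}$ on $\mathbf{N}$, with ultraproduct $\kappa$, the associated ultraproduct measure is the measure $\nu$ valued in $\kappa$ for which $\nu(f)$, for $f\colon Y\to X$, is the class of the sequence whose $n$-th term is the common cardinality of the fibres of $\operatorname{Hom}_G(\Delta_n,Y)\to\operatorname{Hom}_G(\Delta_n,X)$ (and $0$ if $\operatorname{Hom}_G(\Delta_n,X)=\emptyset$). Let $\Delta_n=G/G(n)$, where $G(n)$ is the subgroup of $G$ fixing $e_1,\dots,e_n,f_1,\dots,f_n$. **Statement.** Let $k$ be a field of characteristic $0$ and let $t\in k$ be non-zero. There is a unique measure $\mu_t$ on $G$ valued in $k$ with $\mu_t(\mathbf{V}_0)=t$, and: 1. $(\Delta_n)_{n\ge 0}$ is a smooth approximation, and there are fields $(\kappa_n)_{n\ge0}$ and a non-principal ultrafilter $\mathcal{F}$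 on $\mathbf{N}$ such that the ultraproduct $\kappa$ has characteristic $0$, the associated ultraproduct measure $\nu$ valued in $\kappa$ exists, and $\mu_t$ is equivalent to $\nu$. 2. $\mu_t$ satisfies (Nil). -/

import Mathlib

universe u v w

namespace Oligo

/-! ### Permutation groups: smooth and transitive `G`-sets

Throughout, `(G, Ω)` is a permutation group, and `G` carries the topology in which the pointwise
stabilizers of the finite subsets of `Ω` form a neighbourhood basis of the identity. -/

section General

variable (G Ω : Type u) [Group G] [MulAction G Ω]

variable {G} in
/-- A subgroup is open iff it contains the pointwise stabilizer of some finite subset of `Ω`. -/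
def IsOpenSubgroup (U : Subgroup G) : Prop :=
  ∃ A : Set Ω, A.Finite ∧ fixingSubgroup G A ≤ U

/-- An action of `G` is smooth if all stabilizers are open. -/
def IsSmooth (X : Type u) [MulAction G X] : Prop :=
  ∀ x : X, IsOpenSubgroup Ω (MulAction.stabilizer G x)

/-- An action of `G` is finitary if it has finitely many orbits. -/
def IsFinitary (X : Type u) [MulAction G X] : Prop :=
  Finite (MulAction.orbitRel.Quotient G X)

/-- Transitive (in particular nonempty) smooth `G`-sets. -/
structure TransGSet : Type (u + 1) where
  carrier : Type u
  [action : MulAction G carrier]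
  nonempty : Nonempty carrier
  pretransitive : MulAction.IsPretransitive G carrier
  smooth : IsSmooth G Ω carrier

instance : CoeSort (TransGSet G Ω) (Type u) := ⟨TransGSet.carrier⟩

attribute [instance] TransGSet.action TransGSet.pretransitive TransGSet.nonempty

variable {G}

theorem isOpenSubgroup_top : IsOpenSubgroup Ω (⊤ : Subgroup G) :=
  ⟨∅, Set.finite_empty, le_top⟩

variable {Ω}

theorem IsOpenSubgroup.inf {U W : Subgroup G} (hU : IsOpenSubgroup Ω U)
    (hW : IsOpenSubgroup Ω W) : IsOpenSubgroup Ω (U ⊓ W) := by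
  obtain ⟨A, hA, hAU⟩ := hU
  obtain ⟨B, hB, hBW⟩ := hW
  refine ⟨A ∪ B, hA.union hB, le_inf ?_ ?_⟩
  · exact (fixingSubgroup_antitone G Ω Set.subset_union_left).trans hAU
  · exact (fixingSubgroup_antitone G Ω Set.subset_union_right).trans hBW

theorem isSmooth_quotient {U : Subgroup G} (hU : IsOpenSubgroup Ω U) :
    IsSmooth G Ω (G ⧸ U) := by
  obtain ⟨A, hA, hAU⟩ := hU
  intro x
  induction x using QuotientGroup.induction_on with
  | H g =>
    refine ⟨(fun a => g • a) '' A, hA.image _, fun h hh => ?_⟩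
    rw [mem_fixingSubgroup_iff] at hh
    rw [MulAction.mem_stabilizer_iff]
    change (((h * g : G)) : G ⧸ U) = (g : G ⧸ U)
    rw [eq_comm, QuotientGroup.eq]
    apply hAU
    rw [mem_fixingSubgroup_iff]
    intro a ha
    have h1 := hh (g • a) ⟨a, ha, rfl⟩
    rw [mul_smul, mul_smul, h1, inv_smul_smul]

/-- The transitive `G`-set `G/U`, for `U` an open subgroup. -/
def TransGSet.coset (U : Subgroup G) (hU : IsOpenSubgroup Ω U) : TransGSet G Ω where
  carrier := G ⧸ U
  nonempty := ⟨((1 : G) : G ⧸ U)⟩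
  pretransitive := inferInstance
  smooth := isSmooth_quotient hU

/-- The projection `G/W → G/U`, for open subgroups `W ≤ U`. -/
def cosetMap {W U : Subgroup G} (hW : IsOpenSubgroup Ω W) (hU : IsOpenSubgroup Ω U)
    (h : W ≤ U) : TransGSet.coset W hW →[G] TransGSet.coset U hU where
  toFun := Subgroup.quotientMapOfLE h
  map_smul' g x := by
    induction x using QuotientGroup.induction_on with
    | H a => rfl

/-! ### Measures and the universal ring -/

/-- `IsOrbitDecomp f h p r` says that `(p i, r i)` identify the fibre product of `f : Y → X` and
`h : X' → X` with the disjoint union of the transitive `G`-sets `Y' i`; that is, the `Y' i` are the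
orbits of the base change of `f` along `h`, and the `r i` are the restrictions to these orbits of
the projection to `X'`. -/
def IsOrbitDecomp {X Y X' : TransGSet G Ω} (f : Y →[G] X) (h : X' →[G] X) {n : ℕ}
    {Y' : Fin n → TransGSet G Ω} (p : ∀ i, Y' i →[G] Y) (r : ∀ i, Y' i →[G] X') : Prop :=
  (∀ i z, f (p i z) = h (r i z)) ∧
    ∀ (y : Y) (x' : X'), f y = h x' → ∃! z : Σ i, Y' i, p z.1 z.2 = y ∧ r z.1 z.2 = x'

variable (G Ω) in
/-- A measure on `(G, Ω)` with values in a commutative ring `k`: a rule assigning a value to each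
map of transitive `G`-sets. -/
@[ext]
structure Measure (k : Type v) [CommRing k] where
  toFun : ∀ {Y X : TransGSet G Ω}, (Y →[G] X) → k
  map_iso : ∀ {Y X : TransGSet G Ω} (f : Y →[G] X), Function.Bijective f → toFun f = 1
  map_comp : ∀ {Z Y X : TransGSet G Ω} (f : Y →[G] X) (g : Z →[G] Y),
    toFun (f.comp g) = toFun f * toFun g
  map_base_change : ∀ {X Y X' : TransGSet G Ω} (f : Y →[G] X) (h : X' →[G] X) {n : ℕ}
    {Y' : Fin n → TransGSet G Ω} (p : ∀ i, Y' i →[G] Y) (r : ∀ i, Y' i →[G] X'),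
    IsOrbitDecomp f h p r → toFun f = ∑ i, toFun (r i)

variable (G Ω) in
/-- Maps of transitive `G`-sets. -/
structure TransMap : Type (u + 1) where
  {source : TransGSet G Ω}
  {target : TransGSet G Ω}
  map : source →[G] target

variable (G Ω) in
/-- The relations between the symbols `[f]` expressing the axioms of a measure. -/
inductive ThetaRel : MvPolynomial (TransMap G Ω) ℤ → Prop
  | iso {Y X : TransGSet G Ω} (f : Y →[G] X) : Function.Bijective f →
      ThetaRel (MvPolynomial.X ⟨f⟩ - 1)
  | comp {Z Y X : TransGSet G Ω} (f : Y →[G] X) (g : Z →[G] Y) :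
      ThetaRel (MvPolynomial.X ⟨f.comp g⟩ - MvPolynomial.X ⟨f⟩ * MvPolynomial.X ⟨g⟩)
  | base_change {X Y X' : TransGSet G Ω} (f : Y →[G] X) (h : X' →[G] X) {n : ℕ}
      {Y' : Fin n → TransGSet G Ω} (p : ∀ i, Y' i →[G] Y) (r : ∀ i, Y' i →[G] X') :
      IsOrbitDecomp f h p r → ThetaRel (MvPolynomial.X ⟨f⟩ - ∑ i, MvPolynomial.X ⟨r i⟩)

variable (G Ω) in
/-- The ring `Θ(G)` carrying the universal measure. -/
abbrev Theta : Type (u + 1) :=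
  MvPolynomial (TransMap G Ω) ℤ ⧸ Ideal.span {p | ThetaRel G Ω p}

namespace Measure

variable {k : Type v} [CommRing k] (μ : Measure G Ω k)

/-- The ring homomorphism `Θ(G) → k`, `[f] ↦ μ(f)`, corresponding to a measure `μ`. -/
noncomputable def toRingHom : Theta G Ω →+* k :=
  Ideal.Quotient.lift _
    (MvPolynomial.eval₂Hom (Int.castRingHom k) fun f : TransMap G Ω => μ.toFun f.map) (by
      intro a ha
      rw [← RingHom.mem_ker]
      refine (Ideal.span_le.2 ?_) ha
      intro p hp
      rw [SetLike.mem_coe, RingHom.mem_ker]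
      cases hp with
      | iso f hf => simp [μ.map_iso f hf]
      | comp f g => simp [μ.map_comp f g]
      | base_change f h p r hd => simp [μ.map_base_change f h p r hd])

/-- The point of `Spec Θ(G)` defined by a measure with values in a domain (such as a field). -/
noncomputable def specPoint [IsDomain k] : PrimeSpectrum (Theta G Ω) :=
  ⟨RingHom.ker μ.toRingHom, RingHom.ker_isPrime _⟩

/-- The measure `μ(U · y)` of the orbit of a point `y` of a smooth `G`-set under an open
subgroup `U`. The orbit is the fibre over the base point of `G ×_U (U · y) = G/(U ∩ G_y) → G/U`,
so its measure is the value of `μ` on that map. -/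
def orbit {Y : Type u} [MulAction G Y] (hY : IsSmooth G Ω Y) (U : Subgroup G)
    (hU : IsOpenSubgroup Ω U) (y : Y) : k :=
  μ.toFun (cosetMap (hU.inf (hY y)) hU (inf_le_left : U ⊓ MulAction.stabilizer G y ≤ U))

/-- The integral `∫_Y φ` of a function `φ` on a finitary smooth `G`-set that is invariant under
the open subgroup `U`: the sum over the (finitely many) `U`-orbits of the value of `φ` on the orbit
times the measure of the orbit. -/
noncomputable def integral {Y : Type u} [MulAction G Y] (hY : IsSmooth G Ω Y) (U : Subgroup G)
    (hU : IsOpenSubgroup Ω U) (φ : Y → k) : k :=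
  ∑ᶠ o : MulAction.orbitRel.Quotient U Y, φ o.out * μ.orbit hY U hU o.out

/-- The measure of a finitary smooth `G`-set. -/
noncomputable def value {Y : Type u} [MulAction G Y] (hY : IsSmooth G Ω Y) : k :=
  μ.integral hY ⊤ (isOpenSubgroup_top Ω) fun _ => 1

section Matrices

variable {X : Type u} [MulAction G X] (hX : IsSmooth G Ω X)

/-- The product of `G`-invariant `X × X` matrices: `(AB)(z, x) = ∫_X A(z, y) B(y, x) dy`. The
integrand is invariant under `G_z ∩ G_x`. -/
noncomputable def matMul (A B : X → X → k) : X → X → k := fun z x =>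
  μ.integral hX (MulAction.stabilizer G z ⊓ MulAction.stabilizer G x) ((hX z).inf (hX x))
    fun y => A z y * B y x

/-- `matPowSucc A n` is the matrix power `A ^ (n + 1)`. -/
noncomputable def matPowSucc (A : X → X → k) : ℕ → X → X → k
  | 0 => A
  | n + 1 => μ.matMul hX A (matPowSucc A n)

/-- The trace `∫_X A(x, x) dx` of a `G`-invariant `X × X` matrix. -/
noncomputable def trace (A : X → X → k) : k :=
  μ.integral hX ⊤ (isOpenSubgroup_top Ω) fun x => A x x

end Matrices

/-- Condition (Nil): nilpotent `G`-invariant matrices, that is, nilpotent endomorphisms of objects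
of the category of permutation modules of `(G, μ)`, have trace zero. -/
def SatisfiesNil : Prop :=
  ∀ (X : Type u) [MulAction G X] (hX : IsSmooth G Ω X), IsFinitary G X →
    ∀ A : X → X → k, (∀ (g : G) (x y : X), A (g • x) (g • y) = A x y) →
      (∃ n : ℕ, ∀ x y, μ.matPowSucc hX A n x y = 0) → μ.trace hX A = 0

end Measure

/-! ### Smooth approximation and ultraproduct measures -/

/-- A transitive `G`-set `Δ` is homogeneous if for every transitive `G`-set `X` the action of
`Aut(Δ)` on `Hom_G(Δ, X)` is transitive, or `Hom_G(Δ, X)` is empty. -/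
def IsHomogeneous (Δ : TransGSet G Ω) : Prop :=
  ∀ (X : TransGSet G Ω) (i j : Δ →[G] X),
    ∃ σ : Δ →[G] Δ, Function.Bijective σ ∧ i.comp σ = j

/-- A family of homogeneous transitive `G`-sets is a smooth approximation if for each transitive
`G`-set `X` all but finitely many members of the family admit a map to `X`. -/
structure IsSmoothApproximation {I : Type w} (Δ : I → TransGSet G Ω) : Prop where
  homogeneous : ∀ i, IsHomogeneous (Δ i)
  cofinite : ∀ X : TransGSet G Ω, {i | IsEmpty (Δ i →[G] X)}.Finite

open Classical in
/-- The cardinality of the fibres of `Hom_G(Δ, Y) → Hom_G(Δ, X)` induced by `f : Y → X`, or `0` if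
`Hom_G(Δ, X)` is empty. (All fibres have the same cardinality if `Δ` is homogeneous.) -/
noncomputable def fibreCard (Δ : TransGSet G Ω) {Y X : TransGSet G Ω} (f : Y →[G] X) : ℕ :=
  if h : Nonempty (Δ →[G] X) then Nat.card {g : Δ →[G] Y // f.comp g = h.some} else 0

end General

section Ultraproduct

variable {I : Type w} (κ : I → Type v) [∀ i, Field (κ i)] (𝓕 : Ultrafilter I)

/-- The ideal of families that vanish almost everywhere with respect to the ultrafilter. -/
def ultraIdeal : Ideal (∀ i, κ i) where
  carrier := {x | ∀ᶠ i in (𝓕 : Filter I), x i = 0}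
  zero_mem' := Filter.Eventually.of_forall fun _ => rfl
  add_mem' ha hb := by
    filter_upwards [ha, hb] with i h1 h2
    simp [h1, h2]
  smul_mem' c x hx := by
    filter_upwards [hx] with i h
    simp [h]

/-- The ultraproduct of a family of fields. -/
abbrev Ultraproduct : Type (max v w) := (∀ i, κ i) ⧸ ultraIdeal κ 𝓕

instance ultraIdeal_isMaximal : (ultraIdeal κ 𝓕).IsMaximal := by
  rw [Ideal.isMaximal_iff]
  refine ⟨fun h => ?_, fun J x hJ hx hxJ => ?_⟩
  · have h' : ∀ᶠ i in (𝓕 : Filter I), (1 : κ i) = 0 := h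
    obtain ⟨i, hi⟩ := h'.exists
    exact one_ne_zero hi
  · have hne : ∀ᶠ i in (𝓕 : Filter I), ¬ x i = 0 := Ultrafilter.eventually_not.2 hx
    have h1 : (1 - (fun i => (x i)⁻¹) * x : ∀ i, κ i) ∈ J := by
      apply hJ
      change ∀ᶠ i in (𝓕 : Filter I), (1 : κ i) - (x i)⁻¹ * x i = 0
      filter_upwards [hne] with i hi
      rw [inv_mul_cancel₀ hi, sub_self]
    have h2 := J.add_mem h1 (J.mul_mem_left (fun i => (x i)⁻¹) hxJ)
    rwa [sub_add_cancel] at h2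

end Ultraproduct

/-- `ν` is the ultraproduct measure, with values in the ultraproduct of the fields `κ i` along the
non-principal ultrafilter `𝓕`, associated with the smooth approximation `Δ`: its value on
`f : Y → X` is the class of the family of fibre cardinalities of `Hom_G(Δ i, Y) → Hom_G(Δ i, X)`. -/
structure IsUltraproductMeasure {G Ω : Type u} [Group G] [MulAction G Ω] {I : Type w}
    (Δ : I → TransGSet G Ω) (κ : I → Type v) [∀ i, Field (κ i)] (𝓕 : Ultrafilter I)
    (ν : Measure G Ω (Ultraproduct κ 𝓕)) : Prop where
  smoothApproximation : IsSmoothApproximation Δ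
  nonprincipal : ∀ i, 𝓕 ≠ pure i
  toFun_eq : ∀ {Y X : TransGSet G Ω} (f : Y →[G] X),
    ν.toFun f = Ideal.Quotient.mk (ultraIdeal κ 𝓕) fun i => (fibreCard (Δ i) f : κ i)

/-! ### The infinite general linear group -/

section GeneralLinear

variable (F : Type u) [Field F]

/-- The space `𝐕₀` with basis `e_0, e_1, …`. -/
def EvenPart : Type u := ℕ →₀ F

/-- The space `𝐕₁` with basis `f_0, f_1, …`. -/
def OddPart : Type u := ℕ →₀ F

/-- The space `𝐕 = 𝐕₀ ⊕ 𝐕₁`. -/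
abbrev InfSpace : Type u := EvenPart F × OddPart F

variable {F} in
/-- The pairing between `𝐕₀` and `𝐕₁` with `⟨e_i, f_j⟩ = δ_{ij}`. -/
noncomputable def pairing (x : ℕ →₀ F) (y : ℕ →₀ F) : F := x.sum fun i a => a * y i

/-- The infinite general linear group: the automorphisms of `𝐕` preserving the grading and
the pairing. -/
noncomputable def GLInf : Subgroup (((ℕ →₀ F) ≃ₗ[F] (ℕ →₀ F)) × ((ℕ →₀ F) ≃ₗ[F] (ℕ →₀ F))) where
  carrier := {g | ∀ x y, pairing (g.1 x) (g.2 y) = pairing x y}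
  one_mem' _ _ := rfl
  mul_mem' {g h} hg hh x y := (hg (h.1 x) (h.2 y)).trans (hh x y)
  inv_mem' {g} hg x y := by
    have h := hg (g.1⁻¹ x) (g.2⁻¹ y)
    have h1 : g.1 (g.1⁻¹ x) = x := g.1.apply_symm_apply x
    have h2 : g.2 (g.2⁻¹ y) = y := g.2.apply_symm_apply y
    rw [h1, h2] at h
    exact h.symm

noncomputable instance : MulAction (GLInf F) (EvenPart F) where
  smul g x := g.1.1 x
  one_smul _ := rfl
  mul_smul _ _ _ := rfl

noncomputable instance : MulAction (GLInf F) (OddPart F) where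
  smul g x := g.1.2 x
  one_smul _ := rfl
  mul_smul _ _ _ := rfl

/-- The zero vector of `𝐕₁`. -/
noncomputable def oddZero : OddPart F := (0 : ℕ →₀ F)

/-- The zero vector of `𝐕₀`. -/
noncomputable def evenZero : EvenPart F := (0 : ℕ →₀ F)

/-- The basis vector `e_i` of `𝐕₀`. -/
noncomputable def evenBasis (i : ℕ) : EvenPart F := (Finsupp.single i 1 : ℕ →₀ F)

/-- The basis vector `f_i` of `𝐕₁`. -/
noncomputable def oddBasis (i : ℕ) : OddPart F := (Finsupp.single i 1 : ℕ →₀ F)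

theorem isSmooth_evenPart : IsSmooth (GLInf F) (InfSpace F) (EvenPart F) := by
  intro x
  refine ⟨{(x, oddZero F)}, Set.finite_singleton _, fun g hg => ?_⟩
  rw [mem_fixingSubgroup_iff] at hg
  exact congrArg Prod.fst (hg (x, oddZero F) rfl)

/-- The first `n` basis vectors of `𝐕₀` and of `𝐕₁`, as elements of `𝐕`. -/
noncomputable def basisVectors (n : ℕ) : Set (InfSpace F) :=
  (fun i => (evenBasis F i, oddZero F)) '' Set.Iio n ∪
    (fun i => (evenZero F, oddBasis F i)) '' Set.Iio n

/-- The open subgroup `G(n)` fixing the first `n` basis vectors of `𝐕₀` and of `𝐕₁`. -/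
noncomputable def levelSubgroup (n : ℕ) : Subgroup (GLInf F) :=
  fixingSubgroup (GLInf F) (basisVectors F n)

theorem isOpenSubgroup_levelSubgroup (n : ℕ) :
    IsOpenSubgroup (InfSpace F) (levelSubgroup F n) :=
  ⟨basisVectors F n, ((Set.finite_Iio n).image _).union ((Set.finite_Iio n).image _), le_rfl⟩

/-- The transitive `G`-set `G/G(n)`, which is the set of embeddings into `𝐕` of the graded space
of dimension `(n|n)` with a perfect pairing. -/
noncomputable def perfectEmbeddings (n : ℕ) : TransGSet (GLInf F) (InfSpace F) :=
  TransGSet.coset (levelSubgroup F n) (isOpenSubgroup_levelSubgroup F n)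

variable {F} in
/-- The property that characterizes the measure `μ_t`: the space `𝐕₀` has measure `t`. -/
def IsMuParam {k : Type v} [CommRing k] (t : k) (μ : Measure (GLInf F) (InfSpace F) k) : Prop :=
  μ.value (isSmooth_evenPart F) = t

end GeneralLinear

end Oligo

/-! Write q for the cardinality of F. For a transitive G-set X the number of maps Δ_n → X, which is
the number of points of X fixed by G(n), is a polynomial in q^n for large n. So are the fibre
cardinalities attached to a map Y → X, and these polynomials form a measure `polynomialMeasure` with
values in ℚ[X] for which 𝐕₀ has measure X. Evaluation at X = t gives μ_t.

Open subgroups are controlled by the pointwise stabilizers `fixer A₀ A₁` of pairs of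
finite-dimensional subspaces. A computation with transvections (`fixer_inf_le`) shows that every
open subgroup has a smallest such pair, its support, and that it normalizes the stabilizer of its
support. Supports and a Witt-type extension argument give the homogeneity of Δ_n. They also reduce
polynomiality to counting vectors outside A₀ with prescribed pairings with A₁, followed by division
by a constant fibre cardinality.

Uniqueness: under `fixer A₀ A₁` the orbit of v ∉ A₀ is the coset of the orthogonal of A₁ through v,
minus finitely many fixed points. Cosets of this orthogonal all have the same measure, so the
measure of the orbit is determined by that of 𝐕₀. Counting pairs (e, f) with ⟨e, f⟩ = 1 in two ways
shows that 𝐕₁ has the same measure as 𝐕₀. Supports reduce arbitrary maps to these orbits.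

Equivalence with an ultraproduct measure requires fields κ_n in which the class of (q^n) satisfies
the same polynomial equations over ℚ as t. If t is transcendental, an algebraic closure of ℚ serves
for all n. If t is algebraic, let P be an integral multiple of its minimal polynomial. As t ≠ 0,
P(0) ≠ 0, and then the values P(q^n) have arbitrarily large prime divisors p
(`exists_prime_dvd_eval_pow`); κ_n is taken of characteristic p.

For (Nil), a matrix over the ultraproduct is a sequence of ordinary finite matrices over the κ_n,
indexed by the points fixed by G(n), with the ordinary product and trace for almost all n; nilpotent
matrices over a field have trace zero. A counterexample over k would be defined over a finitely
generated algebra over a field contained in both k and the ultraproduct. The κ_n are chosen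
algebraically closed, hence so is the ultraproduct, and the Nullstellensatz would carry the
counterexample there. -/

namespace Oligo

/-! ### The pairing and duality on the finite levels. -/

section Pairing

variable {F : Type u} [Field F]

theorem pairing_add_left (x x' y : ℕ →₀ F) : pairing (x + x') y = pairing x y + pairing x' y :=
  Finsupp.sum_add_index' (by simp) (by intros; ring)

theorem pairing_smul_left (c : F) (x y : ℕ →₀ F) : pairing (c • x) y = c * pairing x y := by
  unfold pairing
  rw [Finsupp.sum_smul_index (by simp), Finsupp.mul_sum]
  simp only [mul_assoc]

theorem pairing_eq_sum {x : ℕ →₀ F} {s : Finset ℕ} (hs : x.support ⊆ s) (y : ℕ →₀ F) :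
    pairing x y = ∑ i ∈ s, x i * y i :=
  Finsupp.sum_of_support_subset _ hs _ (by simp)

theorem pairing_comm (x y : ℕ →₀ F) : pairing x y = pairing y x := by
  classical
  rw [pairing_eq_sum (Finset.subset_union_left (s₂ := y.support)),
    pairing_eq_sum (Finset.subset_union_right (s₁ := x.support))]
  exact Finset.sum_congr rfl fun _ _ => mul_comm _ _

theorem pairing_add_right (x y y' : ℕ →₀ F) : pairing x (y + y') = pairing x y + pairing x y' := by
  simp only [pairing_comm x, pairing_add_left]

theorem pairing_smul_right (c : F) (x y : ℕ →₀ F) : pairing x (c • y) = c * pairing x y := by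
  simp only [pairing_comm x, pairing_smul_left]

/-- The pairing as a bilinear map. -/
noncomputable def pairingHom : (ℕ →₀ F) →ₗ[F] (ℕ →₀ F) →ₗ[F] F :=
  LinearMap.mk₂ F pairing pairing_add_left pairing_smul_left pairing_add_right pairing_smul_right

@[simp]
theorem pairing_zero_left (y : ℕ →₀ F) : pairing 0 y = 0 := by simp [pairing]

@[simp]
theorem pairing_zero_right (x : ℕ →₀ F) : pairing x 0 = 0 := by simp [pairing]

theorem pairing_neg_left (x y : ℕ →₀ F) : pairing (-x) y = -pairing x y :=
  (pairingHom (F := F)).map_neg₂ x y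

theorem pairing_neg_right (x y : ℕ →₀ F) : pairing x (-y) = -pairing x y :=
  (pairingHom x).map_neg y

theorem pairing_sub_left (x x' y : ℕ →₀ F) : pairing (x - x') y = pairing x y - pairing x' y :=
  (pairingHom (F := F)).map_sub₂ x x' y

theorem pairing_sub_right (x y y' : ℕ →₀ F) : pairing x (y - y') = pairing x y - pairing x y' :=
  (pairingHom x).map_sub y y'

theorem pairing_single_left (i : ℕ) (y : ℕ →₀ F) : pairing (Finsupp.single i 1) y = y i := by
  simp [pairing]

theorem pairing_single_right (x : ℕ →₀ F) (i : ℕ) : pairing x (Finsupp.single i 1) = x i := by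
  rw [pairing_comm, pairing_single_left]

variable (F) in
/-- The span of the first `n` basis vectors. -/
def initial (n : ℕ) : Submodule F (ℕ →₀ F) := Finsupp.supported F F (Set.Iio n)

theorem mem_initial {n : ℕ} {x : ℕ →₀ F} : x ∈ initial F n ↔ ∀ i, n ≤ i → x i = 0 := by
  rw [initial, Finsupp.mem_supported']
  simp

theorem single_mem_initial {i n : ℕ} (h : i < n) (c : F) : Finsupp.single i c ∈ initial F n := by
  rw [mem_initial]
  intro j hj
  rw [Finsupp.single_apply, if_neg (by omega)]

theorem initial_mono {m n : ℕ} (h : m ≤ n) : initial F m ≤ initial F n :=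
  Finsupp.supported_mono (Set.Iio_subset_Iio h)

theorem initial_eq_span (n : ℕ) :
    initial F n = Submodule.span F ((fun i => Finsupp.single i (1 : F)) '' Set.Iio n) :=
  Finsupp.supported_eq_span_single F _

instance finite_initial (n : ℕ) : Module.Finite F (initial F n) := by
  rw [initial_eq_span]
  exact FiniteDimensional.span_of_finite F ((Set.finite_Iio n).image _)

theorem exists_mem_initial (x : ℕ →₀ F) : ∃ n, x ∈ initial F n := by
  refine ⟨x.support.sup id + 1, mem_initial.2 fun i hi => ?_⟩
  by_contra h
  have := Finset.le_sup (f := id) (Finsupp.mem_support_iff.2 h)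
  simp only [id] at this
  omega

theorem exists_le_initial {A : Submodule F (ℕ →₀ F)} (hA : A.FG) :
    ∃ n, A ≤ initial F n := by
  obtain ⟨s, rfl⟩ := hA
  choose m hm using exists_mem_initial (F := F)
  refine ⟨s.sup m, Submodule.span_le.2 fun x hx => ?_⟩
  exact initial_mono (Finset.le_sup hx) (hm x)

/-- Linear functionals on `initial F n` are represented by vectors of `initial F n`. -/
theorem exists_repr (n : ℕ) (φ : Module.Dual F (ℕ →₀ F)) :
    ∃ w ∈ initial F n, ∀ x ∈ initial F n, pairing x w = φ x := by
  classical
  refine ⟨∑ i ∈ Finset.range n, Finsupp.single i (φ (Finsupp.single i 1)),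
    Submodule.sum_mem _ fun i hi => single_mem_initial (Finset.mem_range.1 hi) _,
    fun x hx => ?_⟩
  have hs : x.support ⊆ Finset.range n := fun i hi => by
    by_contra h
    exact (Finsupp.mem_support_iff.1 hi) (mem_initial.1 hx i (by simpa using h))
  rw [pairing_eq_sum hs]
  conv_rhs => rw [← Finsupp.sum_single x, Finsupp.sum_of_support_subset _ hs _ (by simp), map_sum]
  refine Finset.sum_congr rfl fun i hi => ?_
  rw [Finsupp.finsetSum_apply, Finset.sum_eq_single i]
  · rw [Finsupp.single_eq_same, ← smul_eq_mul, ← map_smul, Finsupp.smul_single_one]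
  · intro j _ hj
    rw [Finsupp.single_apply, if_neg hj]
  · exact fun h => absurd hi h

/-- A functional that vanishes on `A` but not at `v` is rescaled to take the value 1 at `v` and
represented by a vector of the same level. -/
theorem exists_perp {n : ℕ} {A : Submodule F (ℕ →₀ F)} (hA : A ≤ initial F n) {v : ℕ →₀ F}
    (hvn : v ∈ initial F n) (hv : v ∉ A) :
    ∃ w ∈ initial F n, (∀ x ∈ A, pairing x w = 0) ∧ pairing v w = 1 := by
  obtain ⟨φ, h1, h2⟩ := Submodule.exists_le_ker_of_notMem hv
  obtain ⟨w, hw, hφ⟩ := exists_repr n ((φ v)⁻¹ • φ)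
  refine ⟨w, hw, fun x hx => ?_, ?_⟩
  · rw [hφ x (hA hx)]
    simp [LinearMap.mem_ker.1 (h2 hx)]
  · rw [hφ v hvn]
    simp [h1]

/-- A space is never the union of two proper subspaces, even over the field with two elements: one
of w, a multiple of w', and w + w' works. The two nonvanishing conditions make the transvection
carrying `v` to `v'` exist and be invertible. -/
theorem exists_perp_pair {n : ℕ} {A : Submodule F (ℕ →₀ F)} (hA : A ≤ initial F n) {v v' : ℕ →₀ F}
    (hvn : v ∈ initial F n) (hv : v ∉ A) (hvn' : v' ∈ initial F n) (hv' : v' ∉ A) :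
    ∃ w ∈ initial F n, (∀ x ∈ A, pairing x w = 0) ∧ pairing v w = 1 ∧ pairing v' w ≠ 0 := by
  obtain ⟨w, hw, h0, h1⟩ := exists_perp hA hvn hv
  obtain ⟨w', hw', h0', h1'⟩ := exists_perp hA hvn' hv'
  by_cases h2 : pairing v' w = 0
  · by_cases h3 : pairing v w' = 0
    · refine ⟨w + w', add_mem hw hw', fun x hx => ?_, ?_, ?_⟩ <;>
        simp_all [pairing_add_right]
    · refine ⟨(pairing v w')⁻¹ • w', Submodule.smul_mem _ _ hw', fun x hx => ?_, ?_, ?_⟩ <;>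
        simp_all [pairing_smul_right]
  · exact ⟨w, hw, h0, h1, h2⟩

/-- The annihilator of an intersection is the sum of the annihilators; the summand killing `A` is
represented within the level. -/
theorem exists_perp_decomp {n : ℕ} {A B : Submodule F (ℕ →₀ F)} (hA : A ≤ initial F n)
    (hB : B ≤ initial F n) {u : ℕ →₀ F} (hu : ∀ x ∈ A ⊓ B, pairing x u = 0) :
    ∃ a ∈ initial F n, (∀ x ∈ A, pairing x a = 0) ∧ ∀ x ∈ B, pairing x (u - a) = 0 := by
  have h1 : pairingHom u ∈ (A ⊓ B).dualAnnihilator := by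
    rw [Submodule.mem_dualAnnihilator]
    intro x hx
    exact (pairing_comm _ _).trans (hu x hx)
  rw [Subspace.dualAnnihilator_inf_eq, Submodule.mem_sup] at h1
  obtain ⟨φ, hφ, ψ, hψ, hs⟩ := h1
  rw [Submodule.mem_dualAnnihilator] at hφ hψ
  obtain ⟨a, ha, haφ⟩ := exists_repr n φ
  refine ⟨a, ha, fun x hx => (haφ x (hA hx)).trans (hφ x hx), fun x hx => ?_⟩
  have h2 : φ x + ψ x = pairing u x := LinearMap.congr_fun hs x
  rw [pairing_sub_right, haφ x (hB hx), pairing_comm, ← h2, hψ x hx, add_zero, sub_self]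

end Pairing

/-! ### Transvections in the infinite general linear group. -/

section Transvections

variable {F : Type u} [Field F]

theorem GLInf.pairing_map (g : GLInf F) (x y : ℕ →₀ F) :
    pairing (g.1.1 x) (g.1.2 y) = pairing x y := g.2 x y

theorem GLInf.ext {g h : GLInf F} (h1 : ∀ x, g.1.1 x = h.1.1 x) (h2 : ∀ x, g.1.2 x = h.1.2 x) :
    g = h :=
  Subtype.ext (Prod.ext (LinearEquiv.ext h1) (LinearEquiv.ext h2))

theorem GLInf.inv_fst_apply (g : GLInf F) (x : ℕ →₀ F) : (g⁻¹).1.1 (g.1.1 x) = x :=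
  g.1.1.symm_apply_apply x

theorem GLInf.fst_inv_apply (g : GLInf F) (x : ℕ →₀ F) : g.1.1 ((g⁻¹).1.1 x) = x :=
  g.1.1.apply_symm_apply x

theorem GLInf.inv_snd_apply (g : GLInf F) (x : ℕ →₀ F) : (g⁻¹).1.2 (g.1.2 x) = x :=
  g.1.2.symm_apply_apply x

theorem GLInf.snd_inv_apply (g : GLInf F) (x : ℕ →₀ F) : g.1.2 ((g⁻¹).1.2 x) = x :=
  g.1.2.apply_symm_apply x

theorem GLInf.mul_fst_apply (g h : GLInf F) (x : ℕ →₀ F) : (g * h).1.1 x = g.1.1 (h.1.1 x) := rfl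

theorem GLInf.mul_snd_apply (g h : GLInf F) (x : ℕ →₀ F) : (g * h).1.2 x = g.1.2 (h.1.2 x) := rfl

/-- Exchange of the two parts of `𝐕`, as an automorphism of the infinite general linear group. -/
noncomputable def GLInf.swap : GLInf F ≃* GLInf F where
  toFun g := ⟨(g.1.2, g.1.1), fun x y => by
    rw [pairing_comm, GLInf.pairing_map, pairing_comm]⟩
  invFun g := ⟨(g.1.2, g.1.1), fun x y => by
    rw [pairing_comm, GLInf.pairing_map, pairing_comm]⟩
  left_inv _ := rfl
  right_inv _ := rfl
  map_mul' _ _ := rfl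

theorem GLInf.swap_swap (g : GLInf F) : GLInf.swap (GLInf.swap g) = g := rfl

/-- The linear automorphism `v ↦ v + ⟨v, w⟩ u`. -/
noncomputable def transvectionEquiv (u w : ℕ →₀ F) (h : 1 + pairing u w ≠ 0) :
    (ℕ →₀ F) ≃ₗ[F] (ℕ →₀ F) where
  toFun v := v + pairing v w • u
  invFun v := v - ((1 + pairing u w)⁻¹ * pairing v w) • u
  map_add' x y := by rw [pairing_add_left, add_smul]; abel
  map_smul' c x := by rw [pairing_smul_left, RingHom.id_apply, smul_add, mul_smul]
  left_inv v := by
    dsimp only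
    rw [pairing_add_left, pairing_smul_left, add_sub_assoc, ← sub_smul]
    have : pairing v w - (1 + pairing u w)⁻¹ * (pairing v w + pairing v w * pairing u w) = 0 := by
      field_simp; ring
    rw [this, zero_smul, add_zero]
  right_inv v := by
    dsimp only
    rw [pairing_sub_left, pairing_smul_left, sub_add, ← sub_smul]
    have : (1 + pairing u w)⁻¹ * pairing v w -
        (pairing v w - (1 + pairing u w)⁻¹ * pairing v w * pairing u w) = 0 := by
      field_simp; ring
    rw [this, zero_smul, sub_zero]

/-- The transvection (or dilatation) `v ↦ v + ⟨v, w⟩ u` on `𝐕₀`, together with its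
contragredient on `𝐕₁`. -/
noncomputable def transvection (u w : ℕ →₀ F) (h : 1 + pairing u w ≠ 0) : GLInf F :=
  ⟨(transvectionEquiv u w h, (transvectionEquiv w u (by rwa [pairing_comm])).symm), fun x y => by
    change pairing (x + pairing x w • u) (y - ((1 + pairing w u)⁻¹ * pairing y u) • w) = _
    rw [pairing_add_left, pairing_sub_right, pairing_sub_right, pairing_smul_left,
      pairing_smul_right, pairing_smul_left, pairing_smul_right, pairing_comm w u,
      pairing_comm y u]
    field_simp
    ring⟩

theorem transvection_fst (u w : ℕ →₀ F) (h : 1 + pairing u w ≠ 0) (x : ℕ →₀ F) :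
    (transvection u w h).1.1 x = x + pairing x w • u := rfl

theorem transvection_snd (u w : ℕ →₀ F) (h : 1 + pairing u w ≠ 0) (y : ℕ →₀ F) :
    (transvection u w h).1.2 y = y - ((1 + pairing u w)⁻¹ * pairing u y) • w := by
  change y - ((1 + pairing w u)⁻¹ * pairing y u) • w = _
  rw [pairing_comm w u, pairing_comm y u]

theorem one_add_pairing_ne_zero {u w : ℕ →₀ F} (h : pairing u w = 0) : 1 + pairing u w ≠ 0 := by
  simp [h]

/-- Together with `transvection_add_right`, this lets a transvection be factored along a
decomposition of its direction or of its functional. -/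
theorem transvection_add_left {u u' w : ℕ →₀ F} (h : pairing u w = 0) (h' : pairing u' w = 0) :
    transvection (u + u') w (by simp [pairing_add_left, h, h']) =
      transvection u w (one_add_pairing_ne_zero h) *
        transvection u' w (one_add_pairing_ne_zero h') := by
  refine GLInf.ext (fun x => ?_) fun y => ?_
  · simp only [GLInf.mul_fst_apply, transvection_fst, pairing_add_left, pairing_smul_left, h',
      mul_zero, add_zero, smul_add]
    abel
  · simp only [GLInf.mul_snd_apply, transvection_snd, pairing_add_left, pairing_sub_right,
      pairing_smul_right, h, h', mul_zero, add_zero, inv_one, one_mul, sub_zero, add_smul]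
    abel

theorem transvection_add_right {u w w' : ℕ →₀ F} (h : pairing u w = 0) (h' : pairing u w' = 0) :
    transvection u (w + w') (by simp [pairing_add_right, h, h']) =
      transvection u w (one_add_pairing_ne_zero h) *
        transvection u w' (one_add_pairing_ne_zero h') := by
  refine GLInf.ext (fun x => ?_) fun y => ?_
  · simp only [GLInf.mul_fst_apply, transvection_fst, pairing_add_right, pairing_add_left,
      pairing_smul_left, h, mul_zero, add_zero, add_smul]
    abel
  · simp only [GLInf.mul_snd_apply, transvection_snd, pairing_add_right, pairing_sub_right,
      pairing_smul_right, h, h', mul_zero, add_zero, inv_one, one_mul, sub_zero, smul_add]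
    abel

theorem conj_transvection (g : GLInf F) {u w : ℕ →₀ F} (h : 1 + pairing u w ≠ 0) :
    g * transvection u w h * g⁻¹ =
      transvection (g.1.1 u) (g.1.2 w) (by rwa [GLInf.pairing_map]) := by
  have key1 : ∀ x, pairing ((g⁻¹).1.1 x) w = pairing x (g.1.2 w) := fun x => by
    rw [← GLInf.pairing_map g, GLInf.fst_inv_apply]
  have key2 : ∀ y, pairing u ((g⁻¹).1.2 y) = pairing (g.1.1 u) y := fun y => by
    rw [← GLInf.pairing_map g, GLInf.snd_inv_apply]
  refine GLInf.ext (fun x => ?_) fun y => ?_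
  · rw [GLInf.mul_fst_apply, GLInf.mul_fst_apply, transvection_fst, transvection_fst, map_add,
      map_smul, GLInf.fst_inv_apply, key1]
  · rw [GLInf.mul_snd_apply, GLInf.mul_snd_apply, transvection_snd, transvection_snd, map_sub,
      map_smul, GLInf.snd_inv_apply, key2, GLInf.pairing_map]

theorem swap_transvection {u w : ℕ →₀ F} (h : pairing u w = 0) :
    GLInf.swap (transvection u w (one_add_pairing_ne_zero h)) =
      transvection w (-u) (by simp [pairing_neg_right, pairing_comm w u, h]) := by
  refine GLInf.ext (fun x => ?_) fun y => ?_
  · change (transvection u w (one_add_pairing_ne_zero h)).1.2 x = _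
    rw [transvection_snd, transvection_fst, h, pairing_neg_right, pairing_comm u x]
    simp [sub_eq_add_neg]
  · change (transvection u w (one_add_pairing_ne_zero h)).1.1 y = _
    rw [transvection_fst, transvection_snd, pairing_neg_right, pairing_comm w u, h,
      pairing_comm y w]
    simp

end Transvections

/-! ### Pointwise stabilizers and their generation by transvections. -/

section Fixer

variable {F : Type u} [Field F]

/-- The subgroup of the elements fixing `A₀ ⊆ 𝐕₀` and `A₁ ⊆ 𝐕₁` pointwise. -/
noncomputable def fixer (A₀ A₁ : Submodule F (ℕ →₀ F)) : Subgroup (GLInf F) where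
  carrier := {g | (∀ x ∈ A₀, g.1.1 x = x) ∧ ∀ y ∈ A₁, g.1.2 y = y}
  one_mem' := ⟨fun _ _ => rfl, fun _ _ => rfl⟩
  mul_mem' {g h} hg hh := ⟨fun x hx => by rw [GLInf.mul_fst_apply, hh.1 x hx, hg.1 x hx],
    fun y hy => by rw [GLInf.mul_snd_apply, hh.2 y hy, hg.2 y hy]⟩
  inv_mem' {g} hg := ⟨fun x hx => by
    conv_lhs => rw [← hg.1 x hx]
    exact GLInf.inv_fst_apply g x, fun y hy => by
    conv_lhs => rw [← hg.2 y hy]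
    exact GLInf.inv_snd_apply g y⟩

theorem mem_fixer {A₀ A₁ : Submodule F (ℕ →₀ F)} {g : GLInf F} :
    g ∈ fixer A₀ A₁ ↔ (∀ x ∈ A₀, g.1.1 x = x) ∧ ∀ y ∈ A₁, g.1.2 y = y := Iff.rfl

theorem swap_mem_fixer {A₀ A₁ : Submodule F (ℕ →₀ F)} {g : GLInf F} :
    GLInf.swap g ∈ fixer A₀ A₁ ↔ g ∈ fixer A₁ A₀ := and_comm

theorem fixer_anti {A₀ A₁ B₀ B₁ : Submodule F (ℕ →₀ F)} (h₀ : A₀ ≤ B₀) (h₁ : A₁ ≤ B₁) :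
    fixer B₀ B₁ ≤ fixer A₀ A₁ :=
  fun _ hg => ⟨fun x hx => hg.1 x (h₀ hx), fun y hy => hg.2 y (h₁ hy)⟩

theorem fixer_bot : fixer (⊥ : Submodule F (ℕ →₀ F)) ⊥ = ⊤ := by
  refine eq_top_iff.2 fun g _ => ⟨fun x hx => ?_, fun y hy => ?_⟩
  · rw [(Submodule.mem_bot F).1 hx, map_zero]
  · rw [(Submodule.mem_bot F).1 hy, map_zero]

theorem mem_fixer_sup_span {A₀ A₁ : Submodule F (ℕ →₀ F)} {g : GLInf F} {v : ℕ →₀ F}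
    (hg : g ∈ fixer A₀ A₁) (hv : g.1.1 v = v) :
    g ∈ fixer (A₀ ⊔ Submodule.span F {v}) A₁ := by
  refine ⟨fun x hx => ?_, hg.2⟩
  have : A₀ ⊔ Submodule.span F {v} ≤ LinearMap.eqLocus (g.1.1 : (ℕ →₀ F) →ₗ[F] _) LinearMap.id :=
    sup_le (fun x hx => hg.1 x hx) ((Submodule.span_singleton_le_iff_mem _ _).2 hv)
  exact this hx

theorem fixer_sup_span_left (A₀ A₁ : Submodule F (ℕ →₀ F)) (v : ℕ →₀ F) :
    fixer (A₀ ⊔ Submodule.span F {v}) A₁ =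
      fixer A₀ A₁ ⊓ MulAction.stabilizer (α := EvenPart F) (GLInf F) v := by
  refine le_antisymm (le_inf (fixer_anti le_sup_left le_rfl) fun g hg => ?_) fun g hg =>
    mem_fixer_sup_span hg.1 (MulAction.mem_stabilizer_iff.1 hg.2)
  exact MulAction.mem_stabilizer_iff.2
    (hg.1 v (le_sup_right (a := A₀) (Submodule.mem_span_singleton_self v)))

theorem fixer_sup_span_right (A₀ A₁ : Submodule F (ℕ →₀ F)) (v : ℕ →₀ F) :
    fixer A₀ (A₁ ⊔ Submodule.span F {v}) =
      fixer A₀ A₁ ⊓ MulAction.stabilizer (α := OddPart F) (GLInf F) v := by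
  ext g
  have h := SetLike.ext_iff.1 (fixer_sup_span_left A₁ A₀ v) (GLInf.swap g)
  rw [swap_mem_fixer, Subgroup.mem_inf, swap_mem_fixer] at h
  rw [h, Subgroup.mem_inf]
  rfl

variable (F) in
/-- The stabilizer of the span of the first `n` basis vectors of `𝐕₀` and of `𝐕₁`. -/
noncomputable def levelStabilizer (n : ℕ) : Subgroup (GLInf F) where
  carrier := {g | (∀ x, g.1.1 x ∈ initial F n ↔ x ∈ initial F n) ∧
    ∀ y, g.1.2 y ∈ initial F n ↔ y ∈ initial F n}
  one_mem' := ⟨fun _ => Iff.rfl, fun _ => Iff.rfl⟩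
  mul_mem' {g h} hg hh := ⟨fun x => (hg.1 _).trans (hh.1 x), fun y => (hg.2 _).trans (hh.2 y)⟩
  inv_mem' {g} hg := ⟨fun x => by rw [← hg.1, GLInf.fst_inv_apply],
    fun y => by rw [← hg.2, GLInf.snd_inv_apply]⟩

theorem swap_mem_levelStabilizer {n : ℕ} {g : GLInf F} :
    GLInf.swap g ∈ levelStabilizer F n ↔ g ∈ levelStabilizer F n := and_comm

theorem transvection_mem_fixer {A₀ A₁ : Submodule F (ℕ →₀ F)} {u w : ℕ →₀ F}
    (h : 1 + pairing u w ≠ 0) (hu : ∀ y ∈ A₁, pairing u y = 0) (hw : ∀ x ∈ A₀, pairing x w = 0) :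
    transvection u w h ∈ fixer A₀ A₁ := by
  refine ⟨fun x hx => ?_, fun y hy => ?_⟩
  · rw [transvection_fst, hw x hx, zero_smul, add_zero]
  · rw [transvection_snd, hu y hy, mul_zero, zero_smul, sub_zero]

theorem transvection_mem_levelStabilizer {n : ℕ} {u w : ℕ →₀ F}
    (h : 1 + pairing u w ≠ 0) (hu : u ∈ initial F n) (hw : w ∈ initial F n) :
    transvection u w h ∈ levelStabilizer F n := by
  refine ⟨fun x => ?_, fun y => ?_⟩
  · rw [transvection_fst, Submodule.add_mem_iff_left _ (Submodule.smul_mem _ _ hu)]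
  · rw [transvection_snd, Submodule.sub_mem_iff_left _ (Submodule.smul_mem _ _ hw)]

/-- The pointwise stabilizer of `A₀` and `A₁` acts transitively on the vectors outside `A₀` with
given pairings with `A₁`, through elements stabilizing a given finite level. -/
theorem exists_mem_fixer_map_eq {n : ℕ} {A₀ A₁ : Submodule F (ℕ →₀ F)} (hA : A₀ ≤ initial F n)
    {v v' : ℕ →₀ F} (hvn : v ∈ initial F n) (hv : v ∉ A₀) (hvn' : v' ∈ initial F n) (hv' : v' ∉ A₀)
    (h : ∀ y ∈ A₁, pairing (v' - v) y = 0) :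
    ∃ g ∈ fixer A₀ A₁, g ∈ levelStabilizer F n ∧ g.1.1 v = v' := by
  obtain ⟨w, hw, h0, h1, h2⟩ := exists_perp_pair hA hvn hv hvn' hv'
  have hc : 1 + pairing (v' - v) w ≠ 0 := by
    rwa [pairing_sub_left, h1, add_sub_cancel]
  refine ⟨transvection (v' - v) w hc, transvection_mem_fixer hc h h0,
    transvection_mem_levelStabilizer hc (sub_mem hvn' hvn) hw, ?_⟩
  rw [transvection_fst, h1, one_smul, add_sub_cancel]

theorem exists_mem_fixer_map_eq' {A₀ A₁ : Submodule F (ℕ →₀ F)} (hA : A₀.FG)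
    {v v' : ℕ →₀ F} (hv : v ∉ A₀) (hv' : v' ∉ A₀) (h : ∀ y ∈ A₁, pairing (v' - v) y = 0) :
    ∃ g ∈ fixer A₀ A₁, g.1.1 v = v' := by
  obtain ⟨n₁, h₁⟩ := exists_le_initial hA
  obtain ⟨n₂, h₂⟩ := exists_mem_initial v
  obtain ⟨n₃, h₃⟩ := exists_mem_initial v'
  have e₁ : n₁ ≤ n₁ + n₂ + n₃ := by omega
  have e₂ : n₂ ≤ n₁ + n₂ + n₃ := by omega
  have e₃ : n₃ ≤ n₁ + n₂ + n₃ := by omega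
  obtain ⟨g, hg, -, hgv⟩ := exists_mem_fixer_map_eq (h₁.trans (initial_mono e₁))
    (initial_mono e₂ h₂) hv (initial_mono e₃ h₃) hv' h
  exact ⟨g, hg, hgv⟩

theorem single_perp {n : ℕ} {A : Submodule F (ℕ →₀ F)} (hA : A ≤ initial F n) {x : ℕ →₀ F}
    (hx : x ∈ A) : pairing x (Finsupp.single n 1) = 0 := by
  rw [pairing_single_right]
  exact mem_initial.1 (hA hx) n le_rfl

theorem single_perp' {n : ℕ} {A : Submodule F (ℕ →₀ F)} (hA : A ≤ initial F n) {x : ℕ →₀ F}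
    (hx : x ∈ A) : pairing (Finsupp.single n 1) x = 0 := by
  rw [pairing_comm, single_perp hA hx]

theorem exists_le_initial₄ {A B C D : Submodule F (ℕ →₀ F)} (hA : A.FG) (hB : B.FG) (hC : C.FG)
    (hD : D.FG) : ∃ n, A ≤ initial F n ∧ B ≤ initial F n ∧ C ≤ initial F n ∧ D ≤ initial F n := by
  obtain ⟨n, hn⟩ := exists_le_initial ((hA.sup hB).sup (hC.sup hD))
  exact ⟨n, (le_sup_left.trans le_sup_left).trans hn, (le_sup_right.trans le_sup_left).trans hn,
    (le_sup_left.trans le_sup_right).trans hn, (le_sup_right.trans le_sup_right).trans hn⟩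

/-- Write T(u, w) for the transvection. Splitting u and w along the two annihilators at once would
produce mixed terms lying in neither group, so a basis index n beyond all the data is used. As e_n
and f_n are orthogonal to everything, T(u, f_n) and T(e_n, w) each factor into one element of either
group. Conjugating the second by the first gives T(e_n + u, w) = T(e_n, w) T(u, w). -/
theorem transvection_mem_sup {A₀ A₁ B₀ B₁ : Submodule F (ℕ →₀ F)} (hA₀ : A₀.FG) (hA₁ : A₁.FG)
    (hB₀ : B₀.FG) (hB₁ : B₁.FG) {u w : ℕ →₀ F} (huw : pairing u w = 0)
    (hu : ∀ y ∈ A₁ ⊓ B₁, pairing u y = 0) (hw : ∀ x ∈ A₀ ⊓ B₀, pairing x w = 0) :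
    transvection u w (one_add_pairing_ne_zero huw) ∈ fixer A₀ A₁ ⊔ fixer B₀ B₁ := by
  obtain ⟨m, a1, a2, a3, a4⟩ := exists_le_initial₄ hA₀ hA₁ hB₀ hB₁
  obtain ⟨m₁, hm₁⟩ := exists_mem_initial u
  obtain ⟨m₂, hm₂⟩ := exists_mem_initial w
  obtain ⟨n, e, e₁, e₂⟩ : ∃ n, m ≤ n ∧ m₁ ≤ n ∧ m₂ ≤ n := ⟨m + m₁ + m₂, by omega, by omega, by omega⟩
  replace a1 := a1.trans (initial_mono e)
  replace a2 := a2.trans (initial_mono e)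
  replace a3 := a3.trans (initial_mono e)
  replace a4 := a4.trans (initial_mono e)
  have hun := initial_mono e₁ hm₁
  have hwn := initial_mono e₂ hm₂
  obtain ⟨a, han, haA, haB⟩ := exists_perp_decomp a2 a4
    fun x hx => (pairing_comm _ _).trans (hu x hx)
  obtain ⟨b, hbn, hbA, hbB⟩ := exists_perp_decomp a1 a3 hw
  have fN : ∀ {x : ℕ →₀ F}, x ∈ initial F n → pairing x (Finsupp.single n 1) = 0 :=
    fun hx => single_perp le_rfl hx
  have eN : ∀ {x : ℕ →₀ F}, x ∈ initial F n → pairing (Finsupp.single n 1) x = 0 :=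
    fun hx => single_perp' le_rfl hx
  have k1 : transvection u (Finsupp.single n 1) (one_add_pairing_ne_zero (fN hun)) ∈
      fixer A₀ A₁ ⊔ fixer B₀ B₁ := by
    have hs := transvection_add_left (fN han) (fN (sub_mem hun han))
    simp only [add_sub_cancel] at hs
    rw [hs]
    refine mul_mem (Subgroup.mem_sup_left (transvection_mem_fixer _ (fun y hy => ?_)
      fun x hx => single_perp a1 hx)) (Subgroup.mem_sup_right (transvection_mem_fixer _
      (fun y hy => ?_) fun x hx => single_perp a3 hx))
    · rw [pairing_comm, haA y hy]
    · rw [pairing_comm, haB y hy]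
  have k2 : transvection (Finsupp.single n 1) w (one_add_pairing_ne_zero (eN hwn)) ∈
      fixer A₀ A₁ ⊔ fixer B₀ B₁ := by
    have hs := transvection_add_right (eN hbn) (eN (sub_mem hwn hbn))
    simp only [add_sub_cancel] at hs
    rw [hs]
    exact mul_mem (Subgroup.mem_sup_left (transvection_mem_fixer _
      (fun y hy => single_perp' a2 hy) hbA)) (Subgroup.mem_sup_right (transvection_mem_fixer _
      (fun y hy => single_perp' a4 hy) hbB))
  have k3 := mul_mem (mul_mem k1 k2) (inv_mem k1)
  rw [conj_transvection] at k3
  have e1 : (transvection u (Finsupp.single n 1) (one_add_pairing_ne_zero (fN hun))).1.1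
      (Finsupp.single n 1) = Finsupp.single n 1 + u := by
    rw [transvection_fst, pairing_single_left, Finsupp.single_eq_same, one_smul]
  have e2 : (transvection u (Finsupp.single n 1) (one_add_pairing_ne_zero (fN hun))).1.2 w = w := by
    rw [transvection_snd, huw, mul_zero, zero_smul, sub_zero]
  simp only [e1, e2] at k3
  rw [transvection_add_left (eN hwn) huw] at k3
  exact (Subgroup.mul_mem_cancel_left _ k2).1 k3

/-- It suffices to carry `v` to `g v` by an element of `K` fixing `D` and `A₁`, for the discrepancy
then also fixes `v`. One transvection with orthogonal direction and functional may not do this, so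
both vectors are moved to the common point v + e_n, with n a fresh index. -/
theorem fixer_le_of_transvection_mem_span {K : Subgroup (GLInf F)} {C₀ C₁ : Submodule F (ℕ →₀ F)}
    (hK : ∀ (u w : ℕ →₀ F) (huw : pairing u w = 0), (∀ y ∈ C₁, pairing u y = 0) →
      (∀ x ∈ C₀, pairing x w = 0) → transvection u w (one_add_pairing_ne_zero huw) ∈ K)
    {D A₁ : Submodule F (ℕ →₀ F)} (hD : D.FG) (hA₁ : A₁.FG) (hC₀ : C₀ ≤ D) (hC₁ : C₁ ≤ A₁)
    (v : ℕ →₀ F) (h : fixer (D ⊔ Submodule.span F {v}) A₁ ≤ K) : fixer D A₁ ≤ K := by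
  intro g hg
  suffices hs : ∃ k ∈ K, k ∈ fixer D A₁ ∧ k.1.1 v = g.1.1 v by
    obtain ⟨k, hk, hkD, hkv⟩ := hs
    refine (Subgroup.mul_mem_cancel_left K (inv_mem hk)).1 (h (mem_fixer_sup_span
      (mul_mem (inv_mem hkD) hg) ?_))
    rw [GLInf.mul_fst_apply, ← hkv, GLInf.inv_fst_apply]
  by_cases hv : v ∈ D
  · exact ⟨1, one_mem _, one_mem _, (hg.1 v hv).symm⟩
  have hv' : g.1.1 v ∉ D := fun hgv => hv <| by
    have := hg.1 _ hgv
    rwa [g.1.1.injective this] at hgv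
  have hS : ∀ x : ℕ →₀ F, (Submodule.span F {x}).FG := fun x => Submodule.fg_span_singleton x
  obtain ⟨n, h1, h2, h3, h4⟩ := exists_le_initial₄ hD hA₁ (hS v) (hS (g.1.1 v))
  rw [Submodule.span_singleton_le_iff_mem] at h3 h4
  have eN : ∀ {x : ℕ →₀ F}, x ∈ initial F n → pairing (Finsupp.single n 1) x = 0 :=
    fun hx => single_perp' le_rfl hx
  have fN : ∀ {x : ℕ →₀ F}, x ∈ initial F n → pairing x (Finsupp.single n 1) = 0 :=
    fun hx => single_perp le_rfl hx
  obtain ⟨w, hw, hwD, hwv⟩ := exists_perp h1 h3 hv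
  obtain ⟨w', hw', hwD', hwv'⟩ := exists_perp h1 h4 hv'
  have hgp : ∀ y ∈ A₁, pairing (g.1.1 v) y = pairing v y := fun y hy => by
    conv_lhs => rw [← hg.2 y hy]
    exact GLInf.pairing_map g v y
  let u' : ℕ →₀ F := v + Finsupp.single n 1 - g.1.1 v
  -- The coefficient of f_n makes w'' orthogonal to u' and leaves its pairings with `D` and with `g
  -- v` as they were for w'.
  let w'' : ℕ →₀ F := w' + (1 - pairing v w') • Finsupp.single n 1
  have hu' : ∀ y ∈ A₁, pairing u' y = 0 := fun y hy => by
    simp only [u', pairing_sub_left, pairing_add_left, hgp y hy, eN (h2 hy), add_zero, sub_self]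
  have hw'' : ∀ x ∈ D, pairing x w'' = 0 := fun x hx => by
    simp only [w'', pairing_add_right, pairing_smul_right, hwD' x hx, fN (h1 hx), mul_zero,
      add_zero]
  have hgw : pairing (g.1.1 v) w'' = 1 := by
    simp only [w'', pairing_add_right, pairing_smul_right, hwv', fN h4, mul_zero, add_zero]
  have huw : pairing u' w'' = 0 := by
    simp only [u', pairing_sub_left, hgw]
    simp only [w'', pairing_add_left, pairing_add_right, pairing_smul_right, fN h3, eN hw',
      pairing_single_left, Finsupp.single_eq_same]
    ring
  have m1 : transvection (Finsupp.single n 1) w (one_add_pairing_ne_zero (eN hw)) ∈ K ⊓ fixer D A₁ :=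
    ⟨hK _ _ (eN hw) (fun y hy => eN (h2 (hC₁ hy))) fun x hx => hwD x (hC₀ hx),
      transvection_mem_fixer _ (fun y hy => eN (h2 hy)) hwD⟩
  have m2 : transvection u' w'' (one_add_pairing_ne_zero huw) ∈ K ⊓ fixer D A₁ :=
    ⟨hK _ _ huw (fun y hy => hu' y (hC₁ hy)) fun x hx => hw'' x (hC₀ hx),
      transvection_mem_fixer _ hu' hw''⟩
  have m3 := mul_mem (inv_mem m2) m1
  refine ⟨_, m3.1, m3.2, ?_⟩
  have e1 : (transvection (Finsupp.single n 1) w (one_add_pairing_ne_zero (eN hw))).1.1 v =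
      (transvection u' w'' (one_add_pairing_ne_zero huw)).1.1 (g.1.1 v) := by
    rw [transvection_fst, transvection_fst, hwv, hgw, one_smul, one_smul]
    simp only [u']
    abel
  rw [GLInf.mul_fst_apply, e1, GLInf.inv_fst_apply]

theorem fixer_le_of_transvection_mem_left {K : Subgroup (GLInf F)}
    {C₀ C₁ : Submodule F (ℕ →₀ F)}
    (hK : ∀ (u w : ℕ →₀ F) (huw : pairing u w = 0), (∀ y ∈ C₁, pairing u y = 0) →
      (∀ x ∈ C₀, pairing x w = 0) → transvection u w (one_add_pairing_ne_zero huw) ∈ K)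
    {D A₁ : Submodule F (ℕ →₀ F)} (hD : D.FG) (hA₁ : A₁.FG) (hC₀ : C₀ ≤ D) (hC₁ : C₁ ≤ A₁)
    {B : Submodule F (ℕ →₀ F)} (hB : B.FG) (h : fixer (D ⊔ B) A₁ ≤ K) : fixer D A₁ ≤ K := by
  induction B, hB using Submodule.fg_induction generalizing D with
  | singleton v => exact fixer_le_of_transvection_mem_span hK hD hA₁ hC₀ hC₁ v h
  | sup M N hM hN ihM ihN =>
    refine ihM hD hC₀ (ihN (hD.sup hM) (hC₀.trans le_sup_left) ?_)
    rwa [sup_assoc]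

/-- Modulo the stabilizer of the larger pair, transvections generate the stabilizer of the smaller
one. The two subspaces are enlarged one after the other, the odd one by way of `GLInf.swap`. -/
theorem fixer_le_of_transvection_mem {K : Subgroup (GLInf F)}
    {C₀ C₁ : Submodule F (ℕ →₀ F)} (hC₀ : C₀.FG) (hC₁ : C₁.FG)
    (hK : ∀ (u w : ℕ →₀ F) (huw : pairing u w = 0), (∀ y ∈ C₁, pairing u y = 0) →
      (∀ x ∈ C₀, pairing x w = 0) → transvection u w (one_add_pairing_ne_zero huw) ∈ K)
    {A₀ A₁ : Submodule F (ℕ →₀ F)} (hA₀ : A₀.FG) (hA₁ : A₁.FG) (h₀ : C₀ ≤ A₀) (h₁ : C₁ ≤ A₁)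
    (h : fixer A₀ A₁ ≤ K) : fixer C₀ C₁ ≤ K := by
  have s1 : fixer C₀ A₁ ≤ K := fixer_le_of_transvection_mem_left hK hC₀ hA₁ le_rfl h₁ hA₀
    (by rwa [sup_eq_right.2 h₀])
  have hK' : ∀ (u w : ℕ →₀ F) (huw : pairing u w = 0), (∀ y ∈ C₀, pairing u y = 0) →
      (∀ x ∈ C₁, pairing x w = 0) → transvection u w (one_add_pairing_ne_zero huw) ∈
        K.comap GLInf.swap.toMonoidHom := by
    intro u w huw hu hw
    rw [Subgroup.mem_comap, MulEquiv.toMonoidHom_eq_coe, MonoidHom.coe_coe, swap_transvection huw]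
    refine hK w (-u) (by rw [pairing_neg_right, pairing_comm, huw, neg_zero]) (fun y hy => ?_) fun x hx => ?_
    · rw [pairing_comm, hw y hy]
    · rw [pairing_neg_right, pairing_comm, hu x hx, neg_zero]
  have s2 : fixer C₁ C₀ ≤ K.comap GLInf.swap.toMonoidHom := by
    refine fixer_le_of_transvection_mem_left hK' hC₁ hC₀ le_rfl le_rfl hA₁ fun g hg => ?_
    rw [sup_eq_right.2 h₁] at hg
    rw [Subgroup.mem_comap, MulEquiv.toMonoidHom_eq_coe, MonoidHom.coe_coe]
    exact s1 (swap_mem_fixer.2 hg)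
  intro g hg
  have h2 := s2 (swap_mem_fixer.2 hg)
  rwa [Subgroup.mem_comap, MulEquiv.toMonoidHom_eq_coe, MonoidHom.coe_coe, GLInf.swap_swap] at h2

/-- This makes the set of pairs whose stabilizer lies in a given open subgroup closed under
intersection, whence the existence of supports. -/
theorem fixer_inf_le {A₀ A₁ B₀ B₁ : Submodule F (ℕ →₀ F)} (hA₀ : A₀.FG) (hA₁ : A₁.FG)
    (hB₀ : B₀.FG) (hB₁ : B₁.FG) :
    fixer (A₀ ⊓ B₀) (A₁ ⊓ B₁) ≤ fixer A₀ A₁ ⊔ fixer B₀ B₁ :=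
  fixer_le_of_transvection_mem (hA₀.of_le inf_le_left) (hA₁.of_le inf_le_left)
    (fun _ _ huw hu hw => transvection_mem_sup hA₀ hA₁ hB₀ hB₁ huw hu hw) hA₀ hA₁ inf_le_left
    inf_le_left le_sup_left

end Fixer

/-! ### Supports of open subgroups and extension of partial isomorphisms. -/

section Support

variable {F : Type u} [Field F]

theorem isOpenSubgroup_fixer {A₀ A₁ : Submodule F (ℕ →₀ F)} (h₀ : A₀.FG) (h₁ : A₁.FG) :
    IsOpenSubgroup (InfSpace F) (fixer A₀ A₁) := by
  obtain ⟨s, rfl⟩ := h₀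
  obtain ⟨t, rfl⟩ := h₁
  refine ⟨(fun x => (x, oddZero F)) '' (s : Set (ℕ →₀ F)) ∪
    (fun y => (evenZero F, y)) '' (t : Set (ℕ →₀ F)),
    (s.finite_toSet.image _).union (t.finite_toSet.image _), fun g hg => ?_⟩
  rw [mem_fixingSubgroup_iff] at hg
  have e₀ : Submodule.span F (s : Set (ℕ →₀ F)) ≤
      LinearMap.eqLocus (g.1.1 : (ℕ →₀ F) →ₗ[F] _) LinearMap.id :=
    Submodule.span_le.2 fun x hx => congrArg Prod.fst (hg (x, oddZero F) (Or.inl ⟨x, hx, rfl⟩))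
  have e₁ : Submodule.span F (t : Set (ℕ →₀ F)) ≤
      LinearMap.eqLocus (g.1.2 : (ℕ →₀ F) →ₗ[F] _) LinearMap.id :=
    Submodule.span_le.2 fun y hy => congrArg Prod.snd (hg (evenZero F, y) (Or.inr ⟨y, hy, rfl⟩))
  exact ⟨fun x hx => e₀ hx, fun y hy => e₁ hy⟩

theorem exists_fixer_le {U : Subgroup (GLInf F)} (hU : IsOpenSubgroup (InfSpace F) U) :
    ∃ A₀ A₁ : Submodule F (ℕ →₀ F), A₀.FG ∧ A₁.FG ∧ fixer A₀ A₁ ≤ U := by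
  obtain ⟨A, hA, hAU⟩ := hU
  refine ⟨Submodule.span F (Prod.fst '' A), Submodule.span F (Prod.snd '' A),
    Submodule.fg_span (hA.image _), Submodule.fg_span (hA.image _), fun g hg => hAU ?_⟩
  rw [mem_fixingSubgroup_iff]
  exact fun a ha => Prod.ext (hg.1 _ (Submodule.subset_span ⟨a, ha, rfl⟩))
    (hg.2 _ (Submodule.subset_span ⟨a, ha, rfl⟩))

theorem levelSubgroup_eq_fixer (n : ℕ) :
    levelSubgroup F n = fixer (initial F n) (initial F n) := by
  refine le_antisymm (fun g hg => ?_) fun g hg => ?_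
  · rw [levelSubgroup, mem_fixingSubgroup_iff] at hg
    have e₀ : initial F n ≤ LinearMap.eqLocus (g.1.1 : (ℕ →₀ F) →ₗ[F] _) LinearMap.id := by
      rw [initial_eq_span]
      refine Submodule.span_le.2 ?_
      rintro - ⟨i, hi, rfl⟩
      exact congrArg Prod.fst (hg (evenBasis F i, oddZero F) (Or.inl ⟨i, hi, rfl⟩))
    have e₁ : initial F n ≤ LinearMap.eqLocus (g.1.2 : (ℕ →₀ F) →ₗ[F] _) LinearMap.id := by
      rw [initial_eq_span]
      refine Submodule.span_le.2 ?_
      rintro - ⟨i, hi, rfl⟩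
      exact congrArg Prod.snd (hg (evenZero F, oddBasis F i) (Or.inr ⟨i, hi, rfl⟩))
    exact ⟨fun x hx => e₀ hx, fun y hy => e₁ hy⟩
  · rw [levelSubgroup, mem_fixingSubgroup_iff]
    rintro - (⟨i, hi, rfl⟩ | ⟨i, hi, rfl⟩)
    · exact Prod.ext (hg.1 _ (single_mem_initial hi 1)) (map_zero g.1.2)
    · exact Prod.ext (map_zero g.1.1) (hg.2 _ (single_mem_initial hi 1))

theorem mem_fixer_map {A₀ A₁ : Submodule F (ℕ →₀ F)} {g h : GLInf F} :
    h ∈ fixer (A₀.map (g.1.1 : (ℕ →₀ F) →ₗ[F] (ℕ →₀ F)))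
      (A₁.map (g.1.2 : (ℕ →₀ F) →ₗ[F] (ℕ →₀ F))) ↔ g⁻¹ * h * g ∈ fixer A₀ A₁ := by
  have k₀ : ∀ x y, (g⁻¹).1.1 x = y ↔ x = g.1.1 y := fun x y => g.1.1.symm_apply_eq
  have k₁ : ∀ x y, (g⁻¹).1.2 x = y ↔ x = g.1.2 y := fun x y => g.1.2.symm_apply_eq
  simp only [mem_fixer, Submodule.mem_map, forall_exists_index, and_imp,
    forall_apply_eq_imp_iff₂, GLInf.mul_fst_apply, GLInf.mul_snd_apply, LinearEquiv.coe_coe, k₀, k₁]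

/-- `(A₀, A₁)` is the smallest pair of finite-dimensional subspaces whose pointwise stabilizer is
contained in `U`. -/
structure IsSupport (U : Subgroup (GLInf F)) (A₀ A₁ : Submodule F (ℕ →₀ F)) : Prop where
  fg₀ : A₀.FG
  fg₁ : A₁.FG
  fixer_le : fixer A₀ A₁ ≤ U
  min : ∀ {B₀ B₁ : Submodule F (ℕ →₀ F)}, B₀.FG → B₁.FG → fixer B₀ B₁ ≤ U → A₀ ≤ B₀ ∧ A₁ ≤ B₁

/-- Take a pair of least total dimension. Its intersection with any other admissible pair is
admissible by `fixer_inf_le`, so by minimality nothing is lost in intersecting. -/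
theorem exists_isSupport {U : Subgroup (GLInf F)} (hU : IsOpenSubgroup (InfSpace F) U) :
    ∃ A₀ A₁, IsSupport U A₀ A₁ := by
  obtain ⟨B₀, B₁, hB₀, hB₁, hBU⟩ := exists_fixer_le hU
  let P : ℕ → Prop := fun d => ∃ A₀ A₁ : Submodule F (ℕ →₀ F), A₀.FG ∧ A₁.FG ∧ fixer A₀ A₁ ≤ U ∧
    Module.finrank F A₀ + Module.finrank F A₁ = d
  have hP : ∃ d, P d := ⟨_, B₀, B₁, hB₀, hB₁, hBU, rfl⟩
  classical
  obtain ⟨A₀, A₁, hA₀, hA₁, hAU, hd⟩ := Nat.find_spec hP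
  refine ⟨A₀, A₁, hA₀, hA₁, hAU, fun {C₀ C₁} hC₀ hC₁ hCU => ?_⟩
  have f₀ : (A₀ ⊓ C₀).FG := hA₀.of_le inf_le_left
  have f₁ : (A₁ ⊓ C₁).FG := hA₁.of_le inf_le_left
  have hmin := Nat.find_min' hP ⟨A₀ ⊓ C₀, A₁ ⊓ C₁, f₀, f₁,
    (fixer_inf_le hA₀ hA₁ hC₀ hC₁).trans (sup_le hAU hCU), rfl⟩
  rw [← hd] at hmin
  have i₀ : Module.Finite F A₀ := Module.Finite.iff_fg.2 hA₀
  have i₁ : Module.Finite F A₁ := Module.Finite.iff_fg.2 hA₁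
  have l₀ := Submodule.finrank_mono (inf_le_left : A₀ ⊓ C₀ ≤ A₀)
  have l₁ := Submodule.finrank_mono (inf_le_left : A₁ ⊓ C₁ ≤ A₁)
  exact ⟨inf_eq_left.1 (Submodule.eq_of_le_of_finrank_eq inf_le_left (by omega)),
    inf_eq_left.1 (Submodule.eq_of_le_of_finrank_eq inf_le_left (by omega))⟩

/-- A vector a outside `B₀` can be moved to a + e_n, with n a fresh index, by an element fixing `B₀`
and `B₁`. -/
theorem le_of_fixer_le_left {A₀ A₁ B₀ B₁ : Submodule F (ℕ →₀ F)} (hB₀ : B₀.FG) (hB₁ : B₁.FG)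
    (h : fixer B₀ B₁ ≤ fixer A₀ A₁) : A₀ ≤ B₀ := by
  intro a ha
  by_contra hb
  obtain ⟨n, h1, h2, h3, -⟩ := exists_le_initial₄ hB₀ hB₁ (Submodule.fg_span_singleton a) hB₀
  rw [Submodule.span_singleton_le_iff_mem] at h3
  have hb' : a + Finsupp.single n 1 ∉ B₀ := fun hc => by
    have := mem_initial.1 (h1 hc) n le_rfl
    rw [Finsupp.add_apply, mem_initial.1 h3 n le_rfl] at this
    simp at this
  obtain ⟨g, hg, hga⟩ := exists_mem_fixer_map_eq' (A₁ := B₁) hB₀ hb hb' fun y hy => by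
    rw [add_sub_cancel_left, single_perp' h2 hy]
  have h4 := (h hg).1 a ha
  rw [hga, add_eq_left] at h4
  simp at h4

theorem isSupport_fixer {A₀ A₁ : Submodule F (ℕ →₀ F)} (h₀ : A₀.FG) (h₁ : A₁.FG) :
    IsSupport (fixer A₀ A₁) A₀ A₁ where
  fg₀ := h₀
  fg₁ := h₁
  fixer_le := le_rfl
  min hB₀ hB₁ h := ⟨le_of_fixer_le_left hB₀ hB₁ h, le_of_fixer_le_left hB₁ hB₀ fun _ hg =>
    swap_mem_fixer.1 (h (swap_mem_fixer.2 hg))⟩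

/-- Witt-type extension, one generator at a time: if σ agrees with g on `D`, it is corrected by a
transvection of the level that fixes `D` and `A₁` and carries `v` to σ⁻¹ g v. -/
theorem exists_levelStabilizer_extend_left {n : ℕ} {A₁ B : Submodule F (ℕ →₀ F)} (hB : B.FG) :
    ∀ {D : Submodule F (ℕ →₀ F)}, D ≤ initial F n → B ≤ initial F n →
    ∀ {g : GLInf F}, (∀ x ∈ B, g.1.1 x ∈ initial F n) →
    (∃ σ ∈ levelStabilizer F n, g⁻¹ * σ ∈ fixer D A₁) →
    ∃ σ ∈ levelStabilizer F n, g⁻¹ * σ ∈ fixer (D ⊔ B) A₁ := by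
  induction B, hB using Submodule.fg_induction with
  | singleton v =>
    rintro D hD hB g hgB ⟨σ, hσ, hσD⟩
    rw [Submodule.span_singleton_le_iff_mem] at hB
    by_cases hv : v ∈ D
    · refine ⟨σ, hσ, ?_⟩
      rwa [sup_eq_left.2 ((Submodule.span_singleton_le_iff_mem _ _).2 hv)]
    have hτ : σ⁻¹ * g ∈ fixer D A₁ := by simpa using inv_mem hσD
    have hv' : (σ⁻¹ * g).1.1 v ∉ D := fun hgv => hv <| by
      have := hτ.1 _ hgv
      rwa [(σ⁻¹ * g).1.1.injective this] at hgv
    obtain ⟨T, hT, hTn, hTv⟩ := exists_mem_fixer_map_eq (A₁ := A₁) hD hB hv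
      (((inv_mem hσ).1 _).2 (hgB v (Submodule.mem_span_singleton_self v))) hv' fun y hy => by
        rw [pairing_sub_left, sub_eq_zero]
        conv_lhs => rw [← hτ.2 y hy]
        exact GLInf.pairing_map (σ⁻¹ * g) v y
    refine ⟨σ * T, mul_mem hσ hTn, mem_fixer_sup_span ?_ ?_⟩
    · rw [← mul_assoc]
      exact mul_mem hσD hT
    · have e : g⁻¹ * (σ * T) = (σ⁻¹ * g)⁻¹ * T := by group
      rw [e, GLInf.mul_fst_apply, hTv]
      exact GLInf.inv_fst_apply (σ⁻¹ * g) v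
  | sup M N hM hN ihM ihN =>
    intro D hD hB g hgB h
    rw [← sup_assoc]
    exact ihN (sup_le hD (le_sup_left.trans hB)) (le_sup_right.trans hB)
      (fun x hx => hgB x (le_sup_right (a := M) hx))
      (ihM hD (le_sup_left.trans hB) (fun x hx => hgB x (le_sup_left (a := M) hx)) h)

/-- A partial isomorphism between graded subspaces of a finite level that is induced by some group
element is induced by one stabilizing that level. -/
theorem exists_levelStabilizer_extend {n : ℕ} {A₀ A₁ : Submodule F (ℕ →₀ F)}
    (h₀ : A₀ ≤ initial F n) (h₁ : A₁ ≤ initial F n) {g : GLInf F}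
    (hg₀ : ∀ x ∈ A₀, g.1.1 x ∈ initial F n) (hg₁ : ∀ y ∈ A₁, g.1.2 y ∈ initial F n) :
    ∃ σ ∈ levelStabilizer F n, g⁻¹ * σ ∈ fixer A₀ A₁ := by
  have fg : ∀ {A : Submodule F (ℕ →₀ F)}, A ≤ initial F n → A.FG := fun h =>
    Submodule.FG.of_le (Module.Finite.iff_fg.1 (finite_initial n)) h
  obtain ⟨σ, hσ, hσ'⟩ := exists_levelStabilizer_extend_left (n := n) (A₁ := ⊥) (fg h₀) bot_le h₀ hg₀
    ⟨1, one_mem _, by rw [fixer_bot]; trivial⟩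
  rw [bot_sup_eq] at hσ'
  -- The second pass works on the odd side; the agreement on `A₀` already obtained is kept as the
  -- constraint on the other side.
  obtain ⟨τ, hτ, hτ'⟩ := exists_levelStabilizer_extend_left (n := n) (A₁ := A₀) (D := ⊥)
    (g := GLInf.swap g) (fg h₁) bot_le h₁ hg₁
    ⟨GLInf.swap σ, swap_mem_levelStabilizer.2 hσ, swap_mem_fixer.1 hσ'⟩
  rw [bot_sup_eq] at hτ'
  exact ⟨GLInf.swap τ, swap_mem_levelStabilizer.2 hτ, swap_mem_fixer.2 hτ'⟩

end Support

/-! ### Maps out of homogeneous sets and the measure axioms for fibre cardinalities. -/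

section Homs

variable {G Ω : Type u} [Group G] [MulAction G Ω]

/-- The equivariant map `G/V → X` sending the base point to a point fixed by `V`. -/
def cosetHom {V : Subgroup G} (hV : IsOpenSubgroup Ω V) {X : Type u} [MulAction G X] (x : X)
    (h : V ≤ MulAction.stabilizer G x) : TransGSet.coset V hV →[G] X where
  toFun := Quotient.lift (fun g : G => g • x) fun a b hab => by
    have := h (QuotientGroup.leftRel_apply.1 hab)
    rw [MulAction.mem_stabilizer_iff, mul_smul, inv_smul_eq_iff] at this
    exact this.symm
  map_smul' g z := by
    induction z using QuotientGroup.induction_on with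
    | H a => exact mul_smul g a x

/-- The base point of `G/V`. -/
def TransGSet.base {V : Subgroup G} (hV : IsOpenSubgroup Ω V) : TransGSet.coset V hV :=
  ((1 : G) : G ⧸ V)

theorem TransGSet.smul_base {V : Subgroup G} (hV : IsOpenSubgroup Ω V) (g : G) :
    g • TransGSet.base hV = ((g : G ⧸ V) : TransGSet.coset V hV) :=
  congrArg (fun a : G => (a : G ⧸ V)) (mul_one g)

theorem TransGSet.smul_base_eq_iff {V : Subgroup G} (hV : IsOpenSubgroup Ω V) (g h : G) :
    g • TransGSet.base hV = h • TransGSet.base hV ↔ g⁻¹ * h ∈ V := by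
  rw [smul_base, smul_base]
  exact QuotientGroup.eq

theorem TransGSet.exists_smul_base {V : Subgroup G} (hV : IsOpenSubgroup Ω V)
    (z : TransGSet.coset V hV) : ∃ g : G, z = g • TransGSet.base hV := by
  induction z using QuotientGroup.induction_on with
  | H a => exact ⟨a, (smul_base hV a).symm⟩

theorem TransGSet.stabilizer_base {V : Subgroup G} (hV : IsOpenSubgroup Ω V) :
    MulAction.stabilizer G (TransGSet.base hV) = V := by
  ext g
  rw [MulAction.mem_stabilizer_iff, eq_comm]
  conv_lhs => lhs; rw [← one_smul G (TransGSet.base hV)]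
  rw [smul_base_eq_iff, inv_one, one_mul]

theorem cosetHom_smul_base {V : Subgroup G} (hV : IsOpenSubgroup Ω V) {X : Type u} [MulAction G X]
    (x : X) (h : V ≤ MulAction.stabilizer G x) (g : G) :
    cosetHom hV x h (g • TransGSet.base hV) = g • x := by
  rw [TransGSet.smul_base]; rfl

theorem cosetHom_base {V : Subgroup G} (hV : IsOpenSubgroup Ω V) {X : Type u} [MulAction G X]
    (x : X) (h : V ≤ MulAction.stabilizer G x) :
    cosetHom hV x h (TransGSet.base hV) = x := by
  simpa using cosetHom_smul_base hV x h 1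

theorem coset_hom_ext {V : Subgroup G} {hV : IsOpenSubgroup Ω V} {X : Type u} [MulAction G X]
    {f g : TransGSet.coset V hV →[G] X}
    (h : f (TransGSet.base hV) = g (TransGSet.base hV)) : f = g := by
  ext z
  obtain ⟨a, rfl⟩ := TransGSet.exists_smul_base hV z
  rw [map_smul, map_smul, h]

theorem le_stabilizer_apply_base {V : Subgroup G} (hV : IsOpenSubgroup Ω V) {X : Type u}
    [MulAction G X] (f : TransGSet.coset V hV →[G] X) :
    V ≤ MulAction.stabilizer G (f (TransGSet.base hV)) := fun g hg => by
  rw [MulAction.mem_stabilizer_iff, ← map_smul]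
  rw [← TransGSet.stabilizer_base hV] at hg
  rw [MulAction.mem_stabilizer_iff.1 hg]

theorem cosetMap_base {W U : Subgroup G} (hW : IsOpenSubgroup Ω W) (hU : IsOpenSubgroup Ω U)
    (h : W ≤ U) : cosetMap hW hU h (TransGSet.base hW) = TransGSet.base hU := rfl

theorem cosetMap_smul_base {W U : Subgroup G} (hW : IsOpenSubgroup Ω W) (hU : IsOpenSubgroup Ω U)
    (h : W ≤ U) (g : G) :
    cosetMap hW hU h (g • TransGSet.base hW) = g • TransGSet.base hU := by
  rw [map_smul, cosetMap_base]

theorem hom_surjective {Y X : TransGSet G Ω} (f : Y →[G] X) : Function.Surjective f := by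
  intro x
  obtain ⟨y⟩ := Y.nonempty
  obtain ⟨g, hg⟩ := MulAction.exists_smul_eq G (f y) x
  exact ⟨g • y, by rw [map_smul, hg]⟩

/-- Precomposition with an automorphism of Δ carrying one base map to the other identifies the
fibres, so the choice made in `fibreCard` is immaterial. -/
theorem card_fibre_eq {Δ : TransGSet G Ω} (hΔ : IsHomogeneous Δ) {Y X : TransGSet G Ω}
    (f : Y →[G] X) (h : Δ →[G] X) :
    Nat.card {g : Δ →[G] Y // f.comp g = h} = fibreCard Δ f := by
  have hne : Nonempty (Δ →[G] X) := ⟨h⟩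
  rw [fibreCard, dif_pos hne]
  obtain ⟨σ, hσ, hσh⟩ := hΔ X h hne.some
  obtain ⟨τ, hτl, hτr⟩ := Function.bijective_iff_has_inverse.1 hσ
  let τ' : Δ →[G] Δ := σ.inverse τ hτl hτr
  refine Nat.card_congr (Equiv.ofBijective
    (fun g => ⟨g.1.comp σ, (congrArg (fun a => a.comp σ) g.2).trans hσh⟩) ⟨fun a b hab => ?_, fun b => ?_⟩)
  · refine Subtype.ext (MulActionHom.ext fun d => ?_)
    obtain ⟨d, rfl⟩ := hσ.2 d
    exact DFunLike.congr_fun (congrArg Subtype.val hab) d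
  · refine ⟨⟨b.1.comp τ', MulActionHom.ext fun d => ?_⟩, Subtype.ext (MulActionHom.ext fun d => ?_)⟩
    · have h1 := DFunLike.congr_fun (b.2.trans hσh.symm) (τ d)
      change f (b.1 (τ d)) = h (σ (τ d)) at h1
      rw [hτr d] at h1
      exact h1
    · exact congrArg b.1 (hτl d)

theorem card_hom_eq_mul {Δ : TransGSet G Ω} (hΔ : IsHomogeneous Δ)
    (hfin : ∀ X : TransGSet G Ω, Finite (Δ →[G] X)) {Y X : TransGSet G Ω} (f : Y →[G] X) :
    Nat.card (Δ →[G] Y) = Nat.card (Δ →[G] X) * fibreCard Δ f := by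
  have := Fintype.ofFinite (Δ →[G] X)
  have e := Equiv.sigmaFiberEquiv (fun g : Δ →[G] Y => f.comp g)
  rw [← Nat.card_congr e, Nat.card_sigma, Finset.sum_congr rfl fun h _ => card_fibre_eq hΔ f h]
  simp

theorem fibreCard_of_bijective {Δ : TransGSet G Ω} {Y X : TransGSet G Ω}
    (f : Y →[G] X) (hf : Function.Bijective f) (h : Nonempty (Δ →[G] X)) : fibreCard Δ f = 1 := by
  rw [fibreCard, dif_pos h]
  obtain ⟨τ, hτl, hτr⟩ := Function.bijective_iff_has_inverse.1 hf
  let τ' : X →[G] Y := f.inverse τ hτl hτr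
  rw [Nat.card_eq_one_iff_unique]
  refine ⟨⟨fun a b => Subtype.ext (MulActionHom.ext fun d => hf.1 ?_)⟩,
    ⟨⟨τ'.comp h.some, MulActionHom.ext fun d => hτr _⟩⟩⟩
  exact DFunLike.congr_fun (a.2.trans b.2.symm) d

theorem fibreCard_comp {Δ : TransGSet G Ω} (hΔ : IsHomogeneous Δ)
    (hfin : ∀ X : TransGSet G Ω, Finite (Δ →[G] X)) {Z Y X : TransGSet G Ω} (f : Y →[G] X)
    (g : Z →[G] Y) : fibreCard Δ (f.comp g) = fibreCard Δ f * fibreCard Δ g := by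
  by_cases hX : Nonempty (Δ →[G] X)
  · obtain ⟨h⟩ := hX
    have := Fintype.ofFinite {a : Δ →[G] Y // f.comp a = h}
    rw [← card_fibre_eq hΔ f h, ← card_fibre_eq hΔ (f.comp g) h]
    have e : {c : Δ →[G] Z // (f.comp g).comp c = h} ≃
        Σ a : {a : Δ →[G] Y // f.comp a = h}, {c : Δ →[G] Z // g.comp c = a.1} :=
      { toFun := fun c => ⟨⟨g.comp c.1, c.2⟩, ⟨c.1, rfl⟩⟩
        invFun := fun p => ⟨p.2.1,
          (congrArg (fun a => f.comp a) p.2.2 : f.comp (g.comp p.2.1) = f.comp p.1.1).trans p.1.2⟩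
        left_inv := fun _ => rfl
        right_inv := by
          rintro ⟨⟨a, ha⟩, ⟨c, hc⟩⟩
          obtain rfl : g.comp c = a := hc
          rfl }
    rw [Nat.card_congr e, Nat.card_sigma, Finset.sum_congr rfl fun a _ => card_fibre_eq hΔ g a.1]
    simp
  · rw [fibreCard, dif_neg hX, fibreCard, dif_neg hX, zero_mul]

/-- A map from the transitive set Δ to the fibre product lands in a single orbit, so the lifts to
`Y` are the disjoint union of the lifts to the `Y' i`. Without a map Δ → `X'` the right side would
be the default 0, while the left side need not be. -/
theorem fibreCard_base_change {Δ : TransGSet G Ω} (hΔ : IsHomogeneous Δ)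
    (hfin : ∀ X : TransGSet G Ω, Finite (Δ →[G] X)) {X Y X' : TransGSet G Ω} (f : Y →[G] X)
    (h : X' →[G] X) {n : ℕ} {Y' : Fin n → TransGSet G Ω} (p : ∀ i, Y' i →[G] Y)
    (r : ∀ i, Y' i →[G] X') (hd : IsOrbitDecomp f h p r) (hX' : Nonempty (Δ →[G] X')) :
    fibreCard Δ f = ∑ i, fibreCard Δ (r i) := by
  obtain ⟨x⟩ := hX'
  rw [← card_fibre_eq hΔ f (h.comp x), Finset.sum_congr rfl fun i _ => (card_fibre_eq hΔ (r i) x).symm,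
    ← Nat.card_sigma]
  symm
  refine Nat.card_congr (Equiv.ofBijective (fun z : Σ i, {z : Δ →[G] Y' i // (r i).comp z = x} =>
    ⟨(p z.1).comp z.2.1, MulActionHom.ext fun d => ?_⟩) ⟨?_, ?_⟩)
  · have h1 := DFunLike.congr_fun z.2.2 d
    change r z.1 (z.2.1 d) = x d at h1
    change f (p z.1 (z.2.1 d)) = h (x d)
    rw [hd.1, h1]
  · rintro ⟨i, z, hz⟩ ⟨j, z', hz'⟩ hzz
    have hpt : ∀ d, (⟨i, z d⟩ : Σ i, Y' i) = ⟨j, z' d⟩ := fun d => by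
      have h1 : p i (z d) = p j (z' d) := DFunLike.congr_fun (congrArg Subtype.val hzz) d
      have h2 : r i (z d) = x d := DFunLike.congr_fun hz d
      have h3 : r j (z' d) = x d := DFunLike.congr_fun hz' d
      exact (hd.2 (p i (z d)) (x d) (by rw [hd.1, h2])).unique ⟨rfl, h2⟩ ⟨h1.symm, h3⟩
    obtain ⟨d₀⟩ := Δ.nonempty
    obtain rfl : i = j := congrArg Sigma.fst (hpt d₀)
    have hzz' : z = z' := MulActionHom.ext fun d => by simpa using hpt d
    subst hzz'
    rfl
  · rintro ⟨g, hg⟩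
    have hg' : ∀ d, f (g d) = h (x d) := fun d => DFunLike.congr_fun hg d
    obtain ⟨d₀⟩ := Δ.nonempty
    obtain ⟨⟨i, z₀⟩, ⟨h1, h2⟩, -⟩ := hd.2 (g d₀) (x d₀) (hg' d₀)
    have hex : ∀ d, ∃ z : Y' i, p i z = g d ∧ r i z = x d := fun d => by
      obtain ⟨γ, rfl⟩ := MulAction.exists_smul_eq G d₀ d
      exact ⟨γ • z₀, by rw [map_smul, map_smul, h1], by rw [map_smul, map_smul, h2]⟩
    choose z hz1 hz2 using hex
    have huniq : ∀ d (z' : Y' i), p i z' = g d → r i z' = x d → z' = z d := fun d z' h3 h4 => by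
      have := (hd.2 (g d) (x d) (hg' d)).unique (y₁ := ⟨i, z'⟩) (y₂ := ⟨i, z d⟩) ⟨h3, h4⟩
        ⟨hz1 d, hz2 d⟩
      simpa using this
    refine ⟨⟨i, ⟨⟨z, fun γ d => ?_⟩, MulActionHom.ext fun d => hz2 d⟩⟩,
      Subtype.ext (MulActionHom.ext fun d => hz1 d)⟩
    exact (huniq _ _ (by rw [map_smul, map_smul, hz1]; rfl) (by rw [map_smul, map_smul, hz2]; rfl)).symm

/-- A map out of G/V is given by a point fixed by V. Lying over the base point of G/U forces that
point to come from an element a of `U`, and it then corresponds to a • y. This turns fibre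
cardinalities into counts of fixed points. -/
theorem fibreCard_coset {V U : Subgroup G} (hV : IsOpenSubgroup Ω V) (hU : IsOpenSubgroup Ω U)
    (hVU : V ≤ U) (hΔ : IsHomogeneous (TransGSet.coset V hV)) {Y : Type u} [MulAction G Y]
    (hY : IsSmooth G Ω Y) (y : Y) :
    fibreCard (TransGSet.coset V hV) (cosetMap (hU.inf (hY y)) hU inf_le_left) =
      Nat.card {y' : Y // y' ∈ MulAction.orbit U y ∧ V ≤ MulAction.stabilizer G y'} := by
  rw [← card_fibre_eq hΔ _ (cosetMap hV hU hVU)]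
  set H := U ⊓ MulAction.stabilizer G y
  have hH : IsOpenSubgroup Ω H := hU.inf (hY y)
  have key : ∀ g : TransGSet.coset V hV →[G] TransGSet.coset H hH,
      (cosetMap hH hU inf_le_left).comp g = cosetMap hV hU hVU →
      ∃ a ∈ U, g (TransGSet.base hV) = a • TransGSet.base hH := fun g hg => by
    obtain ⟨a, ha⟩ := TransGSet.exists_smul_base hH (g (TransGSet.base hV))
    refine ⟨a, ?_, ha⟩
    have h1 := DFunLike.congr_fun hg (TransGSet.base hV)
    rw [MulActionHom.comp_apply, ha, cosetMap_smul_base, cosetMap_base] at h1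
    rw [← TransGSet.stabilizer_base hU]
    exact h1
  have hy : H ≤ MulAction.stabilizer G y := inf_le_right
  refine Nat.card_congr (Equiv.ofBijective (fun g => ⟨cosetHom hH y hy (g.1 (TransGSet.base hV)), ?_,
    le_stabilizer_apply_base hV ((cosetHom hH y hy).comp g.1)⟩) ⟨?_, ?_⟩)
  · obtain ⟨a, ha, hga⟩ := key g.1 g.2
    rw [hga, cosetHom_smul_base]
    exact ⟨⟨a, ha⟩, rfl⟩
  · intro g g' hgg
    obtain ⟨a, ha, hga⟩ := key g.1 g.2
    obtain ⟨a', ha', hga'⟩ := key g'.1 g'.2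
    have h1 := congrArg Subtype.val hgg
    simp only [hga, hga', cosetHom_smul_base] at h1
    refine Subtype.ext (coset_hom_ext ?_)
    rw [hga, hga', TransGSet.smul_base_eq_iff]
    refine Subgroup.mem_inf.2 ⟨mul_mem (inv_mem ha) ha', ?_⟩
    rw [MulAction.mem_stabilizer_iff, mul_smul, inv_smul_eq_iff, h1]
  · rintro ⟨-, ⟨⟨a, ha⟩, rfl⟩, hfix⟩
    have hst : V ≤ MulAction.stabilizer G (a • TransGSet.base hH) := fun h hh => by
      rw [MulAction.mem_stabilizer_iff, ← mul_smul, eq_comm, TransGSet.smul_base_eq_iff]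
      refine Subgroup.mem_inf.2 ⟨mul_mem (inv_mem ha) (mul_mem (hVU hh) ha), ?_⟩
      have h1 : h • a • y = a • y := hfix hh
      rw [MulAction.mem_stabilizer_iff, mul_smul, mul_smul, h1, inv_smul_smul]
    refine ⟨⟨cosetHom hV _ hst, coset_hom_ext ?_⟩, Subtype.ext ?_⟩
    · rw [MulActionHom.comp_apply, cosetHom_base, cosetMap_smul_base, cosetMap_base]
      have : a ∈ MulAction.stabilizer G (TransGSet.base hU) := by
        rwa [TransGSet.stabilizer_base]
      exact this
    · change cosetHom hH y hy (cosetHom hV _ hst (TransGSet.base hV)) = a • y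
      rw [cosetHom_base, cosetHom_smul_base]

end Homs

/-! ### Finiteness of orbits under open subgroups. -/

section Oligomorphic

variable {G Ω : Type u} [Group G] [MulAction G Ω]

/-- The subgroup `K` has finitely many orbits on `X`. -/
def HasFiniteOrbits (K : Subgroup G) (X : Type u) [MulAction G X] : Prop :=
  ∃ S : Set X, S.Finite ∧ ∀ x, ∃ k ∈ K, k • x ∈ S

variable (G Ω) in
/-- All open subgroups have finitely many orbits on `X`. -/
def IsOligomorphic (X : Type u) [MulAction G X] : Prop :=
  ∀ K : Subgroup G, IsOpenSubgroup Ω K → HasFiniteOrbits K X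

theorem HasFiniteOrbits.finite {K : Subgroup G} {X : Type u} [MulAction G X]
    (h : HasFiniteOrbits K X) : Finite (MulAction.orbitRel.Quotient K X) := by
  obtain ⟨S, hS, h⟩ := h
  have := hS.to_subtype
  refine Finite.of_surjective
    (fun s : S => (Quotient.mk'' s.1 : MulAction.orbitRel.Quotient K X)) fun o => ?_
  induction o using Quotient.inductionOn' with
  | h x =>
    obtain ⟨k, hk, hx⟩ := h x
    exact ⟨⟨_, hx⟩, Quotient.sound' ⟨⟨k, hk⟩, rfl⟩⟩

theorem IsOligomorphic.prod {X Y : Type u} [MulAction G X] [MulAction G Y]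
    (hXs : IsSmooth G Ω X) (hX : IsOligomorphic G Ω X) (hY : IsOligomorphic G Ω Y) :
    IsOligomorphic G Ω (X × Y) := by
  intro K hK
  obtain ⟨S, hS, h⟩ := hX K hK
  choose T hT hT' using fun s : X => hY (K ⊓ MulAction.stabilizer G s) (hK.inf (hXs s))
  refine ⟨⋃ s ∈ S, {s} ×ˢ T s, hS.biUnion fun s _ => (Set.finite_singleton s).prod (hT s),
    fun ⟨x, y⟩ => ?_⟩
  obtain ⟨k, hk, hx⟩ := h x
  obtain ⟨l, hl, hy⟩ := hT' (k • x) (k • y)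
  refine ⟨l * k, mul_mem hl.1 hk, Set.mem_biUnion hx ⟨?_, ?_⟩⟩
  · change (l * k) • x = k • x
    rw [mul_smul, MulAction.mem_stabilizer_iff.1 hl.2]
  · change (l * k) • y ∈ T (k • x)
    rwa [mul_smul]

theorem IsOligomorphic.of_injective {X Y : Type u} [MulAction G X] [MulAction G Y]
    (f : X →[G] Y) (hf : Function.Injective f) (hY : IsOligomorphic G Ω Y) : IsOligomorphic G Ω X := by
  intro K hK
  obtain ⟨S, hS, h⟩ := hY K hK
  refine ⟨f ⁻¹' S, hS.preimage hf.injOn, fun x => ?_⟩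
  obtain ⟨k, hk, hx⟩ := h (f x)
  exact ⟨k, hk, by rwa [Set.mem_preimage, map_smul]⟩

theorem IsOligomorphic.of_surjective {X Y : Type u} [MulAction G X] [MulAction G Y]
    (f : X →[G] Y) (hf : Function.Surjective f) (hX : IsOligomorphic G Ω X) :
    IsOligomorphic G Ω Y := by
  intro K hK
  obtain ⟨S, hS, h⟩ := hX K hK
  refine ⟨f '' S, hS.image f, fun y => ?_⟩
  obtain ⟨x, rfl⟩ := hf y
  obtain ⟨k, hk, hx⟩ := h x
  exact ⟨k, hk, k • x, hx, map_smul f k x⟩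

theorem IsOligomorphic.of_coset {X : Type u} [MulAction G X] (hX : IsSmooth G Ω X)
    (hfin : IsFinitary G X)
    (h : ∀ (U : Subgroup G) (hU : IsOpenSubgroup Ω U), IsOligomorphic G Ω (TransGSet.coset U hU)) :
    IsOligomorphic G Ω X := by
  intro K hK
  have : Finite (MulAction.orbitRel.Quotient G X) := hfin
  choose S hS hS' using fun x : X => h _ (hX x) K hK
  refine ⟨⋃ o : MulAction.orbitRel.Quotient G X,
    cosetHom (hX o.out) o.out le_rfl '' S o.out, Set.finite_iUnion fun o => (hS _).image _,
    fun x => ?_⟩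
  obtain ⟨g, hg⟩ := MulAction.orbitRel_apply.1
    (Quotient.exact' (Quotient.out_eq' (Quotient.mk'' x : MulAction.orbitRel.Quotient G X)))
  set y := (Quotient.mk'' x : MulAction.orbitRel.Quotient G X).out with hy
  obtain ⟨k, hk, hz⟩ := hS' y (g⁻¹ • TransGSet.base (hX y))
  refine ⟨k, hk, Set.mem_iUnion.2 ⟨Quotient.mk'' x, _, hz, ?_⟩⟩
  rw [map_smul]
  congr 1
  refine (cosetHom_smul_base (hX y) y le_rfl g⁻¹).trans ?_
  rw [inv_smul_eq_iff]
  exact hg.symm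

end Oligomorphic

/-! ### Homogeneity of G/G(n), smooth approximation and oligomorphy. -/

section GeneralLinearGroup

variable {F : Type u} [Field F]

theorem isSmooth_oddPart : IsSmooth (GLInf F) (InfSpace F) (OddPart F) := by
  intro x
  refine ⟨{(evenZero F, x)}, Set.finite_singleton _, fun g hg => ?_⟩
  rw [mem_fixingSubgroup_iff] at hg
  exact congrArg Prod.snd (hg (evenZero F, x) rfl)

theorem conj_mem_levelSubgroup {n : ℕ} {σ h : GLInf F} (hσ : σ ∈ levelStabilizer F n)
    (hh : h ∈ levelSubgroup F n) : σ⁻¹ * h * σ ∈ levelSubgroup F n := by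
  rw [levelSubgroup_eq_fixer] at hh ⊢
  rw [← mem_fixer_map]
  refine fixer_anti ?_ ?_ hh
  · rintro - ⟨x, hx, rfl⟩
    exact (hσ.1 x).2 hx
  · rintro - ⟨x, hx, rfl⟩
    exact (hσ.2 x).2 hx

/-- The conjugate of G(n) by g⁻¹ is the stabilizer of the level translated by g⁻¹, and minimality of
the support applies to that pair. -/
theorem map_le_of_conj_le {n : ℕ} {U : Subgroup (GLInf F)} {A₀ A₁ : Submodule F (ℕ →₀ F)}
    (h : IsSupport U A₀ A₁) (g : GLInf F)
    (hg : ∀ x ∈ levelSubgroup F n, g⁻¹ * x * g ∈ U) :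
    (∀ x ∈ A₀, g.1.1 x ∈ initial F n) ∧ ∀ y ∈ A₁, g.1.2 y ∈ initial F n := by
  have fg := Module.Finite.iff_fg.1 (finite_initial (F := F) n)
  obtain ⟨h₀, h₁⟩ := h.min (fg.map ((g⁻¹).1.1 : (ℕ →₀ F) →ₗ[F] (ℕ →₀ F)))
    (fg.map ((g⁻¹).1.2 : (ℕ →₀ F) →ₗ[F] (ℕ →₀ F))) fun x hx => by
      rw [mem_fixer_map, ← levelSubgroup_eq_fixer] at hx
      have := hg _ hx
      simpa [mul_assoc] using this
  refine ⟨fun x hx => ?_, fun x hx => ?_⟩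
  · obtain ⟨y, hy, rfl⟩ := h₀ hx
    exact (GLInf.fst_inv_apply g y).symm ▸ hy
  · obtain ⟨y, hy, rfl⟩ := h₁ hx
    exact (GLInf.snd_inv_apply g y).symm ▸ hy

/-- Two maps give two points x and g x fixed by G(n). The support of the stabilizer of x and its
translate by g both lie in level n, so g can be replaced by some σ preserving the level with σ x = g
x. Such a σ normalizes G(n) and thus induces an automorphism of G/G(n). -/
theorem isHomogeneous_coset_levelSubgroup {n : ℕ}
    (hn : IsOpenSubgroup (InfSpace F) (levelSubgroup F n)) :
    IsHomogeneous (TransGSet.coset (levelSubgroup F n) hn) := by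
  intro X i j
  obtain ⟨g, hg⟩ := MulAction.exists_smul_eq (GLInf F) (i (TransGSet.base hn))
    (j (TransGSet.base hn))
  obtain ⟨A₀, A₁, hA⟩ := exists_isSupport (X.smooth (i (TransGSet.base hn)))
  have hi := le_stabilizer_apply_base hn i
  have hj := le_stabilizer_apply_base hn j
  obtain ⟨a₀, a₁⟩ := map_le_of_conj_le hA 1 fun x hx => by simpa using hi hx
  obtain ⟨b₀, b₁⟩ := map_le_of_conj_le hA g fun x hx => by
    have := hj hx
    rw [← hg] at this
    rw [MulAction.mem_stabilizer_iff] at this ⊢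
    rw [mul_smul, mul_smul, this, inv_smul_smul]
  obtain ⟨σ, hσ, hσg⟩ := exists_levelStabilizer_extend a₀ a₁ b₀ b₁
  have hσi : σ • i (TransGSet.base hn) = j (TransGSet.base hn) := by
    have := hA.fixer_le hσg
    rw [MulAction.mem_stabilizer_iff, mul_smul, inv_smul_eq_iff] at this
    rw [this, hg]
  have hs : ∀ τ ∈ levelStabilizer F n,
      levelSubgroup F n ≤ MulAction.stabilizer (GLInf F) (τ • TransGSet.base hn) := by
    intro τ hτ x hx
    rw [MulAction.mem_stabilizer_iff, ← mul_smul, eq_comm, TransGSet.smul_base_eq_iff, ← mul_assoc]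
    exact conj_mem_levelSubgroup hτ hx
  refine ⟨cosetHom hn _ (hs σ hσ), ⟨fun x y hxy => ?_, hom_surjective _⟩, coset_hom_ext ?_⟩
  · obtain ⟨a, rfl⟩ := TransGSet.exists_smul_base hn x
    obtain ⟨b, rfl⟩ := TransGSet.exists_smul_base hn y
    rw [cosetHom_smul_base, cosetHom_smul_base, ← mul_smul, ← mul_smul,
      TransGSet.smul_base_eq_iff] at hxy
    rw [TransGSet.smul_base_eq_iff]
    have := conj_mem_levelSubgroup (inv_mem hσ) hxy
    have e : σ⁻¹⁻¹ * ((a * σ)⁻¹ * (b * σ)) * σ⁻¹ = a⁻¹ * b := by group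
    rwa [e] at this
  · rw [MulActionHom.comp_apply, cosetHom_base, map_smul, hσi]

theorem isHomogeneous_perfectEmbeddings (n : ℕ) : IsHomogeneous (perfectEmbeddings F n) :=
  isHomogeneous_coset_levelSubgroup _

theorem levelSubgroup_le {n : ℕ} {A₀ A₁ : Submodule F (ℕ →₀ F)} (h₀ : A₀ ≤ initial F n)
    (h₁ : A₁ ≤ initial F n) : levelSubgroup F n ≤ fixer A₀ A₁ := by
  rw [levelSubgroup_eq_fixer]
  exact fixer_anti h₀ h₁

theorem eventually_levelSubgroup_le {U : Subgroup (GLInf F)}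
    (hU : IsOpenSubgroup (InfSpace F) U) : ∀ᶠ n in Filter.atTop, levelSubgroup F n ≤ U := by
  obtain ⟨A₀, A₁, h₀, h₁, hA⟩ := exists_fixer_le hU
  obtain ⟨n, hn₀, hn₁, -⟩ := exists_le_initial₄ h₀ h₁ h₀ h₁
  filter_upwards [Filter.eventually_ge_atTop n] with m hm
  exact (levelSubgroup_le (hn₀.trans (initial_mono hm)) (hn₁.trans (initial_mono hm))).trans hA

theorem eventually_nonempty_hom (X : TransGSet (GLInf F) (InfSpace F)) :
    ∀ᶠ n in Filter.atTop, Nonempty (perfectEmbeddings F n →[GLInf F] X) := by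
  obtain ⟨x⟩ := X.nonempty
  filter_upwards [eventually_levelSubgroup_le (X.smooth x)] with n hn
  exact ⟨cosetHom (isOpenSubgroup_levelSubgroup F n) x hn⟩

theorem isSmoothApproximation_perfectEmbeddings : IsSmoothApproximation (perfectEmbeddings F) where
  homogeneous := isHomogeneous_perfectEmbeddings
  cofinite X := by
    have := eventually_nonempty_hom X
    rw [← Nat.cofinite_eq_atTop, Filter.eventually_cofinite] at this
    simpa only [not_nonempty_iff] using this

/-- A vector outside level n is equivalent under G(n) to w + e_n, where w in level n has the same
pairings with that level. Over a finite field this leaves finitely many orbits. -/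
theorem exists_mem_fixer_map_mem_initial (n : ℕ) (x : ℕ →₀ F) :
    ∃ g ∈ fixer (initial F n) (initial F n), g.1.1 x ∈ initial F (n + 1) := by
  by_cases hx : x ∈ initial F n
  · exact ⟨1, one_mem _, initial_mono (Nat.le_succ n) hx⟩
  obtain ⟨w, hw, hwx⟩ := exists_repr n (pairingHom x)
  have hs : w + Finsupp.single n 1 ∉ initial F n := fun hc => by
    have := mem_initial.1 hc n le_rfl
    rw [Finsupp.add_apply, mem_initial.1 hw n le_rfl] at this
    simp at this
  obtain ⟨g, hg, hgx⟩ := exists_mem_fixer_map_eq' (A₁ := initial F n)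
    (Module.Finite.iff_fg.1 (finite_initial (F := F) n)) hx hs fun y hy => by
      have h1 : pairing y w = pairing x y := hwx y hy
      rw [pairing_sub_left, pairing_add_left, pairing_comm w, h1, single_perp' le_rfl hy]
      simp
  refine ⟨g, hg, ?_⟩
  rw [hgx]
  exact add_mem (initial_mono (Nat.le_succ n) hw) (single_mem_initial (Nat.lt_succ_self n) 1)

/-- A property of open subgroups holds for all pointwise stabilizers if it holds for the whole
group and passes to the stabilizers of further vectors of `𝐕₀` and of `𝐕₁`. -/
theorem fixer_induction {P : Submodule F (ℕ →₀ F) → Submodule F (ℕ →₀ F) → Prop}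
    {C₀ C₁ : Submodule F (ℕ →₀ F)} (hC₀ : C₀.FG) (hC₁ : C₁.FG) (bot : P C₀ C₁)
    (left : ∀ {A₀ A₁} (v : ℕ →₀ F), A₀.FG → A₁.FG → C₀ ≤ A₀ → C₁ ≤ A₁ → P A₀ A₁ →
      P (A₀ ⊔ Submodule.span F {v}) A₁)
    (right : ∀ {A₀ A₁} (v : ℕ →₀ F), A₀.FG → A₁.FG → C₀ ≤ A₀ → C₁ ≤ A₁ → P A₀ A₁ →
      P A₀ (A₁ ⊔ Submodule.span F {v}))
    {A₀ A₁ : Submodule F (ℕ →₀ F)} (h₀ : A₀.FG) (h₁ : A₁.FG) (hCA₀ : C₀ ≤ A₀) (hCA₁ : C₁ ≤ A₁) :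
    P A₀ A₁ := by
  have l : ∀ {B : Submodule F (ℕ →₀ F)}, B.FG → ∀ {D₀ D₁}, D₀.FG → D₁.FG → C₀ ≤ D₀ → C₁ ≤ D₁ →
      P D₀ D₁ → P (D₀ ⊔ B) D₁ := by
    intro B hB
    induction B, hB using Submodule.fg_induction with
    | singleton v => exact fun a b c d => left v a b c d
    | sup M N hM hN ihM ihN =>
      intro D₀ D₁ a b c d h
      rw [← sup_assoc]
      exact ihN (a.sup hM) b (c.trans le_sup_left) d (ihM a b c d h)
  have r : ∀ {B : Submodule F (ℕ →₀ F)}, B.FG → ∀ {D₀ D₁}, D₀.FG → D₁.FG → C₀ ≤ D₀ → C₁ ≤ D₁ →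
      P D₀ D₁ → P D₀ (D₁ ⊔ B) := by
    intro B hB
    induction B, hB using Submodule.fg_induction with
    | singleton v => exact fun a b c d => right v a b c d
    | sup M N hM hN ihM ihN =>
      intro D₀ D₁ a b c d h
      rw [← sup_assoc]
      exact ihN a (b.sup hM) c (d.trans le_sup_left) (ihM a b c d h)
  have h2 := r h₁ (hC₀.sup h₀) hC₁ le_sup_left le_rfl (l h₀ hC₀ hC₁ le_rfl le_rfl bot)
  rwa [sup_eq_right.2 hCA₀, sup_eq_right.2 hCA₁] at h2

/-- G/(U ∩ G_y) embeds into G/U × Y as the orbit of the point formed by the base point and y. -/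
theorem isOligomorphic_coset_inf {U : Subgroup (GLInf F)} (hU : IsOpenSubgroup (InfSpace F) U)
    {Y : Type u} [MulAction (GLInf F) Y] (hY : IsSmooth (GLInf F) (InfSpace F) Y)
    (h : IsOligomorphic (GLInf F) (InfSpace F) (TransGSet.coset U hU)) (h' : IsOligomorphic (GLInf F) (InfSpace F) Y)
    (y : Y) : IsOligomorphic (GLInf F) (InfSpace F)
      (TransGSet.coset (U ⊓ MulAction.stabilizer (GLInf F) y) (hU.inf (hY y))) := by
  have hH := hU.inf (hY y)
  have hst : U ⊓ MulAction.stabilizer (GLInf F) y ≤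
      MulAction.stabilizer (GLInf F) ((TransGSet.base hU, y) : TransGSet.coset U hU × Y) := by
    intro g hg
    have h1 : g ∈ MulAction.stabilizer (GLInf F) (TransGSet.base hU) := by
      rw [TransGSet.stabilizer_base]
      exact hg.1
    exact Prod.ext h1 hg.2
  refine (h.prod (TransGSet.coset U hU).smooth h').of_injective (cosetHom hH _ hst)
    fun a b hab => ?_
  obtain ⟨a, rfl⟩ := TransGSet.exists_smul_base hH a
  obtain ⟨b, rfl⟩ := TransGSet.exists_smul_base hH b
  rw [cosetHom_smul_base, cosetHom_smul_base] at hab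
  rw [TransGSet.smul_base_eq_iff, Subgroup.mem_inf]
  refine ⟨(TransGSet.smul_base_eq_iff hU a b).1 (congrArg Prod.fst hab), ?_⟩
  have : a • y = b • y := congrArg Prod.snd hab
  rw [MulAction.mem_stabilizer_iff, mul_smul, ← this, inv_smul_smul]

variable [Finite F]

instance finite_initial_coe (n : ℕ) : Finite (initial F n) :=
  Module.finite_of_finite F

/-- A self-map of G/G(n) comes from an element mapping the finite level into itself and is
determined by the restriction of that element. By homogeneity all maps to `X` arise from one of them
by precomposing with self-maps. -/
theorem finite_hom_coset_levelSubgroup {n : ℕ}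
    (hn : IsOpenSubgroup (InfSpace F) (levelSubgroup F n)) (X : TransGSet (GLInf F) (InfSpace F)) :
    Finite (TransGSet.coset _ hn →[GLInf F] X) := by
  have hself : Finite (TransGSet.coset _ hn →[GLInf F] TransGSet.coset _ hn) := by
    have key : ∀ f : TransGSet.coset _ hn →[GLInf F] TransGSet.coset _ hn,
        ∃ g : GLInf F, f (TransGSet.base hn) = g • TransGSet.base hn ∧
          (∀ x ∈ initial F n, g.1.1 x ∈ initial F n) ∧ ∀ x ∈ initial F n, g.1.2 x ∈ initial F n := by
      intro f
      obtain ⟨g, hg⟩ := TransGSet.exists_smul_base hn (f (TransGSet.base hn))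
      have fg := Module.Finite.iff_fg.1 (finite_initial (F := F) n)
      refine ⟨g, hg, map_le_of_conj_le (isSupport_fixer fg fg) g fun x hx => ?_⟩
      have h1 := le_stabilizer_apply_base hn f hx
      rw [hg, MulAction.mem_stabilizer_iff, ← mul_smul, eq_comm, TransGSet.smul_base_eq_iff,
        levelSubgroup_eq_fixer] at h1
      rwa [mul_assoc]
    choose g hg hg₀ hg₁ using key
    refine Finite.of_injective (fun f =>
      ((fun x => ⟨(g f).1.1 x.1, hg₀ f x.1 x.2⟩, fun x => ⟨(g f).1.2 x.1, hg₁ f x.1 x.2⟩) :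
      (initial F n → initial F n) × (initial F n → initial F n))) fun f f' hff => ?_
    refine coset_hom_ext ?_
    refine (hg f).trans (Eq.trans ?_ (hg f').symm)
    rw [TransGSet.smul_base_eq_iff, levelSubgroup_eq_fixer]
    have h1 := congrArg Prod.fst hff
    have h2 := congrArg Prod.snd hff
    refine ⟨fun x hx => ?_, fun x hx => ?_⟩
    · have h3 : (g f).1.1 x = (g f').1.1 x := congrArg Subtype.val (congrFun h1 ⟨x, hx⟩)
      rw [GLInf.mul_fst_apply, ← h3, GLInf.inv_fst_apply]
    · have h3 : (g f).1.2 x = (g f').1.2 x := congrArg Subtype.val (congrFun h2 ⟨x, hx⟩)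
      rw [GLInf.mul_snd_apply, ← h3, GLInf.inv_snd_apply]
  rcases isEmpty_or_nonempty (TransGSet.coset _ hn →[GLInf F] X) with h | ⟨⟨i⟩⟩
  · infer_instance
  · refine Finite.of_surjective (fun σ : TransGSet.coset _ hn →[GLInf F] TransGSet.coset _ hn =>
      i.comp σ) fun j => ?_
    obtain ⟨σ, -, hσ⟩ := isHomogeneous_coset_levelSubgroup hn X i j
    exact ⟨σ, hσ⟩

theorem finite_hom_perfectEmbeddings (n : ℕ) (X : TransGSet (GLInf F) (InfSpace F)) :
    Finite (perfectEmbeddings F n →[GLInf F] X) :=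
  finite_hom_coset_levelSubgroup _ X

theorem isOligomorphic_evenPart : IsOligomorphic (GLInf F) (InfSpace F) (EvenPart F) := by
  intro K hK
  obtain ⟨n, hn⟩ := (eventually_levelSubgroup_le hK).exists
  refine ⟨(initial F (n + 1) : Set (ℕ →₀ F)), Set.finite_coe_iff.1 (finite_initial_coe (n + 1)), fun x => ?_⟩
  obtain ⟨g, hg, hgx⟩ := exists_mem_fixer_map_mem_initial n x
  exact ⟨g, hn (by rwa [levelSubgroup_eq_fixer]), hgx⟩

theorem isOligomorphic_oddPart : IsOligomorphic (GLInf F) (InfSpace F) (OddPart F) := by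
  intro K hK
  obtain ⟨n, hn⟩ := (eventually_levelSubgroup_le hK).exists
  refine ⟨(initial F (n + 1) : Set (ℕ →₀ F)), Set.finite_coe_iff.1 (finite_initial_coe (n + 1)), fun x => ?_⟩
  obtain ⟨g, hg, hgx⟩ := exists_mem_fixer_map_mem_initial n x
  exact ⟨GLInf.swap g, hn (by rw [levelSubgroup_eq_fixer]; exact swap_mem_fixer.2 hg), hgx⟩

theorem isOligomorphic_coset {U : Subgroup (GLInf F)} (hU : IsOpenSubgroup (InfSpace F) U) :
    IsOligomorphic (GLInf F) (InfSpace F) (TransGSet.coset U hU) := by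
  obtain ⟨A₀, A₁, h₀, h₁, hA⟩ := exists_fixer_le hU
  have key : ∀ h : IsOpenSubgroup (InfSpace F) (fixer A₀ A₁),
      IsOligomorphic (GLInf F) (InfSpace F) (TransGSet.coset _ h) := by
    refine fixer_induction (P := fun A₀ A₁ => ∀ h : IsOpenSubgroup (InfSpace F) (fixer A₀ A₁),
      IsOligomorphic (GLInf F) (InfSpace F) (TransGSet.coset _ h)) Submodule.fg_bot Submodule.fg_bot ?_ ?_ ?_
      h₀ h₁ bot_le bot_le
    · intro h K hK
      refine ⟨{TransGSet.base h}, Set.finite_singleton _, fun x => ⟨1, one_mem _, ?_⟩⟩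
      obtain ⟨g, rfl⟩ := TransGSet.exists_smul_base h x
      rw [one_smul, Set.mem_singleton_iff, ← MulAction.mem_stabilizer_iff,
        TransGSet.stabilizer_base, fixer_bot]
      trivial
    · intro A₀ A₁ v h₀ h₁ _ _ ih
      rw [fixer_sup_span_left]
      intro _
      exact isOligomorphic_coset_inf (isOpenSubgroup_fixer h₀ h₁) (isSmooth_evenPart F) (ih _)
        isOligomorphic_evenPart _
    · intro A₀ A₁ v h₀ h₁ _ _ ih
      rw [fixer_sup_span_right]
      intro _
      exact isOligomorphic_coset_inf (isOpenSubgroup_fixer h₀ h₁) isSmooth_oddPart (ih _)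
        isOligomorphic_oddPart _
  exact (key (isOpenSubgroup_fixer h₀ h₁)).of_surjective (cosetMap _ hU hA) (hom_surjective _)

theorem isOligomorphic_of_isFinitary {X : Type u} [MulAction (GLInf F) X]
    (hX : IsSmooth (GLInf F) (InfSpace F) X) (hfin : IsFinitary (GLInf F) X) :
    IsOligomorphic (GLInf F) (InfSpace F) X :=
  IsOligomorphic.of_coset hX hfin fun _ => isOligomorphic_coset

end GeneralLinearGroup

open Polynomial Filter

/-! ### Sequences that are eventually polynomial in q^n. -/

section EventuallyEval

/-- The sequence `c` is eventually given by evaluating the polynomial `p` at `q ^ n`. -/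
def EventuallyEval (q : ℕ) (c : ℕ → ℕ) (p : ℚ[X]) : Prop :=
  ∀ᶠ n in atTop, (c n : ℚ) = p.eval ((q : ℚ) ^ n)

theorem eq_zero_of_eventually_eval {q : ℕ} (hq : 1 < q) {p : ℚ[X]}
    (h : ∀ᶠ n : ℕ in atTop, p.eval ((q : ℚ) ^ n) = 0) : p = 0 := by
  obtain ⟨N, hN⟩ := eventually_atTop.1 h
  have hinj : Function.Injective fun n : ℕ => (q : ℚ) ^ n :=
    pow_right_injective₀ (by positivity) (by exact_mod_cast hq.ne')
  refine Polynomial.eq_zero_of_infinite_isRoot p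
    (Set.Infinite.mono ?_ ((Set.Ici_infinite N).image hinj.injOn))
  rintro - ⟨n, hn, rfl⟩
  exact hN n hn

theorem EventuallyEval.unique {q : ℕ} (hq : 1 < q) {c c' : ℕ → ℕ} {p p' : ℚ[X]}
    (h : EventuallyEval q c p) (h' : EventuallyEval q c' p') (hc : ∀ᶠ n in atTop, c n = c' n) :
    p = p' := by
  rw [← sub_eq_zero]
  refine eq_zero_of_eventually_eval hq ?_
  filter_upwards [h, h', hc] with n h1 h2 h3
  rw [eval_sub, ← h1, ← h2, h3, sub_self]

theorem EventuallyEval.congr {q : ℕ} {c c' : ℕ → ℕ} {p : ℚ[X]} (h : EventuallyEval q c p)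
    (hc : ∀ᶠ n in atTop, c' n = c n) : EventuallyEval q c' p := by
  filter_upwards [h, hc] with n h1 h2
  rw [h2, h1]

theorem EventuallyEval.mul {q : ℕ} {c c' : ℕ → ℕ} {p p' : ℚ[X]}
    (h : EventuallyEval q c p) (h' : EventuallyEval q c' p') :
    EventuallyEval q (fun n => c n * c' n) (p * p') := by
  filter_upwards [h, h'] with n h1 h2
  rw [Nat.cast_mul, h1, h2, eval_mul]

theorem EventuallyEval.sum {q : ℕ} {ι : Type*} (s : Finset ι) {c : ι → ℕ → ℕ} {p : ι → ℚ[X]}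
    (h : ∀ i, EventuallyEval q (c i) (p i)) :
    EventuallyEval q (fun n => ∑ i ∈ s, c i n) (∑ i ∈ s, p i) := by
  have := (s.eventually_all).2 fun i _ => h i
  filter_upwards [this] with n h1
  rw [Nat.cast_sum, eval_finsetSum]
  exact Finset.sum_congr rfl h1

theorem EventuallyEval.const (q d : ℕ) : EventuallyEval q (fun _ => d) (C (d : ℚ)) :=
  Eventually.of_forall fun _ => by rw [eval_C]

theorem exists_integer_multiple (p : ℚ[X]) :
    ∃ (D : ℤ) (P : ℤ[X]), D ≠ 0 ∧ P.map (Int.castRingHom ℚ) = C (D : ℚ) * p := by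
  obtain ⟨b, hb, hp⟩ := IsLocalization.integerNormalization_spec (nonZeroDivisors ℤ) p
  refine ⟨b, IsLocalization.integerNormalization (nonZeroDivisors ℤ) p,
    nonZeroDivisors.ne_zero hb, ?_⟩
  rw [show (Int.castRingHom ℚ) = algebraMap ℤ ℚ from rfl, hp, zsmul_eq_mul, map_intCast]

/-- Let D clear the denominators of the quotient r / p. Then D times remainder over p, evaluated at
q^n, is eventually an integer, because b n is one; it also tends to 0. So it is eventually 0, and
the remainder vanishes. -/
theorem EventuallyEval.exists_div {q : ℕ} (hq : 1 < q) {a b c : ℕ → ℕ} {p r : ℚ[X]}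
    (hp : p ≠ 0) (ha : EventuallyEval q a p) (hc : EventuallyEval q c r)
    (habc : ∀ᶠ n in atTop, c n = a n * b n) : ∃ s, EventuallyEval q b s := by
  have hlim : Tendsto (fun n : ℕ => (q : ℚ) ^ n) atTop atTop :=
    tendsto_pow_atTop_atTop_of_one_lt (by exact_mod_cast hq)
  have hp0 : ∀ᶠ n : ℕ in atTop, p.eval ((q : ℚ) ^ n) ≠ 0 :=
    hlim.eventually (Polynomial.eventually_atTop_not_isRoot p hp)
  have hdm : ∀ x, r.eval x = p.eval x * (r / p).eval x + (r % p).eval x := fun x => by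
    rw [← eval_mul, ← eval_add, EuclideanDomain.div_add_mod]
  obtain ⟨D, P, hD, hP⟩ := exists_integer_multiple (r / p)
  have hD' : (D : ℚ) ≠ 0 := Int.cast_ne_zero.2 hD
  have hPe : ∀ n : ℕ, ((P.eval ((q : ℤ) ^ n) : ℤ) : ℚ) = D * (r / p).eval ((q : ℚ) ^ n) := by
    intro n
    have h1 := congrArg (eval ((q : ℚ) ^ n)) hP
    rw [eval_mul, eval_C] at h1
    rw [← h1]
    have h2 : ((q : ℚ) ^ n) = (((q : ℤ) ^ n : ℤ) : ℚ) := by push_cast; rfl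
    rw [h2, eval_intCast_map]
    rfl
  have hsmall := ((Polynomial.div_tendsto_atTop_zero_of_degree_lt (r % p) p
    (EuclideanDomain.mod_lt r hp)).const_mul (D : ℚ)).comp hlim
  rw [mul_zero] at hsmall
  have hlt := hsmall.eventually (Metric.ball_mem_nhds (0 : ℚ) one_pos)
  have hrem : r % p = 0 := by
    refine eq_zero_of_eventually_eval hq ?_
    filter_upwards [ha, hc, habc, hp0, hlt] with n h1 h2 h3 h4 h5
    have h6 : (c n : ℚ) = a n * b n := by exact_mod_cast h3
    rw [h1, h2, hdm] at h6
    have h7 : (D : ℚ) * ((r % p).eval ((q : ℚ) ^ n) / p.eval ((q : ℚ) ^ n)) =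
        ((D * b n - P.eval ((q : ℤ) ^ n) : ℤ) : ℚ) := by
      push_cast
      rw [hPe n]
      field_simp
      linear_combination h6
    simp only [Function.comp_apply] at h5
    rw [dist_zero_right, h7, Int.norm_cast_rat, Int.norm_eq_abs] at h5
    have h8 : D * b n - P.eval ((q : ℤ) ^ n) = 0 := by
      rw [← Int.abs_lt_one_iff]
      exact_mod_cast h5
    rw [h8, Int.cast_zero, mul_eq_zero, or_iff_right hD', div_eq_zero_iff, or_iff_left h4] at h7
    exact h7
  refine ⟨r / p, ?_⟩
  filter_upwards [ha, hc, habc, hp0] with n h1 h2 h3 h4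
  have h6 : (c n : ℚ) = a n * b n := by exact_mod_cast h3
  rw [h1, h2, hdm, hrem, eval_zero, add_zero] at h6
  exact (mul_left_cancel₀ h4 h6).symm

end EventuallyEval

/-! ### Counting the points fixed by an open subgroup. -/

section FixedPoints

variable {G Ω : Type u} [Group G] [MulAction G Ω]

theorem fibreCard_cosetMap {V U H : Subgroup G} (hV : IsOpenSubgroup Ω V)
    (hU : IsOpenSubgroup Ω U) (hH : IsOpenSubgroup Ω H) (hHU : H ≤ U)
    (hVU : V ≤ U) (hΔ : IsHomogeneous (TransGSet.coset V hV)) {Y : Type u} [MulAction G Y]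
    (hY : IsSmooth G Ω Y) (y : Y) (h : H = U ⊓ MulAction.stabilizer G y) :
    fibreCard (TransGSet.coset V hV) (cosetMap hH hU hHU) =
      Nat.card {y' : Y // y' ∈ MulAction.orbit U y ∧ V ≤ MulAction.stabilizer G y'} := by
  subst h
  exact fibreCard_coset hV hU hVU hΔ hY y

theorem finite_fixed {V : Subgroup G} (hV : IsOpenSubgroup Ω V)
    (hfin : ∀ X : TransGSet G Ω, Finite (TransGSet.coset V hV →[G] X)) {Y : Type u} [MulAction G Y]
    (hY : IsSmooth G Ω Y) (hYfin : IsFinitary G Y) :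
    Finite {y : Y // V ≤ MulAction.stabilizer G y} := by
  have : Finite (MulAction.orbitRel.Quotient G Y) := hYfin
  have := hfin
  refine Finite.of_surjective (α := Σ o : MulAction.orbitRel.Quotient G Y,
    (TransGSet.coset V hV →[G] TransGSet.coset _ (hY o.out)))
    (fun p => ⟨cosetHom (hY p.1.out) p.1.out le_rfl (p.2 (TransGSet.base hV)),
      le_stabilizer_apply_base hV ((cosetHom (hY p.1.out) p.1.out le_rfl).comp p.2)⟩) ?_
  rintro ⟨y, hy⟩
  obtain ⟨g, hg⟩ := MulAction.orbitRel_apply.1 (Setoid.symm' _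
    (Quotient.exact' (Quotient.out_eq' (Quotient.mk'' y : MulAction.orbitRel.Quotient G Y))))
  have hz := cosetHom_smul_base (hY _) _ le_rfl g |>.trans hg
  suffices hst : V ≤ MulAction.stabilizer G (g • TransGSet.base
      (hY (Quotient.mk'' y : MulAction.orbitRel.Quotient G Y).out)) from ⟨⟨Quotient.mk'' y, cosetHom hV _ hst⟩,
    Subtype.ext ((congrArg _ (cosetHom_base hV _ hst)).trans hz)⟩
  intro v hv
  have h1 := hy hv
  rw [MulAction.mem_stabilizer_iff, ← hg] at h1
  rw [MulAction.mem_stabilizer_iff, ← mul_smul, eq_comm, TransGSet.smul_base_eq_iff,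
    MulAction.mem_stabilizer_iff, mul_smul, mul_smul, inv_smul_eq_iff]
  exact h1

/-- Summation over the points fixed by `V`, by orbits of a subgroup `U` containing `V`. -/
theorem sum_fixed_eq {V U : Subgroup G} (hV : IsOpenSubgroup Ω V) (hU : IsOpenSubgroup Ω U)
    (hVU : V ≤ U) (hΔ : IsHomogeneous (TransGSet.coset V hV)) {Y : Type u} [MulAction G Y]
    (hY : IsSmooth G Ω Y) [Finite (MulAction.orbitRel.Quotient U Y)]
    [Fintype {y : Y // V ≤ MulAction.stabilizer G y}] {R : Type*} [CommRing R] (a : Y → R)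
    (ha : ∀ g ∈ U, ∀ y, a (g • y) = a y) :
    ∑ y : {y : Y // V ≤ MulAction.stabilizer G y}, a y =
      ∑ᶠ o : MulAction.orbitRel.Quotient U Y, a o.out *
        (fibreCard (TransGSet.coset V hV)
          (cosetMap (hU.inf (hY o.out)) hU inf_le_left) : R) := by
  classical
  have := Fintype.ofFinite (MulAction.orbitRel.Quotient U Y)
  rw [finsum_eq_sum_of_fintype, ← Finset.sum_fiberwise (s := Finset.univ)
    (g := fun y : {y : Y // V ≤ MulAction.stabilizer G y} =>
      (Quotient.mk'' y.1 : MulAction.orbitRel.Quotient U Y))]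
  refine Finset.sum_congr rfl fun o _ => ?_
  have hmem : ∀ y : Y, (Quotient.mk'' y : MulAction.orbitRel.Quotient U Y) = o ↔
      y ∈ MulAction.orbit U o.out := fun y => by
    rw [← MulAction.orbitRel_apply, ← Quotient.eq'', Quotient.out_eq']
  rw [fibreCard_coset hV hU hVU hΔ hY]
  rw [Finset.sum_congr rfl (g := fun _ => a o.out)]
  · rw [Finset.sum_const, nsmul_eq_mul, mul_comm]
    congr 2
    rw [← Fintype.card_subtype, ← Nat.card_eq_fintype_card]
    refine Nat.card_congr ?_
    refine (Equiv.subtypeSubtypeEquivSubtypeInter (fun y => V ≤ MulAction.stabilizer G y)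
      (fun y => (Quotient.mk'' y : MulAction.orbitRel.Quotient U Y) = o)).trans
      (Equiv.subtypeEquivRight fun y => ?_)
    rw [and_comm, hmem]
  · intro y hy
    obtain ⟨u, hu⟩ := (hmem y).1 (Finset.mem_filter.1 hy).2
    rw [← hu]
    exact ha u.1 u.2 _

end FixedPoints

/-! ### Orbits of pointwise stabilizers on vectors, and their sizes at finite levels. -/

section GeneralLinearGroup

variable {F : Type u} [Field F]

theorem mem_orbit_fixer_even {A₀ A₁ : Submodule F (ℕ →₀ F)} (h₀ : A₀.FG) {v : ℕ →₀ F}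
    (hv : v ∉ A₀) (y : ℕ →₀ F) :
    (∃ g ∈ fixer A₀ A₁, g.1.1 v = y) ↔ y ∉ A₀ ∧ ∀ a ∈ A₁, pairing (y - v) a = 0 := by
  refine ⟨?_, fun h => exists_mem_fixer_map_eq' h₀ hv h.1 h.2⟩
  rintro ⟨g, hg, rfl⟩
  refine ⟨fun h => hv ?_, fun a ha => ?_⟩
  · have := hg.1 _ h
    rwa [g.1.1.injective this] at h
  · rw [pairing_sub_left, sub_eq_zero]
    conv_lhs => rw [← hg.2 a ha]
    exact GLInf.pairing_map g v a

theorem mem_orbit_fixer_odd {A₀ A₁ : Submodule F (ℕ →₀ F)} (h₁ : A₁.FG) {v : ℕ →₀ F}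
    (hv : v ∉ A₁) (y : ℕ →₀ F) :
    (∃ g ∈ fixer A₀ A₁, g.1.2 v = y) ↔ y ∉ A₁ ∧ ∀ a ∈ A₀, pairing (y - v) a = 0 := by
  rw [← mem_orbit_fixer_even h₁ hv]
  constructor
  · rintro ⟨g, hg, h⟩
    exact ⟨GLInf.swap g, swap_mem_fixer.2 hg, h⟩
  · rintro ⟨g, hg, h⟩
    exact ⟨GLInf.swap g, swap_mem_fixer.2 hg, h⟩

theorem mem_orbit_iff_even {U : Subgroup (GLInf F)} (v y : EvenPart F) :
    y ∈ MulAction.orbit U v ↔ ∃ g ∈ U, g.1.1 v = y :=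
  ⟨fun ⟨g, hg⟩ => ⟨g.1, g.2, hg⟩, fun ⟨g, hg, h⟩ => ⟨⟨g, hg⟩, h⟩⟩

theorem mem_orbit_iff_odd {U : Subgroup (GLInf F)} (v y : OddPart F) :
    y ∈ MulAction.orbit U v ↔ ∃ g ∈ U, g.1.2 v = y :=
  ⟨fun ⟨g, hg⟩ => ⟨g.1, g.2, hg⟩, fun ⟨g, hg, h⟩ => ⟨⟨g, hg⟩, h⟩⟩

theorem levelSubgroup_le_stabilizer_even {n : ℕ} (y : ℕ →₀ F) :
    levelSubgroup F n ≤ MulAction.stabilizer (α := EvenPart F) (GLInf F) y ↔ y ∈ initial F n := by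
  have fg := Module.Finite.iff_fg.1 (finite_initial (F := F) n)
  rw [levelSubgroup_eq_fixer]
  refine ⟨fun h => ?_, fun h g hg => hg.1 y h⟩
  rw [← Submodule.span_singleton_le_iff_mem, ← bot_sup_eq (Submodule.span F {y})]
  refine le_of_fixer_le_left (A₁ := ⊥) fg fg ?_
  rw [fixer_sup_span_left, fixer_bot, top_inf_eq]
  exact h

theorem levelSubgroup_le_stabilizer_odd {n : ℕ} (y : ℕ →₀ F) :
    levelSubgroup F n ≤ MulAction.stabilizer (α := OddPart F) (GLInf F) y ↔ y ∈ initial F n := by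
  rw [← levelSubgroup_le_stabilizer_even]
  constructor
  · intro h g hg
    rw [levelSubgroup_eq_fixer] at hg
    exact h (by rw [levelSubgroup_eq_fixer]; exact swap_mem_fixer.2 hg : GLInf.swap g ∈ _)
  · intro h g hg
    rw [levelSubgroup_eq_fixer] at hg
    exact h (by rw [levelSubgroup_eq_fixer]; exact swap_mem_fixer.2 hg : GLInf.swap g ∈ _)

theorem card_initial [Finite F] (n : ℕ) : Nat.card (initial F n) = Nat.card F ^ n := by
  rw [initial, Nat.card_congr ((Finsupp.supportedEquivFinsupp (M := F) (R := F) (Set.Iio n)).toEquiv.trans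
    Finsupp.equivFunOnFinite), Nat.card_fun]
  congr 1
  simp

/-- The number of vectors of `initial F n` outside `A₀` with prescribed pairings with `A₁`. -/
theorem exists_eventuallyEval_card [Finite F] {A₀ A₁ : Submodule F (ℕ →₀ F)} (h₀ : A₀.FG)
    (h₁ : A₁.FG) (v : ℕ →₀ F) :
    ∃ p, EventuallyEval (Nat.card F) (fun n =>
      Nat.card {y : ℕ →₀ F // (y ∉ A₀ ∧ ∀ a ∈ A₁, pairing (y - v) a = 0) ∧ y ∈ initial F n}) p := by
  obtain ⟨N, e₀, e₁, e₂, -⟩ := exists_le_initial₄ h₀ h₁ (Submodule.fg_span_singleton v) h₀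
  rw [Submodule.span_singleton_le_iff_mem] at e₂
  have : Module.Finite F A₁ := Module.Finite.iff_fg.2 h₁
  have : Finite A₁ := Module.finite_of_finite F
  have hK : Finite (A₁ →ₗ[F] F) := DFunLike.finite _
  have hK0 : (Nat.card (A₁ →ₗ[F] F) : ℚ) ≠ 0 := Nat.cast_ne_zero.2 Nat.card_pos.ne'
  -- For large n, level n surjects onto the dual of `A₁`, so each fibre has q^n divided by the
  -- cardinality of that dual elements. The points of the fibre of `v` lying in `A₀` are removed;
  -- their number does not depend on n.
  refine ⟨C ((Nat.card (A₁ →ₗ[F] F) : ℚ)⁻¹) * X -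
    C (Nat.card {y : ℕ →₀ F // y ∈ A₀ ∧ ∀ a ∈ A₁, pairing (y - v) a = 0} : ℚ), ?_⟩
  filter_upwards [eventually_ge_atTop N] with n hn
  have f₀ := e₀.trans (initial_mono hn)
  have f₁ := e₁.trans (initial_mono hn)
  have f₂ := initial_mono hn e₂
  -- the linear map whose fibres are to be counted
  let ψ : initial F n →ₗ[F] A₁ →ₗ[F] F :=
    ((LinearMap.lcomp F F A₁.subtype).comp pairingHom).comp (initial F n).subtype
  have hψ : Function.Surjective ψ := fun φ => by
    obtain ⟨φ', hφ'⟩ := LinearMap.exists_extend φ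
    obtain ⟨w, hw, hwφ⟩ := exists_repr n φ'
    refine ⟨⟨w, hw⟩, LinearMap.ext fun a => ?_⟩
    change pairing w a = φ a
    rw [pairing_comm, hwφ _ (f₁ a.2), ← hφ']
    rfl
  have e := LinearMap.quotKerEquivOfSurjective (M := initial F n) (M₂ := A₁ →ₗ[F] F) ψ hψ
  have hcard := Submodule.card_eq_card_quotient_mul_card (R := F) (M := initial F n) (LinearMap.ker ψ)
  rw [card_initial, Nat.card_congr e.toEquiv] at hcard
  have hker : Nat.card (LinearMap.ker ψ) =
      Nat.card {y : ℕ →₀ F // (∀ a ∈ A₁, pairing (y - v) a = 0) ∧ y ∈ initial F n} := by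
    refine Nat.card_congr
      { toFun := fun y => ⟨y.1.1 + v, fun a ha => ?_, add_mem y.1.2 f₂⟩
        invFun := fun y => ⟨⟨y.1 - v, sub_mem y.2.2 f₂⟩, LinearMap.ext fun a => y.2.1 a a.2⟩
        left_inv := fun y => Subtype.ext (Subtype.ext (add_sub_cancel_right _ _))
        right_inv := fun y => Subtype.ext (sub_add_cancel _ _) }
    rw [add_sub_cancel_right]
    exact LinearMap.congr_fun y.2 (⟨a, ha⟩ : A₁)
  have hfin : Finite {y : ℕ →₀ F // y ∈ initial F n} := finite_initial_coe n
  have hfinset : {y : ℕ →₀ F | y ∈ initial F n}.Finite := hfin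
  have hsplit : Nat.card {y : ℕ →₀ F // (∀ a ∈ A₁, pairing (y - v) a = 0) ∧ y ∈ initial F n} =
      Nat.card {y : ℕ →₀ F // (y ∉ A₀ ∧ ∀ a ∈ A₁, pairing (y - v) a = 0) ∧ y ∈ initial F n} +
      Nat.card {y : ℕ →₀ F // y ∈ A₀ ∧ ∀ a ∈ A₁, pairing (y - v) a = 0} := by
    have hs : {y : ℕ →₀ F | (∀ a ∈ A₁, pairing (y - v) a = 0) ∧ y ∈ initial F n} =
        {y | (y ∉ A₀ ∧ ∀ a ∈ A₁, pairing (y - v) a = 0) ∧ y ∈ initial F n} ∪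
        {y | y ∈ A₀ ∧ ∀ a ∈ A₁, pairing (y - v) a = 0} := by
      ext y
      by_cases hy : y ∈ A₀
      · simp [hy, f₀ hy]
      · simp [hy]
    have hd : Disjoint
        {y : ℕ →₀ F | (y ∉ A₀ ∧ ∀ a ∈ A₁, pairing (y - v) a = 0) ∧ y ∈ initial F n}
        {y | y ∈ A₀ ∧ ∀ a ∈ A₁, pairing (y - v) a = 0} :=
      Set.disjoint_left.2 fun y h1 h2 => h1.1.1 h2.1
    have := Set.ncard_union_eq hd (hfinset.subset fun y h => h.2)
      (hfinset.subset fun y h => f₀ h.1)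
    rw [← hs] at this
    exact this
  rw [hker, hsplit] at hcard
  have hq : ((Nat.card F : ℚ)) ^ n = ((Nat.card {y : ℕ →₀ F //
      (y ∉ A₀ ∧ ∀ a ∈ A₁, pairing (y - v) a = 0) ∧ y ∈ initial F n} : ℚ) +
      (Nat.card {y : ℕ →₀ F // y ∈ A₀ ∧ ∀ a ∈ A₁, pairing (y - v) a = 0} : ℚ)) *
      (Nat.card (A₁ →ₗ[F] F) : ℚ) := by exact_mod_cast hcard
  rw [eval_sub, eval_mul, eval_C, eval_C, eval_X, hq]
  field_simp
  ring

end GeneralLinearGroup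

/-! ### Polynomiality of the counts and the universal polynomial measure. -/

section Counting

variable {F : Type u} [Field F]

theorem map_mem_of_isSupport {U : Subgroup (GLInf F)} {A₀ A₁ : Submodule F (ℕ →₀ F)}
    (h : IsSupport U A₀ A₁) {g : GLInf F} (hg : g ∈ U) :
    (∀ x ∈ A₀, g.1.1 x ∈ A₀) ∧ ∀ y ∈ A₁, g.1.2 y ∈ A₁ := by
  obtain ⟨h₀, h₁⟩ := h.min (h.fg₀.map ((g⁻¹).1.1 : (ℕ →₀ F) →ₗ[F] (ℕ →₀ F)))
    (h.fg₁.map ((g⁻¹).1.2 : (ℕ →₀ F) →ₗ[F] (ℕ →₀ F))) fun x hx => by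
      rw [mem_fixer_map] at hx
      have h1 := mul_mem (mul_mem (inv_mem hg) (h.fixer_le hx)) hg
      rw [inv_inv] at h1
      have e : g⁻¹ * (g * x * g⁻¹) * g = x := by group
      rwa [e] at h1
  refine ⟨fun x hx => ?_, fun x hx => ?_⟩
  · obtain ⟨y, hy, rfl⟩ := h₀ hx
    exact (GLInf.fst_inv_apply g y).symm ▸ hy
  · obtain ⟨y, hy, rfl⟩ := h₁ hx
    exact (GLInf.snd_inv_apply g y).symm ▸ hy

/-- `U` normalizes the pointwise stabilizer of its support. -/
theorem conj_mem_fixer_of_isSupport {U : Subgroup (GLInf F)} {A₀ A₁ : Submodule F (ℕ →₀ F)}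
    (h : IsSupport U A₀ A₁) {g x : GLInf F} (hg : g ∈ U) (hx : x ∈ fixer A₀ A₁) :
    g⁻¹ * x * g ∈ fixer A₀ A₁ := by
  rw [← mem_fixer_map]
  obtain ⟨h₀, h₁⟩ := map_mem_of_isSupport h hg
  refine fixer_anti ?_ ?_ hx
  · rintro - ⟨y, hy, rfl⟩
    exact h₀ y hy
  · rintro - ⟨y, hy, rfl⟩
    exact h₁ y hy

variable [Finite F]

/-- The number of maps `Δ_n → X` is eventually a polynomial in `q ^ n`. -/
def HasPolynomialCount (X : TransGSet (GLInf F) (InfSpace F)) : Prop :=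
  ∃ p, EventuallyEval (Nat.card F) (fun n => Nat.card (perfectEmbeddings F n →[GLInf F] X)) p

theorem card_hom_perfectEmbeddings {Y X : TransGSet (GLInf F) (InfSpace F)} (f : Y →[GLInf F] X)
    (n : ℕ) : Nat.card (perfectEmbeddings F n →[GLInf F] Y) =
      Nat.card (perfectEmbeddings F n →[GLInf F] X) * fibreCard (perfectEmbeddings F n) f :=
  card_hom_eq_mul (isHomogeneous_perfectEmbeddings n) (finite_hom_perfectEmbeddings n) f

theorem HasPolynomialCount.of_target {Y X : TransGSet (GLInf F) (InfSpace F)} (f : Y →[GLInf F] X)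
    (hf : ∃ s, EventuallyEval (Nat.card F) (fun n => fibreCard (perfectEmbeddings F n) f) s)
    (hX : HasPolynomialCount X) : HasPolynomialCount Y := by
  obtain ⟨s, hs⟩ := hf
  obtain ⟨p, hp⟩ := hX
  exact ⟨p * s, (hp.mul hs).congr (Eventually.of_forall (card_hom_perfectEmbeddings f))⟩

theorem HasPolynomialCount.of_source {Y X : TransGSet (GLInf F) (InfSpace F)} (f : Y →[GLInf F] X)
    {d : ℕ} (hd : d ≠ 0) (hf : ∀ᶠ n in atTop, fibreCard (perfectEmbeddings F n) f = d)
    (hY : HasPolynomialCount Y) : HasPolynomialCount X := by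
  obtain ⟨p, hp⟩ := hY
  refine EventuallyEval.exists_div (p := C (d : ℚ)) (Finite.one_lt_card (α := F))
    (C_ne_zero.2 (Nat.cast_ne_zero.2 hd)) (EventuallyEval.const _ d) hp ?_
  filter_upwards [hf] with n hn
  rw [card_hom_perfectEmbeddings f, hn, mul_comm]

theorem exists_eventuallyEval_fibreCard_even {A₀ A₁ : Submodule F (ℕ →₀ F)} (h₀ : A₀.FG)
    (h₁ : A₁.FG) {v : ℕ →₀ F} (hv : v ∉ A₀) :
    ∃ s, EventuallyEval (Nat.card F) (fun n => fibreCard (perfectEmbeddings F n)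
      (cosetMap ((isOpenSubgroup_fixer h₀ h₁).inf (isSmooth_evenPart F v))
        (isOpenSubgroup_fixer h₀ h₁) inf_le_left)) s := by
  obtain ⟨p, hp⟩ := exists_eventuallyEval_card h₀ h₁ v
  refine ⟨p, hp.congr ?_⟩
  filter_upwards [eventually_levelSubgroup_le (isOpenSubgroup_fixer h₀ h₁)] with n hn
  refine (fibreCard_coset _ _ hn (isHomogeneous_perfectEmbeddings n) (isSmooth_evenPart F) v).trans
    (Nat.card_congr (Equiv.subtypeEquivRight fun y => and_congr ?_ ?_))
  · exact (mem_orbit_iff_even v y).trans (mem_orbit_fixer_even h₀ hv y)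
  · exact levelSubgroup_le_stabilizer_even y

theorem exists_eventuallyEval_fibreCard_odd {A₀ A₁ : Submodule F (ℕ →₀ F)} (h₀ : A₀.FG)
    (h₁ : A₁.FG) {v : ℕ →₀ F} (hv : v ∉ A₁) :
    ∃ s, EventuallyEval (Nat.card F) (fun n => fibreCard (perfectEmbeddings F n)
      (cosetMap ((isOpenSubgroup_fixer h₀ h₁).inf (isSmooth_oddPart v))
        (isOpenSubgroup_fixer h₀ h₁) inf_le_left)) s := by
  obtain ⟨p, hp⟩ := exists_eventuallyEval_card h₁ h₀ v
  refine ⟨p, hp.congr ?_⟩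
  filter_upwards [eventually_levelSubgroup_le (isOpenSubgroup_fixer h₀ h₁)] with n hn
  refine (fibreCard_coset _ _ hn (isHomogeneous_perfectEmbeddings n) isSmooth_oddPart v).trans
    (Nat.card_congr (Equiv.subtypeEquivRight fun y => and_congr ?_ ?_))
  · exact (mem_orbit_iff_odd v y).trans (mem_orbit_fixer_odd h₁ hv y)
  · exact levelSubgroup_le_stabilizer_odd y

theorem hasPolynomialCount_fixer {A₀ A₁ : Submodule F (ℕ →₀ F)} (h₀ : A₀.FG) (h₁ : A₁.FG)
    (h : IsOpenSubgroup (InfSpace F) (fixer A₀ A₁)) :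
    HasPolynomialCount (TransGSet.coset (fixer A₀ A₁) h) := by
  revert h
  refine fixer_induction (P := fun A₀ A₁ => ∀ h : IsOpenSubgroup (InfSpace F) (fixer A₀ A₁),
    HasPolynomialCount (TransGSet.coset _ h)) Submodule.fg_bot Submodule.fg_bot ?_ ?_ ?_
    h₀ h₁ bot_le bot_le
  · intro h
    refine ⟨C ((1 : ℕ) : ℚ), (EventuallyEval.const _ 1).congr ?_⟩
    filter_upwards [eventually_nonempty_hom (TransGSet.coset _ h)] with n hn
    refine Nat.card_eq_one_iff_unique.2 ⟨⟨fun f g => coset_hom_ext ?_⟩, hn⟩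
    obtain ⟨a, ha⟩ := TransGSet.exists_smul_base h (f (TransGSet.base _))
    obtain ⟨b, hb⟩ := TransGSet.exists_smul_base h (g (TransGSet.base _))
    refine ha.trans (Eq.trans ?_ hb.symm)
    rw [TransGSet.smul_base_eq_iff, fixer_bot]
    trivial
  · intro A₀ A₁ v h₀ h₁ _ _ ih
    by_cases hv : v ∈ A₀
    · rwa [sup_eq_left.2 ((Submodule.span_singleton_le_iff_mem _ _).2 hv)]
    rw [fixer_sup_span_left]
    exact fun _ => (ih (isOpenSubgroup_fixer h₀ h₁)).of_target _
      (exists_eventuallyEval_fibreCard_even h₀ h₁ hv)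
  · intro A₀ A₁ v h₀ h₁ _ _ ih
    by_cases hv : v ∈ A₁
    · rwa [sup_eq_left.2 ((Submodule.span_singleton_le_iff_mem _ _).2 hv)]
    rw [fixer_sup_span_right]
    exact fun _ => (ih (isOpenSubgroup_fixer h₀ h₁)).of_target _
      (exists_eventuallyEval_fibreCard_odd h₀ h₁ hv)

/-- `U` normalizes the stabilizer of its support, so once G(n) lies in that stabilizer it fixes
every point of the `U`-orbit of the base point. The count is then the size of this orbit, whatever n
is. -/
theorem exists_fibreCard_eq_of_isSupport {U : Subgroup (GLInf F)}
    (hU : IsOpenSubgroup (InfSpace F) U) {A₀ A₁ : Submodule F (ℕ →₀ F)} (h : IsSupport U A₀ A₁) :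
    ∃ d : ℕ, d ≠ 0 ∧ ∀ᶠ n in atTop, fibreCard (perfectEmbeddings F n)
      (cosetMap (isOpenSubgroup_fixer h.fg₀ h.fg₁) hU h.fixer_le) = d := by
  have hA := isOpenSubgroup_fixer h.fg₀ h.fg₁
  have hsm := (TransGSet.coset _ hA).smooth
  have hst : fixer A₀ A₁ = U ⊓ MulAction.stabilizer (GLInf F) (TransGSet.base hA) := by
    rw [TransGSet.stabilizer_base, inf_eq_right.2 h.fixer_le]
  have key : ∀ᶠ n in atTop, ∀ y ∈ MulAction.orbit U (TransGSet.base hA),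
      levelSubgroup F n ≤ MulAction.stabilizer (GLInf F) y := by
    filter_upwards [eventually_levelSubgroup_le hA] with n hn
    rintro - ⟨⟨g, hg⟩, rfl⟩ x hx
    change x ∈ MulAction.stabilizer (GLInf F) (g • TransGSet.base hA)
    rw [MulAction.mem_stabilizer_iff, ← mul_smul, eq_comm, TransGSet.smul_base_eq_iff, ← mul_assoc]
    exact conj_mem_fixer_of_isSupport h hg (hn hx)
  refine ⟨Nat.card (MulAction.orbit U (TransGSet.base hA)), ?_, ?_⟩
  · obtain ⟨n, hn⟩ := key.exists
    have : Finite (MulAction.orbit U (TransGSet.base hA)) := by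
      have := finite_hom_coset_levelSubgroup (isOpenSubgroup_levelSubgroup F n)
        (TransGSet.coset _ hA)
      refine Finite.of_injective (fun y => cosetHom (isOpenSubgroup_levelSubgroup F n) y.1
        (hn y.1 y.2)) fun y z hyz => ?_
      have h1 := DFunLike.congr_fun hyz (TransGSet.base (isOpenSubgroup_levelSubgroup F n))
      exact Subtype.ext ((cosetHom_base _ _ _).symm.trans (h1.trans (cosetHom_base _ _ _)))
    have : Nonempty (MulAction.orbit U (TransGSet.base hA)) := ⟨⟨_, MulAction.mem_orbit_self _⟩⟩
    exact Nat.card_pos.ne'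
  · filter_upwards [key, eventually_levelSubgroup_le hU] with n hn hnU
    refine (fibreCard_cosetMap _ hU hA h.fixer_le hnU (isHomogeneous_perfectEmbeddings n) hsm
      (TransGSet.base hA) hst).trans (Nat.card_congr (Equiv.subtypeEquivRight fun y => ?_))
    exact ⟨fun h => h.1, fun h => ⟨h, hn y h⟩⟩

/-- The count for the stabilizer of the support is obtained by adjoining vectors one by one;
descending to `X` divides it by a nonzero constant. -/
theorem hasPolynomialCount (X : TransGSet (GLInf F) (InfSpace F)) : HasPolynomialCount X := by
  obtain ⟨x⟩ := X.nonempty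
  have hU := X.smooth x
  obtain ⟨A₀, A₁, hA⟩ := exists_isSupport hU
  obtain ⟨d, hd, hfd⟩ := exists_fibreCard_eq_of_isSupport hU hA
  have h1 := (hasPolynomialCount_fixer hA.fg₀ hA.fg₁ (isOpenSubgroup_fixer hA.fg₀ hA.fg₁)).of_source _ hd hfd
  refine h1.of_source (cosetHom hU x le_rfl) one_ne_zero ?_
  filter_upwards [eventually_nonempty_hom X] with n hn
  refine fibreCard_of_bijective _ ⟨fun a b hab => ?_, hom_surjective _⟩ hn
  obtain ⟨a, rfl⟩ := TransGSet.exists_smul_base hU a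
  obtain ⟨b, rfl⟩ := TransGSet.exists_smul_base hU b
  rw [cosetHom_smul_base, cosetHom_smul_base] at hab
  rw [TransGSet.smul_base_eq_iff, MulAction.mem_stabilizer_iff, mul_smul, ← hab, inv_smul_smul]

/-- The fibre cardinality is the quotient of the counts for `Y` and for `X`; the latter is not the
zero polynomial, since maps to `X` exist for large n. -/
theorem exists_eventuallyEval_fibreCard {Y X : TransGSet (GLInf F) (InfSpace F)}
    (f : Y →[GLInf F] X) :
    ∃ p, EventuallyEval (Nat.card F) (fun n => fibreCard (perfectEmbeddings F n) f) p := by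
  obtain ⟨p, hp⟩ := hasPolynomialCount X
  obtain ⟨r, hr⟩ := hasPolynomialCount Y
  refine EventuallyEval.exists_div (Finite.one_lt_card (α := F)) ?_ hp hr
    (Eventually.of_forall (card_hom_perfectEmbeddings f))
  rintro rfl
  obtain ⟨n, h1, h2⟩ := (hp.and (eventually_nonempty_hom X)).exists
  have := finite_hom_perfectEmbeddings n X
  rw [eval_zero, Nat.cast_eq_zero] at h1
  exact Nat.card_pos.ne' h1

/-- The polynomial whose values at `q ^ n`, for large `n`, are the fibre cardinalities of `f`. -/
noncomputable def fibrePolynomial {Y X : TransGSet (GLInf F) (InfSpace F)} (f : Y →[GLInf F] X) :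
    ℚ[X] :=
  (exists_eventuallyEval_fibreCard f).choose

theorem fibrePolynomial_spec {Y X : TransGSet (GLInf F) (InfSpace F)} (f : Y →[GLInf F] X) :
    EventuallyEval (Nat.card F) (fun n => fibreCard (perfectEmbeddings F n) f)
      (fibrePolynomial f) :=
  (exists_eventuallyEval_fibreCard f).choose_spec

variable (F) in
/-- The universal measure with values in the polynomial ring over the rational numbers. -/
noncomputable def polynomialMeasure : Measure (GLInf F) (InfSpace F) ℚ[X] where
  toFun f := fibrePolynomial f
  -- Each axiom holds for the fibre cardinalities at all large n, and a polynomial is determined by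
  -- its values at large powers of q.
  map_iso {Y X} f hf := by
    rw [← C_1, ← Nat.cast_one (R := ℚ)]
    refine (fibrePolynomial_spec f).unique (Finite.one_lt_card (α := F))
      (EventuallyEval.const _ 1) ?_
    filter_upwards [eventually_nonempty_hom X] with n hn
    exact fibreCard_of_bijective f hf hn
  map_comp f g := (fibrePolynomial_spec (f.comp g)).unique (Finite.one_lt_card (α := F))
    ((fibrePolynomial_spec f).mul (fibrePolynomial_spec g)) (Eventually.of_forall fun n =>
      fibreCard_comp (isHomogeneous_perfectEmbeddings n) (finite_hom_perfectEmbeddings n) f g)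
  map_base_change {X Y X'} f h n Y' p r hd := by
    refine (fibrePolynomial_spec f).unique (Finite.one_lt_card (α := F))
      (EventuallyEval.sum Finset.univ fun i => fibrePolynomial_spec (r i)) ?_
    filter_upwards [eventually_nonempty_hom X'] with n hn
    exact fibreCard_base_change (isHomogeneous_perfectEmbeddings n) (finite_hom_perfectEmbeddings n)
      f h p r hd hn

end Counting

/-! ### Change of coefficients. -/

section Map

variable {G Ω : Type u} [Group G] [MulAction G Ω]

/-- The image of a measure under a ring homomorphism. -/
def Measure.map {k : Type v} {k' : Type w} [CommRing k] [CommRing k'] (φ : k →+* k')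
    (μ : Measure G Ω k) : Measure G Ω k' where
  toFun f := φ (μ.toFun f)
  map_iso f hf := by rw [μ.map_iso f hf, map_one]
  map_comp f g := by rw [μ.map_comp f g, map_mul]
  map_base_change f h n Y' p r hd := by rw [μ.map_base_change f h p r hd, map_sum]

theorem Measure.map_integral {k : Type v} {k' : Type w} [CommRing k] [CommRing k'] (φ : k →+* k')
    (μ : Measure G Ω k) {Y : Type u} [MulAction G Y] (hY : IsSmooth G Ω Y) (U : Subgroup G)
    (hU : IsOpenSubgroup Ω U) [Finite (MulAction.orbitRel.Quotient U Y)] (a : Y → k) :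
    (μ.map φ).integral hY U hU (fun y => φ (a y)) = φ (μ.integral hY U hU a) := by
  have := Fintype.ofFinite (MulAction.orbitRel.Quotient U Y)
  simp only [Measure.integral, finsum_eq_sum_of_fintype, map_sum, map_mul]
  rfl

theorem Measure.toRingHom_map {k : Type v} {k' : Type w} [CommRing k] [CommRing k'] (φ : k →+* k')
    (μ : Measure G Ω k) : (μ.map φ).toRingHom = φ.comp μ.toRingHom := by
  refine Ideal.Quotient.ringHom_ext (MvPolynomial.ringHom_ext (fun r => ?_) fun f => ?_)
  · simp [Measure.toRingHom]
  · simp [Measure.toRingHom, Measure.map]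

end Map

/-! ### The universal measure of 𝐕₀. -/

section Value

variable {F : Type u} [Field F] [Finite F]

theorem finite_orbits_of_isFinitary {Y : Type u} [MulAction (GLInf F) Y]
    (hY : IsSmooth (GLInf F) (InfSpace F) Y) (hfin : IsFinitary (GLInf F) Y)
    {U : Subgroup (GLInf F)} (hU : IsOpenSubgroup (InfSpace F) U) :
    Finite (MulAction.orbitRel.Quotient U Y) :=
  (isOligomorphic_of_isFinitary hY hfin U hU).finite

theorem isFinitary_of_isOligomorphic {G Ω : Type u} [Group G] [MulAction G Ω] {Y : Type u}
    [MulAction G Y] (h : IsOligomorphic G Ω Y) : IsFinitary G Y := by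
  obtain ⟨S, hS, hS'⟩ := h ⊤ (isOpenSubgroup_top Ω)
  have := hS.to_subtype
  refine Finite.of_surjective
    (fun s : S => (Quotient.mk'' s.1 : MulAction.orbitRel.Quotient G Y)) fun o => ?_
  induction o using Quotient.inductionOn' with
  | h x =>
    obtain ⟨k, -, hx⟩ := hS' x
    exact ⟨⟨_, hx⟩, Quotient.sound' ⟨k, rfl⟩⟩

/-- Sum the fibre polynomials over the orbits and group the points fixed by G(n) by orbit: this is
`sum_fixed_eq` for the constant function 1. -/
theorem eventuallyEval_value {Y : Type u} [MulAction (GLInf F) Y]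
    (hY : IsSmooth (GLInf F) (InfSpace F) Y) (hfin : IsFinitary (GLInf F) Y) :
    EventuallyEval (Nat.card F)
      (fun n => Nat.card {y : Y // levelSubgroup F n ≤ MulAction.stabilizer (GLInf F) y})
      ((polynomialMeasure F).value hY) := by
  have hT := isOpenSubgroup_top (G := GLInf F) (InfSpace F)
  have := finite_orbits_of_isFinitary hY hfin hT
  have := Fintype.ofFinite (MulAction.orbitRel.Quotient (⊤ : Subgroup (GLInf F)) Y)
  have h1 : EventuallyEval (Nat.card F) (fun n =>
      ∑ o : MulAction.orbitRel.Quotient (⊤ : Subgroup (GLInf F)) Y,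
        fibreCard (perfectEmbeddings F n) (cosetMap (hT.inf (hY o.out)) hT inf_le_left))
      (∑ o : MulAction.orbitRel.Quotient (⊤ : Subgroup (GLInf F)) Y,
        (polynomialMeasure F).orbit hY ⊤ hT o.out) :=
    EventuallyEval.sum Finset.univ fun o => fibrePolynomial_spec _
  simp only [Measure.value, Measure.integral, one_mul, finsum_eq_sum_of_fintype]
  refine h1.congr (Eventually.of_forall fun n => ?_)
  have hn := isOpenSubgroup_levelSubgroup F n
  have hf := finite_fixed hn (finite_hom_perfectEmbeddings n) hY hfin
  have := Fintype.ofFinite {y : Y // levelSubgroup F n ≤ MulAction.stabilizer (GLInf F) y}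
  have h2 := sum_fixed_eq hn hT le_top (isHomogeneous_perfectEmbeddings n) hY (fun _ => (1 : ℤ))
    fun _ _ _ => rfl
  rw [finsum_eq_sum_of_fintype] at h2
  simp only [Finset.sum_const, Finset.card_univ, one_mul, nsmul_eq_mul, mul_one] at h2
  rw [Nat.card_eq_fintype_card]
  exact_mod_cast h2

theorem polynomialMeasure_value_even : (polynomialMeasure F).value (isSmooth_evenPart F) = X := by
  refine (eventuallyEval_value (isSmooth_evenPart F)
    (isFinitary_of_isOligomorphic isOligomorphic_evenPart)).unique (Finite.one_lt_card (α := F))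
    (c' := fun n => Nat.card F ^ n) (Eventually.of_forall fun n => by simp)
    (Eventually.of_forall fun n => ?_)
  rw [← card_initial]
  exact Nat.card_congr (Equiv.subtypeEquivRight fun y => levelSubgroup_le_stabilizer_even y)

theorem isMuParam_map {k : Type v} [CommRing k] (φ : ℚ[X] →+* k) :
    IsMuParam (φ X) ((polynomialMeasure F).map φ) := by
  have := (isOligomorphic_evenPart (F := F) ⊤ (isOpenSubgroup_top _)).finite
  rw [← polynomialMeasure_value_even (F := F)]
  refine Eq.trans ?_ ((polynomialMeasure F).map_integral φ _ _ _ _)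
  simp only [map_one]
  rfl

end Value

/-! ### Measures of orbits and their refinement under smaller groups. -/

section MeasureOn

variable {G Ω : Type u} [Group G] [MulAction G Ω] {k : Type v} [CommRing k] (μ : Measure G Ω k)

theorem cosetHom_bijective {V : Subgroup G} (hV : IsOpenSubgroup Ω V) (X : TransGSet G Ω) (x : X)
    (h : V = MulAction.stabilizer G x) : Function.Bijective (cosetHom hV x h.le) := by
  refine ⟨fun a b hab => ?_, hom_surjective (X := X) _⟩
  obtain ⟨a, rfl⟩ := TransGSet.exists_smul_base hV a
  obtain ⟨b, rfl⟩ := TransGSet.exists_smul_base hV b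
  rw [cosetHom_smul_base, cosetHom_smul_base] at hab
  rw [TransGSet.smul_base_eq_iff, h, MulAction.mem_stabilizer_iff, mul_smul, ← hab, inv_smul_smul]

theorem Measure.cosetMap_self {U U' : Subgroup G} (hU : IsOpenSubgroup Ω U)
    (hU' : IsOpenSubgroup Ω U') (h : U' ≤ U) (h' : U' = U) : μ.toFun (cosetMap hU' hU h) = 1 := by
  subst h'
  refine μ.map_iso _ ⟨fun a b hab => ?_, hom_surjective _⟩
  obtain ⟨a, rfl⟩ := TransGSet.exists_smul_base hU a
  obtain ⟨b, rfl⟩ := TransGSet.exists_smul_base hU b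
  rwa [cosetMap_smul_base, cosetMap_smul_base] at hab

theorem Measure.cosetMap_trans {H W U : Subgroup G} (hH : IsOpenSubgroup Ω H)
    (hW : IsOpenSubgroup Ω W) (hU : IsOpenSubgroup Ω U) (h : H ≤ W) (h' : W ≤ U) :
    μ.toFun (cosetMap hH hU (h.trans h')) =
      μ.toFun (cosetMap hW hU h') * μ.toFun (cosetMap hH hW h) := by
  rw [← μ.map_comp]
  congr 1
  exact coset_hom_ext rfl

theorem Measure.toFun_eq_cosetMap {Y X : TransGSet G Ω} (f : Y →[G] X) (y : Y)
    (h : MulAction.stabilizer G y ≤ MulAction.stabilizer G (f y)) :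
    μ.toFun f = μ.toFun (cosetMap (Y.smooth y) (X.smooth (f y)) h) := by
  have h1 : f.comp (cosetHom (Y.smooth y) y le_rfl) =
      (cosetHom (X.smooth (f y)) (f y) le_rfl).comp (cosetMap (Y.smooth y) (X.smooth (f y)) h) := by
    refine coset_hom_ext ?_
    rw [MulActionHom.comp_apply, MulActionHom.comp_apply, cosetHom_base, cosetMap_base,
      cosetHom_base]
  have h2 := μ.map_comp f (cosetHom (Y.smooth y) y le_rfl : TransGSet.coset _ (Y.smooth y) →[G] Y)
  have h3 := μ.map_comp
    (cosetHom (X.smooth (f y)) (f y) le_rfl : TransGSet.coset _ (X.smooth (f y)) →[G] X)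
    (cosetMap (Y.smooth y) (X.smooth (f y)) h)
  rw [μ.map_iso _ (cosetHom_bijective _ Y y rfl), mul_one] at h2
  rw [μ.map_iso _ (cosetHom_bijective _ X (f y) rfl), one_mul] at h3
  rw [← h2, ← h3, h1]

variable {Y : Type u} [MulAction G Y] (hY : IsSmooth G Ω Y)

theorem Measure.orbit_eq_cosetMap {U H : Subgroup G} (hU : IsOpenSubgroup Ω U)
    (hH : IsOpenSubgroup Ω H) (hHU : H ≤ U) (y : Y) (h : H = U ⊓ MulAction.stabilizer G y) :
    μ.orbit hY U hU y = μ.toFun (cosetMap hH hU hHU) := by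
  subst h
  rfl

theorem Measure.orbit_of_fixed {U : Subgroup G} (hU : IsOpenSubgroup Ω U) {y : Y}
    (h : U ≤ MulAction.stabilizer G y) : μ.orbit hY U hU y = 1 :=
  μ.cosetMap_self _ _ _ (inf_eq_left.2 h)

theorem exists_smul_out_eq (U : Subgroup G) (y : Y) :
    ∃ u ∈ U, u • y = (Quotient.mk'' y : MulAction.orbitRel.Quotient U Y).out := by
  obtain ⟨u, hu⟩ := MulAction.orbitRel_apply.1
    (Quotient.exact' (Quotient.out_eq' (Quotient.mk'' y : MulAction.orbitRel.Quotient U Y)))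
  exact ⟨u.1, u.2, hu⟩

theorem mk_eq_mk_iff (U : Subgroup G) (x y : Y) :
    (Quotient.mk'' x : MulAction.orbitRel.Quotient U Y) = Quotient.mk'' y ↔ ∃ u ∈ U, u • y = x := by
  rw [Quotient.eq'', MulAction.orbitRel_apply]
  exact ⟨fun ⟨u, hu⟩ => ⟨u.1, u.2, hu⟩, fun ⟨u, hu, h⟩ => ⟨⟨u, hu⟩, h⟩⟩

open Classical in
/-- The measure of the orbit of `y` under `U` is the sum of the measures of the orbits under a
smaller group `W` into which it decomposes. -/
theorem Measure.orbit_eq_sum {U W : Subgroup G} (hU : IsOpenSubgroup Ω U)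
    (hW : IsOpenSubgroup Ω W) (hWU : W ≤ U) [Fintype (MulAction.orbitRel.Quotient W Y)] (y : Y) :
    μ.orbit hY U hU y = ∑ o : MulAction.orbitRel.Quotient W Y,
      if o.out ∈ MulAction.orbit U y then μ.orbit hY W hW o.out else 0 := by
  let ι := {o : MulAction.orbitRel.Quotient W Y // o.out ∈ MulAction.orbit U y}
  let e : Fin (Fintype.card ι) ≃ ι := (Fintype.equivFin ι).symm
  have hH := hU.inf (hY y)
  choose u hu using fun o : ι => (o.2 : ∃ u : U, u • y = o.1.out)
  have hst : ∀ o : ι, W ⊓ MulAction.stabilizer G o.1.out ≤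
      MulAction.stabilizer G ((u o : G) • TransGSet.base hH) := by
    intro o g hg
    rw [MulAction.mem_stabilizer_iff, ← mul_smul, eq_comm, TransGSet.smul_base_eq_iff,
      Subgroup.mem_inf]
    refine ⟨mul_mem (inv_mem (u o).2) (mul_mem (hWU hg.1) (u o).2), ?_⟩
    have h1 : g • o.1.out = o.1.out := hg.2
    have h2 : (u o : G) • y = o.1.out := hu o
    rw [MulAction.mem_stabilizer_iff, mul_smul, mul_smul, h2, h1, inv_smul_eq_iff, h2]
  -- Base change along G/W → G/U: the orbits of the fibre product correspond to the W-orbits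
  -- contained in U y, the orbit of a point z contributing G/(W ∩ G_z).
  have hdec : IsOrbitDecomp (cosetMap hH hU inf_le_left) (cosetMap hW hU hWU)
      (Y' := fun i => TransGSet.coset _ (hW.inf (hY (e i).1.out)))
      (fun i => cosetHom (hW.inf (hY (e i).1.out)) _ (hst (e i)))
      (fun i => cosetMap (hW.inf (hY (e i).1.out)) hW inf_le_left) := by
    constructor
    · intro i z
      obtain ⟨g, rfl⟩ := TransGSet.exists_smul_base _ z
      rw [cosetHom_smul_base, cosetMap_smul_base, ← mul_smul, cosetMap_smul_base,
        cosetMap_smul_base, TransGSet.smul_base_eq_iff, mul_inv_rev, inv_mul_cancel_right]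
      exact inv_mem (u (e i)).2
    · intro a b hab
      obtain ⟨a, rfl⟩ := TransGSet.exists_smul_base _ a
      obtain ⟨b, rfl⟩ := TransGSet.exists_smul_base _ b
      rw [cosetMap_smul_base, cosetMap_smul_base, eq_comm, TransGSet.smul_base_eq_iff] at hab
      obtain ⟨w, hw, hwy⟩ := exists_smul_out_eq W ((b⁻¹ * a) • y)
      set o : MulAction.orbitRel.Quotient W Y := Quotient.mk'' ((b⁻¹ * a) • y) with ho
      have hoU : o.out ∈ MulAction.orbit U y := by
        refine ⟨⟨w * (b⁻¹ * a), mul_mem (hWU hw) hab⟩, ?_⟩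
        rw [← hwy, ← mul_smul]
        rfl
      refine ⟨⟨e.symm ⟨o, hoU⟩, (b * w⁻¹) • TransGSet.base _⟩, ⟨?_, ?_⟩, ?_⟩
      · simp only [cosetHom_smul_base]
        rw [← mul_smul, TransGSet.smul_base_eq_iff, Subgroup.mem_inf]
        have h2 : ((u (e (e.symm ⟨o, hoU⟩)) : U) : G) • y = o.out := by
          have := hu (e (e.symm ⟨o, hoU⟩))
          rwa [e.apply_symm_apply] at this ⊢
        constructor
        · have : (b * w⁻¹ * (u (e (e.symm ⟨o, hoU⟩)) : U))⁻¹ * a =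
              ((u (e (e.symm ⟨o, hoU⟩)) : U) : G)⁻¹ * (w * (b⁻¹ * a)) := by group
          rw [this]
          exact mul_mem (inv_mem (u _).2) (mul_mem (hWU hw) hab)
        · rw [MulAction.mem_stabilizer_iff, mul_smul, inv_smul_eq_iff, mul_smul, mul_smul, h2,
            ← hwy, inv_smul_smul, ← mul_smul, mul_inv_cancel_left]
      · simp only [cosetMap_smul_base]
        rw [TransGSet.smul_base_eq_iff, mul_inv_rev, inv_inv, inv_mul_cancel_right]
        exact hw
      · rintro ⟨i, z⟩ ⟨h1, h2⟩
        obtain ⟨c, rfl⟩ := TransGSet.exists_smul_base _ z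
        obtain ⟨j, rfl⟩ := e.symm.surjective i
        simp only [cosetHom_smul_base, cosetMap_smul_base] at h1 h2
        rw [← mul_smul, TransGSet.smul_base_eq_iff, Subgroup.mem_inf] at h1
        rw [TransGSet.smul_base_eq_iff] at h2
        have h3 : ((u (e (e.symm j)) : U) : G) • y = j.1.out := by
          have := hu (e (e.symm j))
          rwa [e.apply_symm_apply] at this ⊢
        have h4 : c • j.1.out = a • y := by
          have := h1.2
          rw [MulAction.mem_stabilizer_iff, mul_smul, inv_smul_eq_iff, mul_smul, h3] at this
          exact this.symm
        have h5 : j.1 = o := by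
          rw [ho, ← Quotient.out_eq' j.1, mk_eq_mk_iff]
          refine ⟨c⁻¹ * b, h2, ?_⟩
          rw [mul_smul, ← mul_smul b, mul_inv_cancel_left, ← h4, inv_smul_smul]
        obtain rfl : j = ⟨o, hoU⟩ := Subtype.ext h5
        congr 1
        rw [TransGSet.smul_base_eq_iff, Subgroup.mem_inf]
        refine ⟨?_, ?_⟩
        · have : c⁻¹ * (b * w⁻¹) = (c⁻¹ * b) * w⁻¹ := by group
          rw [this]
          exact mul_mem h2 (inv_mem hw)
        · rw [e.apply_symm_apply, MulAction.mem_stabilizer_iff, mul_smul, inv_smul_eq_iff]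
          change _ = c • o.out
          rw [h4]
          change (b * w⁻¹) • o.out = _
          rw [mul_smul, ← hwy, inv_smul_smul, ← mul_smul, mul_inv_cancel_left]
  have h1 := μ.map_base_change _ _ _ _ hdec
  refine h1.trans ?_
  rw [← Finset.sum_filter]
  refine (Equiv.sum_comp e fun o : ι => μ.orbit hY W hW o.1.out).trans ?_
  exact (Finset.sum_subtype (p := fun o : MulAction.orbitRel.Quotient W Y =>
    o.out ∈ MulAction.orbit U y) _ (by simp) fun o => μ.orbit hY W hW o.out).symm

end MeasureOn

/-! ### Measures of invariant subsets and of cosets. -/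

section MeasureOn

variable {G Ω : Type u} [Group G] [MulAction G Ω] {k : Type v} [CommRing k] (μ : Measure G Ω k)
variable {Y : Type u} [MulAction G Y] (hY : IsSmooth G Ω Y)

-- Independence of the representative is the refinement formula with W = U, where a single summand
-- survives.
open Classical in
theorem Measure.orbit_out {U : Subgroup G} (hU : IsOpenSubgroup Ω U)
    [Finite (MulAction.orbitRel.Quotient U Y)] (y : Y) :
    μ.orbit hY U hU (Quotient.mk'' y : MulAction.orbitRel.Quotient U Y).out =
      μ.orbit hY U hU y := by
  have := Fintype.ofFinite (MulAction.orbitRel.Quotient U Y)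
  rw [μ.orbit_eq_sum hY hU hU le_rfl y, Finset.sum_eq_single
    (Quotient.mk'' y : MulAction.orbitRel.Quotient U Y)]
  · rw [if_pos]
    obtain ⟨u, hu, h⟩ := exists_smul_out_eq U y
    exact ⟨⟨u, hu⟩, h⟩
  · intro o _ ho
    rw [if_neg]
    rintro ⟨u, hu⟩
    refine ho ?_
    rw [← Quotient.out_eq' o, mk_eq_mk_iff]
    exact ⟨u.1, u.2, hu⟩
  · exact fun h => absurd (Finset.mem_univ _) h

open Classical in
/-- The measure of a `U`-invariant subset `S`. -/
noncomputable def Measure.measureOn (U : Subgroup G) (hU : IsOpenSubgroup Ω U) (S : Set Y) : k :=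
  ∑ᶠ o : MulAction.orbitRel.Quotient U Y, if o.out ∈ S then μ.orbit hY U hU o.out else 0

theorem out_mem_iff {U : Subgroup G} {S : Set Y} (hS : ∀ u ∈ U, ∀ y ∈ S, u • y ∈ S) (y : Y) :
    (Quotient.mk'' y : MulAction.orbitRel.Quotient U Y).out ∈ S ↔ y ∈ S := by
  obtain ⟨u, hu, h⟩ := exists_smul_out_eq U y
  rw [← h]
  refine ⟨fun h1 => ?_, hS u hu y⟩
  have := hS u⁻¹ (inv_mem hu) _ h1
  rwa [inv_smul_smul] at this

theorem Measure.measureOn_eq_of_le {U W : Subgroup G} (hU : IsOpenSubgroup Ω U)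
    (hW : IsOpenSubgroup Ω W) (hWU : W ≤ U) [Finite (MulAction.orbitRel.Quotient U Y)]
    [Finite (MulAction.orbitRel.Quotient W Y)] {S : Set Y} (hS : ∀ u ∈ U, ∀ y ∈ S, u • y ∈ S) :
    μ.measureOn hY U hU S = μ.measureOn hY W hW S := by
  classical
  have := Fintype.ofFinite (MulAction.orbitRel.Quotient U Y)
  have := Fintype.ofFinite (MulAction.orbitRel.Quotient W Y)
  rw [Measure.measureOn, Measure.measureOn, finsum_eq_sum_of_fintype, finsum_eq_sum_of_fintype]
  simp only [μ.orbit_eq_sum hY hU hW hWU]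
  have h1 : ∀ o : MulAction.orbitRel.Quotient U Y,
      (if o.out ∈ S then ∑ o' : MulAction.orbitRel.Quotient W Y,
        (if o'.out ∈ MulAction.orbit U o.out then μ.orbit hY W hW o'.out else 0) else 0) =
      ∑ o' : MulAction.orbitRel.Quotient W Y,
        if o = Quotient.mk'' o'.out then
          (if o'.out ∈ S then μ.orbit hY W hW o'.out else 0) else 0 := by
    intro o
    have h2 : ∀ y : Y, y ∈ MulAction.orbit U o.out ↔ o = Quotient.mk'' y := fun y => by
      rw [← MulAction.orbitRel_apply, ← Quotient.eq'', Quotient.out_eq', eq_comm]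
    by_cases ho : o.out ∈ S
    · rw [if_pos ho]
      refine Finset.sum_congr rfl fun o' _ => ?_
      simp only [h2]
      by_cases h3 : o = Quotient.mk'' o'.out
      · rw [if_pos h3, if_pos h3, if_pos]
        rwa [h3, out_mem_iff hS] at ho
      · rw [if_neg h3, if_neg h3]
    · rw [if_neg ho, Finset.sum_eq_zero]
      intro o' _
      by_cases h3 : o = Quotient.mk'' o'.out
      · rw [if_pos h3, if_neg]
        rwa [h3, out_mem_iff hS] at ho
      · rw [if_neg h3]
  rw [Finset.sum_congr rfl fun o _ => h1 o, Finset.sum_comm]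
  refine Finset.sum_congr rfl fun o' _ => ?_
  rw [Finset.sum_ite_eq' Finset.univ]
  simp

theorem Measure.measureOn_univ :
    μ.measureOn hY ⊤ (isOpenSubgroup_top Ω) Set.univ = μ.value hY := by
  simp [Measure.measureOn, Measure.value, Measure.integral]

/-- Measures of invariant sets are invariant under translation by fixed points. -/
theorem Measure.measureOn_translate [AddCommGroup Y]
    (hadd : ∀ (g : G) (x y : Y), g • (x + y) = g • x + g • y) {W : Subgroup G}
    (hW : IsOpenSubgroup Ω W) [Finite (MulAction.orbitRel.Quotient W Y)] {v : Y}
    (hv : W ≤ MulAction.stabilizer G v) {S : Set Y} (hS : ∀ u ∈ W, ∀ y ∈ S, u • y ∈ S) :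
    μ.measureOn hY W hW {x | x - v ∈ S} = μ.measureOn hY W hW S := by
  classical
  have hv' : ∀ g ∈ W, g • v = v := fun g hg => hv hg
  let e : MulAction.orbitRel.Quotient W Y ≃ MulAction.orbitRel.Quotient W Y :=
    Quotient.congr (Equiv.addRight v) fun a b => by
      change (MulAction.orbitRel W Y) a b ↔ (MulAction.orbitRel W Y) (a + v) (b + v)
      rw [MulAction.orbitRel_apply, MulAction.orbitRel_apply]
      refine exists_congr fun g => ?_
      change g.1 • b = a ↔ g.1 • (b + v) = a + v
      rw [hadd, hv' g.1 g.2, add_left_inj]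
  have he : ∀ o, e o = Quotient.mk'' (o.out + v) := fun o => by
    conv_lhs => rw [← Quotient.out_eq' o]
    rfl
  have hS' : ∀ u ∈ W, ∀ y ∈ {x | x - v ∈ S}, u • y ∈ {x | x - v ∈ S} := by
    intro u hu y hy
    have h1 : u • (y - v) + v = u • y := by
      have h2 := hadd u (y - v) v
      rwa [sub_add_cancel, hv' u hu, eq_comm] at h2
    change u • y - v ∈ S
    rw [← h1, add_sub_cancel_right]
    exact hS u hu _ hy
  rw [Measure.measureOn, Measure.measureOn]
  symm
  refine finsum_eq_of_bijective e e.bijective fun o => ?_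
  rw [he, μ.orbit_out hY hW]
  simp only [out_mem_iff hS', Set.mem_ofPred_eq, add_sub_cancel_right]
  have hst : W ⊓ MulAction.stabilizer G (o.out + v) = W ⊓ MulAction.stabilizer G o.out := by
    ext g
    rw [Subgroup.mem_inf, Subgroup.mem_inf, MulAction.mem_stabilizer_iff,
      MulAction.mem_stabilizer_iff]
    refine and_congr_right fun hg => ?_
    rw [hadd, hv' g hg, add_left_inj]
  rw [μ.orbit_eq_cosetMap hY hW (hW.inf (hY o.out)) inf_le_left (o.out + v) hst.symm]
  rfl

/-- The cosets of a subgroup `Z` of finite index such that `U` acts trivially on `Y ⧸ Z` all have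
the same measure. -/
theorem Measure.card_mul_measureOn_coset [AddCommGroup Y]
    (hadd : ∀ (g : G) (x y : Y), g • (x + y) = g • x + g • y) (hfin : IsOligomorphic G Ω Y)
    {U : Subgroup G} (hU : IsOpenSubgroup Ω U) (Z : AddSubgroup Y) [Finite (Y ⧸ Z)]
    (hZ : ∀ u ∈ U, ∀ y, u • y - y ∈ Z) (v : Y) :
    (Nat.card (Y ⧸ Z) : k) * μ.measureOn hY U hU {x | x - v ∈ Z} = μ.value hY := by
  classical
  have hinv : ∀ v : Y, ∀ u ∈ U, ∀ y ∈ {x | x - v ∈ Z}, u • y ∈ {x | x - v ∈ Z} := by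
    intro v u hu y hy
    have := add_mem (hZ u hu y) hy
    rwa [sub_add_sub_cancel] at this
  -- Translation by v is not `U`-equivariant; it is equivariant for U ∩ G_v, and passing to that
  -- subgroup does not change the measure of a `U`-invariant set.
  have key : ∀ v : Y, μ.measureOn hY U hU {x | x - v ∈ Z} = μ.measureOn hY U hU Z := by
    intro v
    have hW := hU.inf (hY v)
    have i₁ := (hfin U hU).finite
    have i₂ := (hfin _ hW).finite
    have h0 : ∀ u ∈ U, ∀ y ∈ (Z : Set Y), u • y ∈ (Z : Set Y) := by
      simpa using hinv 0
    rw [μ.measureOn_eq_of_le hY hU hW inf_le_left (hinv v),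
      μ.measureOn_eq_of_le hY hU hW inf_le_left h0]
    exact μ.measureOn_translate hY hadd hW inf_le_right fun u hu => h0 u hu.1
  have i₁ := (hfin U hU).finite
  have i₂ := (hfin ⊤ (isOpenSubgroup_top Ω)).finite
  have := Fintype.ofFinite (MulAction.orbitRel.Quotient U Y)
  have := Fintype.ofFinite (Y ⧸ Z)
  rw [← μ.measureOn_univ hY, μ.measureOn_eq_of_le hY (isOpenSubgroup_top Ω) hU le_top
    fun _ _ _ _ => Set.mem_univ _]
  have hcos : ∀ c : Y ⧸ Z, μ.measureOn hY U hU {x | (x : Y ⧸ Z) = c} =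
      μ.measureOn hY U hU {x | x - v ∈ Z} := by
    intro c
    obtain ⟨w, rfl⟩ := QuotientAddGroup.mk_surjective c
    rw [key v, ← key w]
    congr 1
    ext x
    rw [Set.mem_ofPred_eq, eq_comm, QuotientAddGroup.eq, Set.mem_ofPred_eq, neg_add_eq_sub]
  have hsum : ∑ c : Y ⧸ Z, μ.measureOn hY U hU {x | (x : Y ⧸ Z) = c} =
      μ.measureOn hY U hU Set.univ := by
    simp only [Measure.measureOn, finsum_eq_sum_of_fintype]
    rw [Finset.sum_comm]
    refine Finset.sum_congr rfl fun o _ => ?_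
    rw [Finset.sum_eq_single ((o.out : Y) : Y ⧸ Z)]
    · simp
    · exact fun c _ hc => if_neg fun h => hc h.symm
    · exact fun h => absurd (Finset.mem_univ _) h
  rw [← hsum, Finset.sum_congr rfl fun c _ => hcos c]
  simp [Nat.card_eq_fintype_card]

theorem Measure.measureOn_eq_orbit_add_card {U : Subgroup G} (hU : IsOpenSubgroup Ω U)
    [Finite (MulAction.orbitRel.Quotient U Y)] {S : Set Y} (v : Y) (T : Finset Y)
    (hT : ∀ x ∈ T, U ≤ MulAction.stabilizer G x) (hvT : v ∉ T)
    (hS : ∀ y, y ∈ S ↔ (∃ u ∈ U, u • v = y) ∨ y ∈ T) :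
    μ.measureOn hY U hU S = μ.orbit hY U hU v + T.card := by
  classical
  have := Fintype.ofFinite (MulAction.orbitRel.Quotient U Y)
  have hinv : ∀ u ∈ U, ∀ y ∈ S, u • y ∈ S := by
    intro u hu y hy
    rcases (hS y).1 hy with ⟨g, hg, rfl⟩ | h
    · exact (hS _).2 (Or.inl ⟨u * g, mul_mem hu hg, mul_smul _ _ _⟩)
    · rw [MulAction.mem_stabilizer_iff.1 (hT y h hu)]
      exact hy
  have hinj : Set.InjOn (fun y : Y => (Quotient.mk'' y : MulAction.orbitRel.Quotient U Y)) T := by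
    intro x hx y hy hxy
    obtain ⟨u, hu, h⟩ := (mk_eq_mk_iff U x y).1 hxy
    rw [← h]
    exact (hT y hy hu : u • y = y)
  have hnot : (Quotient.mk'' v : MulAction.orbitRel.Quotient U Y) ∉
      T.image fun y : Y => (Quotient.mk'' y : MulAction.orbitRel.Quotient U Y) := by
    intro h
    obtain ⟨x, hx, h⟩ := Finset.mem_image.1 h
    obtain ⟨u, hu, h⟩ := (mk_eq_mk_iff U v x).1 h.symm
    have h2 : u • x = x := hT x hx hu
    exact hvT (by rwa [← h, h2])
  rw [Measure.measureOn, finsum_eq_sum_of_fintype, ← Finset.sum_filter]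
  have hset : (Finset.univ.filter fun o : MulAction.orbitRel.Quotient U Y => o.out ∈ S) =
      insert (Quotient.mk'' v) (T.image fun y => Quotient.mk'' y) := by
    ext o
    induction o using Quotient.inductionOn' with
    | h y =>
      rw [Finset.mem_filter, out_mem_iff hinv, hS, Finset.mem_insert, Finset.mem_image,
        mk_eq_mk_iff]
      simp only [Finset.mem_univ, true_and]
      refine or_congr Iff.rfl ⟨fun h => ⟨y, h, rfl⟩, fun ⟨x, hx, h⟩ => ?_⟩
      obtain ⟨u, hu, h⟩ := (mk_eq_mk_iff U y x).1 h.symm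
      rwa [← h, (hT x hx hu : u • x = x)]
  rw [hset, Finset.sum_insert hnot, Finset.sum_image hinj, μ.orbit_out]
  congr 1
  rw [Finset.sum_congr rfl fun x hx => (μ.orbit_out hY hU x).trans (μ.orbit_of_fixed hY hU (hT x hx))]
  simp

/-- An orbit that is a coset of `Z` up to finitely many fixed points, each of measure 1, has its
measure tied to that of `Y` by a linear equation. -/
theorem Measure.card_mul_orbit_add [AddCommGroup Y]
    (hadd : ∀ (g : G) (x y : Y), g • (x + y) = g • x + g • y) (hfin : IsOligomorphic G Ω Y)
    {U : Subgroup G} (hU : IsOpenSubgroup Ω U) (Z : AddSubgroup Y) (hZfin : Finite (Y ⧸ Z))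
    (hZ : ∀ u ∈ U, ∀ y, u • y - y ∈ Z) {v : Y} {T : Set Y} (hTfin : T.Finite)
    (hT : ∀ x ∈ T, U ≤ MulAction.stabilizer G x) (hvT : v ∉ T)
    (hS : ∀ y, y - v ∈ Z ↔ (∃ u ∈ U, u • v = y) ∨ y ∈ T) :
    (Nat.card (Y ⧸ Z) : k) * (μ.orbit hY U hU v + Nat.card T) = μ.value hY := by
  have := (hfin U hU).finite
  rw [← μ.card_mul_measureOn_coset hY hadd hfin hU Z hZ v,
    μ.measureOn_eq_orbit_add_card hY hU v hTfin.toFinset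
      (fun x hx => hT x (hTfin.mem_toFinset.1 hx)) (fun h => hvT (hTfin.mem_toFinset.1 h))
      (fun y => by rw [hTfin.mem_toFinset]; exact hS y), Nat.card_eq_card_finite_toFinset hTfin]

end MeasureOn

/-! ### The linear equations for the measures of orbits of vectors. -/

section Uniqueness

variable {F : Type u} [Field F]

noncomputable instance : AddCommGroup (EvenPart F) := inferInstanceAs (AddCommGroup (ℕ →₀ F))

noncomputable instance : AddCommGroup (OddPart F) := inferInstanceAs (AddCommGroup (ℕ →₀ F))

/-- The vectors orthogonal to `A`. -/
noncomputable def perp (A : Submodule F (ℕ →₀ F)) : AddSubgroup (ℕ →₀ F) where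
  carrier := {z | ∀ a ∈ A, pairing z a = 0}
  zero_mem' a _ := pairing_zero_left a
  add_mem' hx hy a ha := by rw [pairing_add_left, hx a ha, hy a ha, add_zero]
  neg_mem' hx a ha := by rw [pairing_neg_left, hx a ha, neg_zero]

theorem mem_perp {A : Submodule F (ℕ →₀ F)} {z : ℕ →₀ F} :
    z ∈ perp A ↔ ∀ a ∈ A, pairing z a = 0 := Iff.rfl

variable [Finite F]

theorem finite_of_fg {A : Submodule F (ℕ →₀ F)} (hA : A.FG) : Finite A := by
  obtain ⟨n, hn⟩ := exists_le_initial hA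
  exact Finite.of_injective _ (Submodule.inclusion_injective hn)

theorem finite_quotient_perp {A : Submodule F (ℕ →₀ F)} (hA : A.FG) :
    Finite ((ℕ →₀ F) ⧸ perp A) := by
  have := finite_of_fg hA
  let φ : (ℕ →₀ F) ⧸ perp A → A → F := Quotient.lift (fun z (a : A) => pairing z (a : ℕ →₀ F))
    fun x y hxy => by
      have h : -x + y ∈ perp A := QuotientAddGroup.leftRel_apply.1 hxy
      funext a
      have := h a a.2
      rw [neg_add_eq_sub, pairing_sub_left, sub_eq_zero] at this
      exact this.symm
  refine Finite.of_injective φ fun x y hxy => ?_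
  obtain ⟨x, rfl⟩ := QuotientAddGroup.mk_surjective x
  obtain ⟨y, rfl⟩ := QuotientAddGroup.mk_surjective y
  rw [QuotientAddGroup.eq]
  intro a ha
  rw [neg_add_eq_sub, pairing_sub_left, sub_eq_zero]
  exact (congrFun hxy ⟨a, ha⟩).symm

variable {k : Type v} [CommRing k] (μ : Measure (GLInf F) (InfSpace F) k)

/-- `Z` is the orthogonal of `A₁`: elements fixing `A₁` move a vector only within its coset, and the
points of the coset of v outside `A₀` form a single orbit. -/
theorem card_mul_orbit_add_even {A₀ A₁ : Submodule F (ℕ →₀ F)} (h₀ : A₀.FG) (h₁ : A₁.FG)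
    {v : ℕ →₀ F} (hv : v ∉ A₀) :
    (Nat.card ((ℕ →₀ F) ⧸ perp A₁) : k) *
      (μ.orbit (isSmooth_evenPart F) (fixer A₀ A₁) (isOpenSubgroup_fixer h₀ h₁) v +
        Nat.card {x : ℕ →₀ F | x ∈ A₀ ∧ x - v ∈ perp A₁}) = μ.value (isSmooth_evenPart F) := by
  have hZ : ∀ u ∈ fixer A₀ A₁, ∀ y : ℕ →₀ F, u.1.1 y - y ∈ perp A₁ := by
    intro u hu y a ha
    have h2 := GLInf.pairing_map u y a
    rw [(mem_fixer.1 hu).2 a ha] at h2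
    rw [pairing_sub_left, h2, sub_self]
  have hTf : {x : ℕ →₀ F | x ∈ A₀ ∧ x - v ∈ perp A₁}.Finite :=
    (Set.finite_coe_iff.1 (finite_of_fg h₀)).subset fun x hx => hx.1
  have hS : ∀ y : ℕ →₀ F, y - v ∈ perp A₁ ↔ (∃ u ∈ fixer A₀ A₁, u.1.1 v = y) ∨
      y ∈ {x : ℕ →₀ F | x ∈ A₀ ∧ x - v ∈ perp A₁} := by
    intro y
    rw [mem_orbit_fixer_even h₀ hv]
    by_cases hy : y ∈ A₀ <;> simp [hy, mem_perp]
  exact μ.card_mul_orbit_add (Y := EvenPart F) (isSmooth_evenPart F)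
    (fun g x y => map_add g.1.1 _ _) isOligomorphic_evenPart (isOpenSubgroup_fixer h₀ h₁)
    (perp A₁) (finite_quotient_perp h₁) hZ hTf (fun x hx g hg => (mem_fixer.1 hg).1 x hx.1)
    (fun h => hv h.1) hS

theorem card_mul_orbit_add_odd {A₀ A₁ : Submodule F (ℕ →₀ F)} (h₀ : A₀.FG) (h₁ : A₁.FG)
    {v : ℕ →₀ F} (hv : v ∉ A₁) :
    (Nat.card ((ℕ →₀ F) ⧸ perp A₀) : k) *
      (μ.orbit isSmooth_oddPart (fixer A₀ A₁) (isOpenSubgroup_fixer h₀ h₁) v +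
        Nat.card {x : ℕ →₀ F | x ∈ A₁ ∧ x - v ∈ perp A₀}) =
      μ.value (isSmooth_oddPart (F := F)) := by
  have hZ : ∀ u ∈ fixer A₀ A₁, ∀ y : ℕ →₀ F, u.1.2 y - y ∈ perp A₀ := by
    intro u hu y a ha
    have h2 := GLInf.pairing_map u a y
    rw [(mem_fixer.1 hu).1 a ha, pairing_comm, pairing_comm a] at h2
    rw [pairing_sub_left, h2, sub_self]
  have hTf : {x : ℕ →₀ F | x ∈ A₁ ∧ x - v ∈ perp A₀}.Finite :=
    (Set.finite_coe_iff.1 (finite_of_fg h₁)).subset fun x hx => hx.1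
  have hS : ∀ y : ℕ →₀ F, y - v ∈ perp A₀ ↔ (∃ u ∈ fixer A₀ A₁, u.1.2 v = y) ∨
      y ∈ {x : ℕ →₀ F | x ∈ A₁ ∧ x - v ∈ perp A₀} := by
    intro y
    rw [mem_orbit_fixer_odd h₁ hv]
    by_cases hy : y ∈ A₁ <;> simp [hy, mem_perp]
  exact μ.card_mul_orbit_add (Y := OddPart F) isSmooth_oddPart
    (fun g x y => map_add g.1.2 _ _) isOligomorphic_oddPart (isOpenSubgroup_fixer h₀ h₁)
    (perp A₀) (finite_quotient_perp h₀) hZ hTf (fun x hx g hg => (mem_fixer.1 hg).2 x hx.1)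
    (fun h => hv h.1) hS

end Uniqueness

/-! ### Uniqueness of the measure over a field of characteristic zero. -/

section Field

variable {F : Type u} [Field F] [Finite F] {k : Type v} [Field k] [CharZero k]
variable {μ μ' : Measure (GLInf F) (InfSpace F) k}

theorem card_quotient_perp_ne_zero {A : Submodule F (ℕ →₀ F)} (hA : A.FG) :
    (Nat.card ((ℕ →₀ F) ⧸ perp A) : k) ≠ 0 := by
  have := finite_quotient_perp hA
  exact_mod_cast Nat.card_pos.ne'

/-- Measure the orbit of pairs (e, f) with ⟨e, f⟩ = 1 by choosing e first or f first. If s and s'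
are the measures of 𝐕₀ and 𝐕₁, this gives (s - 1) s' / q = (s' - 1) s / q, so s = s'. -/
theorem value_oddPart_eq (μ : Measure (GLInf F) (InfSpace F) k) :
    μ.value (isSmooth_oddPart (F := F)) = μ.value (isSmooth_evenPart F) := by
  let e : ℕ →₀ F := Finsupp.single 0 1
  let E : Submodule F (ℕ →₀ F) := Submodule.span F {e}
  have hb : (⊥ : Submodule F (ℕ →₀ F)).FG := Submodule.fg_bot
  have hE : E.FG := Submodule.fg_span_singleton e
  have he : e ∉ (⊥ : Submodule F (ℕ →₀ F)) := by simp [e]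
  have hee : pairing e e = 1 := by simp [e, pairing_single_left]
  have hempty : Nat.card {x : ℕ →₀ F | x ∈ (⊥ : Submodule F (ℕ →₀ F)) ∧ x - e ∈ perp E} = 0 := by
    have : IsEmpty {x : ℕ →₀ F | x ∈ (⊥ : Submodule F (ℕ →₀ F)) ∧ x - e ∈ perp E} := by
      refine ⟨fun ⟨x, hx, h⟩ => ?_⟩
      have := h e (Submodule.mem_span_singleton_self e)
      rw [(Submodule.mem_bot F).1 hx, zero_sub, pairing_neg_left, hee] at this
      simp at this
    exact Nat.card_of_isEmpty
  have hone : Nat.card {x : ℕ →₀ F | x ∈ (⊥ : Submodule F (ℕ →₀ F)) ∧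
      x - e ∈ perp (⊥ : Submodule F (ℕ →₀ F))} = 1 := by
    rw [Nat.card_eq_one_iff_unique]
    refine ⟨⟨fun x y => Subtype.ext ?_⟩, ⟨0, Submodule.zero_mem _, fun a ha => ?_⟩⟩
    · rw [(Submodule.mem_bot F).1 x.2.1, (Submodule.mem_bot F).1 y.2.1]
    · rw [(Submodule.mem_bot F).1 ha, pairing_zero_right]
  have hK : Nat.card ((ℕ →₀ F) ⧸ perp (⊥ : Submodule F (ℕ →₀ F))) = 1 := by
    rw [Nat.card_eq_one_iff_unique]
    refine ⟨⟨fun x y => ?_⟩, ⟨0⟩⟩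
    obtain ⟨x, rfl⟩ := QuotientAddGroup.mk_surjective x
    obtain ⟨y, rfl⟩ := QuotientAddGroup.mk_surjective y
    rw [QuotientAddGroup.eq]
    intro a ha
    rw [(Submodule.mem_bot F).1 ha, pairing_zero_right]
  have r₁ := card_mul_orbit_add_even μ hb hb he
  have r₂ := card_mul_orbit_add_odd μ hb hb he
  have r₃ := card_mul_orbit_add_even μ hb hE he
  have r₄ := card_mul_orbit_add_odd μ hE hb he
  rw [hone, hK, Nat.cast_one, one_mul] at r₁ r₂
  rw [hempty, Nat.cast_zero, add_zero] at r₃ r₄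
  have hEb : fixer E ⊥ = fixer ⊥ ⊥ ⊓ MulAction.stabilizer (α := EvenPart F) (GLInf F) e := by
    rw [← fixer_sup_span_left, bot_sup_eq]
  have hbE : fixer ⊥ E = fixer ⊥ ⊥ ⊓ MulAction.stabilizer (α := OddPart F) (GLInf F) e := by
    rw [← fixer_sup_span_right, bot_sup_eq]
  have hEE : fixer E E = fixer E ⊥ ⊓ MulAction.stabilizer (α := OddPart F) (GLInf F) e := by
    rw [← fixer_sup_span_right, bot_sup_eq]
  have hEE' : fixer E E = fixer ⊥ E ⊓ MulAction.stabilizer (α := EvenPart F) (GLInf F) e := by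
    rw [← fixer_sup_span_left, bot_sup_eq]
  have obb := isOpenSubgroup_fixer hb hb
  have oEb := isOpenSubgroup_fixer hE hb
  have obE := isOpenSubgroup_fixer hb hE
  have oEE := isOpenSubgroup_fixer hE hE
  have lEb : fixer E ⊥ ≤ fixer ⊥ ⊥ := hEb.trans_le inf_le_left
  have lbE : fixer ⊥ E ≤ fixer ⊥ ⊥ := hbE.trans_le inf_le_left
  have lEE : fixer E E ≤ fixer E ⊥ := hEE.trans_le inf_le_left
  have lEE' : fixer E E ≤ fixer ⊥ E := hEE'.trans_le inf_le_left
  rw [μ.orbit_eq_cosetMap (Y := EvenPart F) _ _ oEb lEb e hEb] at r₁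
  rw [μ.orbit_eq_cosetMap (Y := OddPart F) _ _ obE lbE e hbE] at r₂
  rw [μ.orbit_eq_cosetMap (Y := EvenPart F) _ _ oEE lEE' e hEE'] at r₃
  rw [μ.orbit_eq_cosetMap (Y := OddPart F) _ _ oEE lEE e hEE] at r₄
  have c₁ := μ.cosetMap_trans oEE oEb obb lEE lEb
  have c₂ := μ.cosetMap_trans oEE obE obb lEE' lbE
  rw [c₁] at c₂
  have hne := card_quotient_perp_ne_zero (k := k) hE
  generalize (Nat.card ((ℕ →₀ F) ⧸ perp E) : k) = q at *
  generalize μ.toFun (cosetMap oEb obb lEb) = a at *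
  generalize μ.toFun (cosetMap obE obb lbE) = b at *
  generalize μ.toFun (cosetMap oEE oEb lEE) = c at *
  generalize μ.toFun (cosetMap oEE obE lEE') = d at *
  rw [← r₃, ← r₄]
  have e₁ : a = q * d - 1 := by rw [r₃, ← r₁]; ring
  have e₂ : b = q * c - 1 := by rw [r₄, ← r₂]; ring
  have : c = d := by
    rw [e₁, e₂] at c₂
    linear_combination -c₂
  rw [this]

variable (h : μ.value (isSmooth_evenPart F) = μ'.value (isSmooth_evenPart F))
include h

/-- Vectors are adjoined one at a time. Each factor is solved from its linear equation, whose
leading coefficient is a positive integer and so invertible in characteristic zero. -/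
theorem toFun_cosetMap_fixer_eq {A₀ A₁ : Submodule F (ℕ →₀ F)} (h₀ : A₀.FG) (h₁ : A₁.FG)
    {B₀ B₁ : Submodule F (ℕ →₀ F)} (hB₀ : B₀.FG) (hB₁ : B₁.FG) (hAB₀ : A₀ ≤ B₀) (hAB₁ : A₁ ≤ B₁)
    (hA : IsOpenSubgroup (InfSpace F) (fixer A₀ A₁))
    (hB : IsOpenSubgroup (InfSpace F) (fixer B₀ B₁)) (hle : fixer B₀ B₁ ≤ fixer A₀ A₁) :
    μ.toFun (cosetMap hB hA hle) = μ'.toFun (cosetMap hB hA hle) := by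
  have h' : μ.value (isSmooth_oddPart (F := F)) = μ'.value (isSmooth_oddPart (F := F)) := by
    rw [value_oddPart_eq, value_oddPart_eq, h]
  refine fixer_induction (P := fun B₀ B₁ => ∀ (hB : IsOpenSubgroup (InfSpace F) (fixer B₀ B₁))
    (hle : fixer B₀ B₁ ≤ fixer A₀ A₁),
    μ.toFun (cosetMap hB hA hle) = μ'.toFun (cosetMap hB hA hle)) h₀ h₁ ?_ ?_ ?_ hB₀ hB₁ hAB₀ hAB₁
    hB hle
  · intro hB hle
    rw [μ.cosetMap_self _ _ _ rfl, μ'.cosetMap_self _ _ _ rfl]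
  · intro B₀ B₁ v hB₀ hB₁ hAB₀ hAB₁ ih hB hle
    have l : fixer (B₀ ⊔ Submodule.span F {v}) B₁ ≤ fixer B₀ B₁ := fixer_anti le_sup_left le_rfl
    have l' : fixer B₀ B₁ ≤ fixer A₀ A₁ := fixer_anti hAB₀ hAB₁
    have o := isOpenSubgroup_fixer hB₀ hB₁
    rw [μ.cosetMap_trans hB o hA l l', μ'.cosetMap_trans hB o hA l l', ih o l']
    congr 1
    by_cases hv : v ∈ B₀
    · have : fixer (B₀ ⊔ Submodule.span F {v}) B₁ = fixer B₀ B₁ := by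
        rw [sup_eq_left.2]
        rwa [Submodule.span_singleton_le_iff_mem]
      rw [μ.cosetMap_self _ _ _ this, μ'.cosetMap_self _ _ _ this]
    · have r := card_mul_orbit_add_even μ hB₀ hB₁ hv
      rw [h, ← card_mul_orbit_add_even μ' hB₀ hB₁ hv] at r
      have r' := add_right_cancel (mul_left_cancel₀ (card_quotient_perp_ne_zero hB₁) r)
      rwa [μ.orbit_eq_cosetMap (Y := EvenPart F) _ _ hB l v (fixer_sup_span_left _ _ _),
        μ'.orbit_eq_cosetMap (Y := EvenPart F) _ _ hB l v (fixer_sup_span_left _ _ _)] at r'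
  · intro B₀ B₁ v hB₀ hB₁ hAB₀ hAB₁ ih hB hle
    have l : fixer B₀ (B₁ ⊔ Submodule.span F {v}) ≤ fixer B₀ B₁ := fixer_anti le_rfl le_sup_left
    have l' : fixer B₀ B₁ ≤ fixer A₀ A₁ := fixer_anti hAB₀ hAB₁
    have o := isOpenSubgroup_fixer hB₀ hB₁
    rw [μ.cosetMap_trans hB o hA l l', μ'.cosetMap_trans hB o hA l l', ih o l']
    congr 1
    by_cases hv : v ∈ B₁
    · have : fixer B₀ (B₁ ⊔ Submodule.span F {v}) = fixer B₀ B₁ := by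
        rw [sup_eq_left.2]
        rwa [Submodule.span_singleton_le_iff_mem]
      rw [μ.cosetMap_self _ _ _ this, μ'.cosetMap_self _ _ _ this]
    · have r := card_mul_orbit_add_odd μ hB₀ hB₁ hv
      rw [h', ← card_mul_orbit_add_odd μ' hB₀ hB₁ hv] at r
      have r' := add_right_cancel (mul_left_cancel₀ (card_quotient_perp_ne_zero hB₀) r)
      rwa [μ.orbit_eq_cosetMap (Y := OddPart F) _ _ hB l v (fixer_sup_span_right _ _ _),
        μ'.orbit_eq_cosetMap (Y := OddPart F) _ _ hB l v (fixer_sup_span_right _ _ _)] at r'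

-- `H` normalizes the stabilizer of its support, so the fibre splits under that stabilizer into
-- fixed points, each of measure 1. Their number is the same for all measures and nonzero, which
-- permits division by it.
omit h in
theorem exists_toFun_cosetMap_support {H : Subgroup (GLInf F)}
    (hH : IsOpenSubgroup (InfSpace F) H) {B₀ B₁ : Submodule F (ℕ →₀ F)} (hB : IsSupport H B₀ B₁)
    (oB : IsOpenSubgroup (InfSpace F) (fixer B₀ B₁)) :
    ∃ d : ℕ, d ≠ 0 ∧ ∀ μ : Measure (GLInf F) (InfSpace F) k,
      μ.toFun (cosetMap oB hH hB.fixer_le) = d := by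
  classical
  have i := (isOligomorphic_coset oB _ oB).finite
  have := Fintype.ofFinite
    (MulAction.orbitRel.Quotient (fixer B₀ B₁) (TransGSet.coset (fixer B₀ B₁) oB))
  refine ⟨(Finset.univ.filter fun o : MulAction.orbitRel.Quotient (fixer B₀ B₁)
    (TransGSet.coset (fixer B₀ B₁) oB) => o.out ∈ MulAction.orbit H (TransGSet.base oB)).card,
    ?_, fun μ => ?_⟩
  · rw [Finset.card_ne_zero]
    refine ⟨Quotient.mk'' (TransGSet.base oB), ?_⟩
    rw [Finset.mem_filter]
    refine ⟨Finset.mem_univ _, ?_⟩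
    obtain ⟨u, hu, h⟩ := exists_smul_out_eq (fixer B₀ B₁) (TransGSet.base oB)
    exact ⟨⟨u, hB.fixer_le hu⟩, h⟩
  · have hs : fixer B₀ B₁ = H ⊓ MulAction.stabilizer (GLInf F) (TransGSet.base oB) := by
      rw [TransGSet.stabilizer_base, inf_eq_right.2 hB.fixer_le]
    rw [← μ.orbit_eq_cosetMap (TransGSet.smooth _) hH oB hB.fixer_le (TransGSet.base oB) hs,
      μ.orbit_eq_sum (TransGSet.smooth _) hH oB hB.fixer_le, Finset.card_filter, Nat.cast_sum]
    refine Finset.sum_congr rfl fun o _ => ?_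
    split_ifs with ho
    · obtain ⟨⟨g, hg⟩, ho⟩ := ho
      rw [μ.orbit_of_fixed _ oB, Nat.cast_one]
      intro x hx
      rw [MulAction.mem_stabilizer_iff, ← ho]
      change x • g • TransGSet.base oB = g • TransGSet.base oB
      rw [smul_smul, eq_comm, TransGSet.smul_base_eq_iff, ← mul_assoc]
      exact conj_mem_fixer_of_isSupport hB hg hx
    · simp

theorem toFun_cosetMap_eq_of_le_fixer {A₀ A₁ : Submodule F (ℕ →₀ F)} (h₀ : A₀.FG) (h₁ : A₁.FG)
    (hA : IsOpenSubgroup (InfSpace F) (fixer A₀ A₁)) {H : Subgroup (GLInf F)}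
    (hH : IsOpenSubgroup (InfSpace F) H) (hle : H ≤ fixer A₀ A₁) :
    μ.toFun (cosetMap hH hA hle) = μ'.toFun (cosetMap hH hA hle) := by
  obtain ⟨B₀, B₁, hB⟩ := exists_isSupport hH
  have oB := isOpenSubgroup_fixer hB.fg₀ hB.fg₁
  obtain ⟨d, hd, hd'⟩ := exists_toFun_cosetMap_support (k := k) hH hB oB
  obtain ⟨l₀, l₁⟩ := (isSupport_fixer h₀ h₁).min hB.fg₀ hB.fg₁ (hB.fixer_le.trans hle)
  have e := toFun_cosetMap_fixer_eq h h₀ h₁ hB.fg₀ hB.fg₁ l₀ l₁ hA oB (hB.fixer_le.trans hle)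
  rw [μ.cosetMap_trans oB hH hA hB.fixer_le hle, μ'.cosetMap_trans oB hH hA hB.fixer_le hle,
    hd' μ, hd' μ'] at e
  exact mul_right_cancel₀ (Nat.cast_ne_zero.2 hd) e

/-- Base change along G/(fixer A₀ A₁) → G/U breaks the map into orbits over a target to which
`toFun_cosetMap_eq_of_le_fixer` applies. -/
theorem toFun_cosetMap_eq {H U : Subgroup (GLInf F)} (hH : IsOpenSubgroup (InfSpace F) H)
    (hU : IsOpenSubgroup (InfSpace F) U) (hle : H ≤ U) :
    μ.toFun (cosetMap hH hU hle) = μ'.toFun (cosetMap hH hU hle) := by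
  classical
  obtain ⟨A₀, A₁, h₀, h₁, hA⟩ := exists_fixer_le hU
  have oA := isOpenSubgroup_fixer h₀ h₁
  have i := (isOligomorphic_coset hH _ oA).finite
  have := Fintype.ofFinite (MulAction.orbitRel.Quotient (fixer A₀ A₁) (TransGSet.coset H hH))
  have hs : H = U ⊓ MulAction.stabilizer (GLInf F) (TransGSet.base hH) := by
    rw [TransGSet.stabilizer_base, inf_eq_right.2 hle]
  rw [← μ.orbit_eq_cosetMap (TransGSet.smooth _) hU hH hle (TransGSet.base hH) hs,
    ← μ'.orbit_eq_cosetMap (TransGSet.smooth _) hU hH hle (TransGSet.base hH) hs,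
    μ.orbit_eq_sum (TransGSet.smooth _) hU oA hA, μ'.orbit_eq_sum (TransGSet.smooth _) hU oA hA]
  refine Finset.sum_congr rfl fun o _ => ?_
  split_ifs
  · exact toFun_cosetMap_eq_of_le_fixer h h₀ h₁ oA _ _
  · rfl

/-- A measure with values in a field of characteristic zero is determined by the measure of the
even part. -/
theorem Measure.eq_of_value_evenPart_eq : μ = μ' := by
  ext Y X f
  obtain ⟨y⟩ := Y.nonempty
  have hle : MulAction.stabilizer (GLInf F) y ≤ MulAction.stabilizer (GLInf F) (f y) := by
    intro g hg
    rw [MulAction.mem_stabilizer_iff, ← map_smul, MulAction.mem_stabilizer_iff.1 hg]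
  rw [μ.toFun_eq_cosetMap f y hle, μ'.toFun_eq_cosetMap f y hle]
  exact toFun_cosetMap_eq h _ _ hle

end Field

/-! ### Prime divisors of the values of a polynomial at powers of q. -/

section PrimeDivisors

theorem tendsto_abs_eval_pow {q : ℕ} (hq : 1 < q) {P : ℤ[X]} (hP : 0 < P.natDegree) :
    Tendsto (fun n : ℕ => |P.eval ((q : ℤ) ^ n)|) atTop atTop := by
  have hinj : Function.Injective (Int.castRingHom ℝ) := Int.cast_injective
  have h1 := Polynomial.tendsto_norm_atTop (P.map (Int.castRingHom ℝ))
    (by rwa [Polynomial.degree_map_eq_of_injective hinj, ← Polynomial.natDegree_pos_iff_degree_pos])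
    (tendsto_norm_atTop_atTop.comp (tendsto_pow_atTop_atTop_of_one_lt (r := (q : ℝ))
      (by exact_mod_cast hq)))
  rw [← tendsto_intCast_atTop_iff (R := ℝ)]
  refine h1.congr fun n => ?_
  have h2 : ((q : ℝ) ^ n) = Int.castRingHom ℝ ((q : ℤ) ^ n) := by simp
  rw [h2, Polynomial.eval_map, Polynomial.eval₂_hom]
  exact Int.cast_abs.symm

/-- In the application a = P(q^n₀), b = P(q^n) and c = P(0), and m is the part of a · M! prime to ℓ.
For a prime p ≠ ℓ dividing b, p ≤ `M`, so m contains one more factor p than a; since b ≡ a modulo m,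
the p-part of b divides a. For p = ℓ, b ≡ c modulo q^n, a power beyond what can divide c, so the
ℓ-part of b divides c. -/
theorem dvd_mul_of_prime_dvd_le {ℓ q M n m r : ℕ} (hℓ : ℓ.Prime) {a b c : ℤ} (hℓq : ℓ ∣ q)
    (ha : m * ℓ ^ r = a.natAbs * M.factorial) (hm : ℓ.Coprime m)
    (hab : (m : ℤ) ∣ b - a) (hbc : (q : ℤ) ^ n ∣ b - c) (hc : c ≠ 0) (hn : c.natAbs ≤ n)
    (hM : ∀ p : ℕ, p.Prime → (p : ℤ) ∣ b → p ≤ M) : b ∣ a * c := by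
  rw [← Int.natAbs_dvd_natAbs, Nat.dvd_iff_prime_pow_dvd_dvd]
  intro p k hp hk
  rw [← Int.natCast_dvd, Nat.cast_pow] at hk ⊢
  by_cases hpℓ : p = ℓ
  · subst hpℓ
    refine Dvd.dvd.mul_left ?_ a
    have h1 : ∀ j ≤ n, (p : ℤ) ^ j ∣ b - c := fun j hj =>
      (pow_dvd_pow _ hj).trans ((pow_dvd_pow_of_dvd (Int.natCast_dvd_natCast.2 hℓq) n).trans hbc)
    rcases le_or_gt k n with hkn | hkn
    · exact (dvd_sub_right hk).1 (h1 k hkn)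
    · exfalso
      have h2 : (p : ℤ) ^ n ∣ c := (dvd_sub_right ((pow_dvd_pow _ hkn.le).trans hk)).1 (h1 n le_rfl)
      have h3 := Nat.le_of_dvd (Int.natAbs_pos.2 hc) (Int.natCast_dvd.1 (by exact_mod_cast h2))
      exact absurd (h3.trans hn) (not_le.2 (Nat.lt_pow_self hp.one_lt))
  · refine Dvd.dvd.mul_right ?_ c
    have key : ∀ j ≤ k, (p : ℤ) ^ j ∣ a := by
      intro j
      induction j with
      | zero => intro _; simp
      | succ j ih =>
        intro hj
        have hpM : p ≤ M := hM p hp ((dvd_pow_self _ (by omega)).trans hk)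
        have h2 : p ^ (j + 1) ∣ m * ℓ ^ r := by
          rw [ha, pow_succ]
          refine mul_dvd_mul (Int.natCast_dvd.1 ?_) (hp.dvd_factorial.2 hpM)
          exact_mod_cast ih (by omega)
        have h3 : (p ^ (j + 1)).Coprime (ℓ ^ r) :=
          Nat.Coprime.pow _ _ ((Nat.coprime_primes hp hℓ).2 hpℓ)
        have h4 : (p : ℤ) ^ (j + 1) ∣ m := by exact_mod_cast h3.dvd_of_dvd_mul_right h2
        exact (dvd_sub_right ((pow_dvd_pow _ hj).trans hk)).1 (h4.trans hab)
    exact key k le_rfl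

/-- The values of a nonconstant integral polynomial not vanishing at zero at the powers of a prime
power have arbitrarily large prime divisors. -/
theorem exists_prime_dvd_eval_pow {ℓ q : ℕ} (hℓ : ℓ.Prime) (hℓq : ∃ f, f ≠ 0 ∧ q = ℓ ^ f)
    {P : ℤ[X]} (hP : 0 < P.natDegree) (hP0 : P.eval 0 ≠ 0) (N M : ℕ) :
    ∃ n, N ≤ n ∧ ∃ p : ℕ, p.Prime ∧ M < p ∧ (p : ℤ) ∣ P.eval ((q : ℤ) ^ n) := by
  obtain ⟨f, hf, rfl⟩ := hℓq
  have hq : 1 < ℓ ^ f := Nat.one_lt_pow hf hℓ.one_lt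
  -- If no prime beyond `M` occurred, the values P(q^n) along an arithmetic progression of n would
  -- all divide one fixed nonzero integer, although they grow without bound.
  by_contra! hcon
  have ht := tendsto_abs_eval_pow hq hP
  obtain ⟨n₀, hn₀, hN, hcn⟩ : ∃ n₀ : ℕ, 1 ≤ |P.eval (((ℓ ^ f : ℕ) : ℤ) ^ n₀)| ∧ N ≤ n₀ ∧
      (P.eval 0).natAbs ≤ n₀ :=
    ((ht.eventually_ge_atTop 1).and ((eventually_ge_atTop N).and (eventually_ge_atTop _))).exists
  generalize hqq : ℓ ^ f = q at *
  set a := P.eval ((q : ℤ) ^ n₀) with ha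
  set c := P.eval 0 with hc
  have ha0 : a ≠ 0 := by
    intro h
    rw [h] at hn₀
    simp at hn₀
  set L := a.natAbs * M.factorial with hL
  have hL0 : L ≠ 0 := mul_ne_zero (Int.natAbs_ne_zero.2 ha0) M.factorial_ne_zero
  set m := ordCompl[ℓ] L with hm
  have hcop : ℓ.Coprime m := Nat.coprime_ordCompl hℓ hL0
  have hm0 : 0 < m := Nat.ordCompl_pos ℓ hL0
  have hmr : m * ℓ ^ L.factorization ℓ = L := by rw [mul_comm]; exact Nat.ordProj_mul_ordCompl_eq_self L ℓ
  have hφ : 0 < m.totient := Nat.totient_pos.2 hm0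
  have hlim : Tendsto (fun j => n₀ + j * m.totient) atTop atTop :=
    tendsto_atTop_mono (fun j => (Nat.le_mul_of_pos_right j hφ).trans (Nat.le_add_left _ _))
      tendsto_id
  obtain ⟨j, hj⟩ := ((ht.comp hlim).eventually_gt_atTop |a * c|).exists
  simp only [Function.comp_apply] at hj
  -- By Euler's theorem this gives q^n ≡ q^n₀ modulo m; j is taken so large that |P(q^n)| > |a c|.
  set n := n₀ + j * m.totient with hn
  have hpow : (m : ℤ) ∣ (q : ℤ) ^ n - (q : ℤ) ^ n₀ := by
    have h1 : q ^ m.totient ≡ 1 [MOD m] :=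
      Nat.ModEq.pow_totient (by rw [← hqq]; exact Nat.Coprime.pow_left _ hcop)
    have h2 : q ^ n ≡ q ^ n₀ [MOD m] := by
      have := (h1.pow j).mul_left (q ^ n₀)
      rwa [one_pow, mul_one, ← pow_mul, mul_comm _ j, ← pow_add] at this
    have := (Nat.modEq_iff_dvd.1 h2.symm)
    push_cast at this
    exact this
  have hpos : 0 < |a * c| := abs_pos.2 (mul_ne_zero ha0 hP0)
  have hdvd : P.eval ((q : ℤ) ^ n) ∣ a * c := by
    refine dvd_mul_of_prime_dvd_le (ℓ := ℓ) (q := q) (M := M) (n := n) (m := m)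
      (r := L.factorization ℓ) hℓ (hqq ▸ dvd_pow_self _ hf) hmr hcop
      (hpow.trans (Polynomial.sub_dvd_eval_sub _ _ P)) ?_ hP0
      (hcn.trans (Nat.le_add_right _ _)) ?_
    · have := Polynomial.sub_dvd_eval_sub ((q : ℤ) ^ n) 0 P
      rwa [sub_zero] at this
    · intro p hp hpd
      by_contra! h
      exact hcon n (hN.trans (Nat.le_add_right _ _)) p hp h hpd
  exact absurd (Int.le_of_dvd hpos ((abs_dvd_abs _ _).2 hdvd)) (not_le.2 hj)

end PrimeDivisors

/-! ### Ultraproducts of fields. -/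

section Ultraproduct

variable {I : Type w} (κ : I → Type v) [∀ i, Field (κ i)] (𝓕 : Ultrafilter I)

noncomputable instance : Field (Ultraproduct κ 𝓕) := Ideal.Quotient.field _

/-- The class of a family in the ultraproduct. -/
def Ultraproduct.mk : (∀ i, κ i) →+* Ultraproduct κ 𝓕 := Ideal.Quotient.mk (ultraIdeal κ 𝓕)

variable {κ 𝓕}

theorem Ultraproduct.mk_surjective : Function.Surjective (Ultraproduct.mk κ 𝓕) :=
  Ideal.Quotient.mk_surjective

theorem Ultraproduct.mk_eq_zero {x : ∀ i, κ i} :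
    Ultraproduct.mk κ 𝓕 x = 0 ↔ ∀ᶠ i in (𝓕 : Filter I), x i = 0 :=
  Ideal.Quotient.eq_zero_iff_mem

theorem Ultraproduct.mk_eq_mk {x y : ∀ i, κ i} :
    Ultraproduct.mk κ 𝓕 x = Ultraproduct.mk κ 𝓕 y ↔ ∀ᶠ i in (𝓕 : Filter I), x i = y i := by
  rw [← sub_eq_zero, ← map_sub, mk_eq_zero]
  simp only [Pi.sub_apply, sub_eq_zero]

theorem Ultraproduct.charZero_of_eventually
    (h : ∀ m : ℕ, m ≠ 0 → ∀ᶠ i in (𝓕 : Filter I), (m : κ i) ≠ 0) :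
    CharZero (Ultraproduct κ 𝓕) := by
  refine charZero_of_inj_zero fun m hm => ?_
  by_contra h0
  have h1 : Ultraproduct.mk κ 𝓕 (m : ∀ i, κ i) = 0 := by rw [map_natCast]; exact hm
  obtain ⟨i, h2, h3⟩ := ((mk_eq_zero.1 h1).and (h m h0)).exists
  exact h3 (by simpa using h2)

/-- Lift the lower coefficients of a monic polynomial and take a root in every coordinate. This
makes the ultraproduct a valid target for `exists_specialization`. -/
theorem Ultraproduct.isAlgClosed [∀ i, IsAlgClosed (κ i)] : IsAlgClosed (Ultraproduct κ 𝓕) := by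
  refine IsAlgClosed.of_exists_root _ fun p hp hirr => ?_
  have hd : p.natDegree ≠ 0 := hirr.natDegree_pos.ne'
  choose c hc using fun j => Ultraproduct.mk_surjective (κ := κ) (𝓕 := 𝓕) (p.coeff j)
  have hroot : ∀ i, ∃ x : κ i, x ^ p.natDegree + ∑ j ∈ Finset.range p.natDegree, c j i * x ^ j = 0 := by
    intro i
    have hlt : (∑ j ∈ Finset.range p.natDegree, Polynomial.C (c j i) * Polynomial.X ^ j).degree <
        (p.natDegree : WithBot ℕ) := by
      rw [Polynomial.degree_lt_iff_coeff_zero]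
      intro m hm
      rw [Polynomial.finsetSum_coeff]
      refine Finset.sum_eq_zero fun j hj => ?_
      rw [Polynomial.coeff_C_mul_X_pow, if_neg]
      have := Finset.mem_range.1 hj
      omega
    obtain ⟨x, hx⟩ := IsAlgClosed.exists_root (Polynomial.X ^ p.natDegree +
      ∑ j ∈ Finset.range p.natDegree, Polynomial.C (c j i) * Polynomial.X ^ j) (by
        rw [Polynomial.degree_add_eq_left_of_degree_lt (by rwa [Polynomial.degree_X_pow]),
          Polynomial.degree_X_pow]
        exact_mod_cast hd)
    refine ⟨x, ?_⟩
    rw [Polynomial.IsRoot.def] at hx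
    simpa [Polynomial.eval_finsetSum] using hx
  choose x hx using hroot
  refine ⟨Ultraproduct.mk κ 𝓕 x, ?_⟩
  rw [hp.as_sum]
  simp only [Polynomial.eval_add, Polynomial.eval_pow, Polynomial.eval_X, Polynomial.eval_finsetSum,
    Polynomial.eval_mul, Polynomial.eval_C, ← hc, ← map_pow, ← map_mul, ← map_sum, ← map_add]
  refine Ultraproduct.mk_eq_zero.2 (Eventually.of_forall fun i => ?_)
  rw [Pi.add_apply, Finset.sum_apply]
  exact hx i

theorem eval₂_mk_natCast_pow (P : ℤ[X]) (q : ℕ) {κ : ℕ → Type v} [∀ i, Field (κ i)]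
    {𝓕 : Ultrafilter ℕ} :
    P.eval₂ (Int.castRingHom (Ultraproduct κ 𝓕)) (Ultraproduct.mk κ 𝓕 fun n => (q : κ n) ^ n) =
      Ultraproduct.mk κ 𝓕 fun n => ((P.eval ((q : ℤ) ^ n) : ℤ) : κ n) := by
  have h1 : Int.castRingHom (Ultraproduct κ 𝓕) =
      (Ultraproduct.mk κ 𝓕).comp (Int.castRingHom (∀ i, κ i)) := RingHom.ext_int _ _
  rw [h1, ← Polynomial.hom_eval₂]
  congr 1
  funext n
  have h2 := Polynomial.hom_eval₂ P (Int.castRingHom (∀ i, κ i)) (Pi.evalRingHom κ n)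
    fun n => (q : κ n) ^ n
  refine h2.trans ?_
  have h3 : (Pi.evalRingHom κ n).comp (Int.castRingHom (∀ i, κ i)) = Int.castRingHom (κ n) :=
    RingHom.ext_int _ _
  rw [h3]
  have h4 := Polynomial.eval₂_hom (p := P) (Int.castRingHom (κ n)) ((q : ℤ) ^ n)
  rw [map_pow, map_natCast] at h4
  exact h4

theorem map_intPolynomial_eq_mk {q : ℕ} {κ : ℕ → Type v} [∀ i, Field (κ i)] {𝓕 : Ultrafilter ℕ}
    {φ : ℚ[X] →+* Ultraproduct κ 𝓕} (hφ : φ X = Ultraproduct.mk κ 𝓕 fun n => (q : κ n) ^ n)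
    (P : ℤ[X]) : φ (P.map (Int.castRingHom ℚ)) =
      Ultraproduct.mk κ 𝓕 fun n => ((P.eval ((q : ℤ) ^ n) : ℤ) : κ n) := by
  rw [← eval₂_mk_natCast_pow, ← hφ, ← Polynomial.eval₂_C_X (p := P.map (Int.castRingHom ℚ)),
    Polynomial.hom_eval₂, Polynomial.eval₂_map]
  congr 1
  exact RingHom.ext_int _ _

theorem Ultrafilter.le_cofinite_of_ne_pure (h : ∀ i, 𝓕 ≠ pure i) : (𝓕 : Filter I) ≤ cofinite := by
  rcases 𝓕.le_cofinite_or_eq_pure with h' | ⟨i, hi⟩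
  · exact h'
  · exact absurd hi (h i)

end Ultraproduct

/-! ### Realizing t by an ultraproduct of powers of q. -/

section UltraproductMeasure

variable {F : Type u} [Field F] [Finite F]

/-- The fibre polynomials have rational coefficients while κ n may have positive characteristic. So
an integral multiple is evaluated, and the multiplier is cancelled in the ultraproduct, which has
characteristic zero. -/
theorem isUltraproductMeasure_map {κ : ℕ → Type v} [∀ n, Field (κ n)] {𝓕 : Ultrafilter ℕ}
    (hne : ∀ i, 𝓕 ≠ pure i) [CharZero (Ultraproduct κ 𝓕)] (φ : ℚ[X] →+* Ultraproduct κ 𝓕)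
    (hφ : φ X = Ultraproduct.mk κ 𝓕 fun n => (Nat.card F : κ n) ^ n) :
    IsUltraproductMeasure (perfectEmbeddings F) κ 𝓕 ((polynomialMeasure F).map φ) where
  smoothApproximation := isSmoothApproximation_perfectEmbeddings
  nonprincipal := hne
  toFun_eq {Y X'} f := by
    obtain ⟨D, P, hD, hP⟩ := exists_integer_multiple (fibrePolynomial f)
    have hle : (𝓕 : Filter ℕ) ≤ atTop :=
      (Ultrafilter.le_cofinite_of_ne_pure hne).trans_eq Nat.cofinite_eq_atTop
    have h1 : ∀ᶠ n in (𝓕 : Filter ℕ),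
        D * (fibreCard (perfectEmbeddings F n) f : ℤ) = P.eval ((Nat.card F : ℤ) ^ n) := by
      refine hle ?_
      filter_upwards [fibrePolynomial_spec f] with n hn
      have h2 := Polynomial.eval₂_hom (p := P) (Int.castRingHom ℚ) ((Nat.card F : ℤ) ^ n)
      rw [← Polynomial.eval_map, hP, map_pow, map_natCast, eval_mul, eval_C, ← hn,
        eq_intCast] at h2
      exact_mod_cast h2
    have h3 := map_intPolynomial_eq_mk hφ P
    rw [hP, map_mul] at h3
    have h4 : φ (C (D : ℚ)) = Ultraproduct.mk κ 𝓕 (D : ∀ n, κ n) := by simp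
    have h5 : φ (C (D : ℚ)) ≠ 0 := by
      rw [h4, map_intCast]
      exact_mod_cast hD
    refine mul_left_cancel₀ h5 (h3.trans ?_)
    rw [h4]
    refine Eq.trans ?_ (map_mul (Ultraproduct.mk κ 𝓕) _ _)
    refine Ultraproduct.mk_eq_mk.2 ?_
    filter_upwards [h1] with n hn
    rw [← hn]
    simp

/-- Every nonzero element of a field of characteristic zero looks like an ultraproduct of powers
of `q` in suitable algebraically closed fields. -/
theorem exists_ultraproduct {q : ℕ} (hq : ∃ ℓ f : ℕ, ℓ.Prime ∧ f ≠ 0 ∧ q = ℓ ^ f) {k : Type v}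
    [Field k] [CharZero k] {t : k} (ht : t ≠ 0) :
    ∃ (κ : ℕ → Type) (_ : ∀ n, Field (κ n)) (_ : ∀ n, IsAlgClosed (κ n)) (𝓕 : Ultrafilter ℕ)
      (φ : ℚ[X] →+* Ultraproduct κ 𝓕), CharZero (Ultraproduct κ 𝓕) ∧ (∀ i, 𝓕 ≠ pure i) ∧
        φ X = (Ultraproduct.mk κ 𝓕 fun n => (q : κ n) ^ n) ∧
        RingHom.ker φ = RingHom.ker (eval₂RingHom (algebraMap ℚ k) t) := by
  obtain ⟨ℓ, f, hℓ, hf, hqq⟩ := hq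
  have hq : 1 < q := hqq ▸ Nat.one_lt_pow hf hℓ.one_lt
  by_cases halg : IsAlgebraic ℚ t
  · have hint := halg.isIntegral
    obtain ⟨D, P, hD, hP⟩ := exists_integer_multiple (minpoly ℚ t)
    have hD' : (D : ℚ) ≠ 0 := by exact_mod_cast hD
    have hdeg : 0 < P.natDegree := by
      rw [← Polynomial.natDegree_map_eq_of_injective (f := Int.castRingHom ℚ) Int.cast_injective,
        hP, Polynomial.natDegree_C_mul hD']
      exact minpoly.natDegree_pos hint
    -- Here t ≠ 0 is used: were P a multiple of X, the primes dividing P(q^n) would stay bounded.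
    have hP0 : P.eval 0 ≠ 0 := by
      intro h0
      have h1 := Polynomial.eval₂_hom (p := P) (Int.castRingHom ℚ) 0
      rw [h0, map_zero, ← Polynomial.eval_map, hP, eval_mul, eval_C, mul_eq_zero,
        or_iff_right hD', ← Polynomial.coeff_zero_eq_eval_zero] at h1
      exact minpoly.coeff_zero_ne_zero hint ht h1
    have hfreq : ∀ M : ℕ, ∃ᶠ n in atTop, ∃ p : ℕ, p.Prime ∧ M < p ∧
        (p : ℤ) ∣ P.eval ((q : ℤ) ^ n) := fun M => frequently_atTop.2 fun N =>
      exists_prime_dvd_eval_pow hℓ ⟨f, hf, hqq⟩ hdeg hP0 N M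
    obtain ⟨s, hs, hsp⟩ := extraction_forall_of_frequently hfreq
    choose p hp hpM hpd using hsp
    -- The characteristic at n = s i is p i > i, a divisor of P(q^(s i)). Off the range of s it is
    -- some irrelevant prime, because the ultrafilter is supported on that range.
    let r : ℕ → ℕ := fun n => p (Function.invFun s n)
    have hr : ∀ i, r (s i) = p i := fun i => by
      simp only [r]
      rw [Function.leftInverse_invFun hs.injective i]
    have hr' : ∀ n, Fact (r n).Prime := fun n => ⟨hp _⟩
    let κ : ℕ → Type := fun n => AlgebraicClosure (ZMod (r n))
    let 𝓕 : Ultrafilter ℕ := (hyperfilter ℕ).map s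
    have h𝓕 : ∀ Q : ℕ → Prop, (∀ᶠ i in atTop, Q (s i)) → ∀ᶠ n in (𝓕 : Filter ℕ), Q n := by
      intro Q hQ
      change ∀ᶠ i in (hyperfilter ℕ : Filter ℕ), Q (s i)
      exact Nat.hyperfilter_le_atTop hQ
    have hchar : ∀ n, CharP (κ n) (r n) := fun n =>
      charP_of_injective_algebraMap (algebraMap (ZMod (r n)) (κ n)).injective _
    have hzero : CharZero (Ultraproduct κ 𝓕) := by
      refine Ultraproduct.charZero_of_eventually fun m hm => h𝓕 _ ?_
      filter_upwards [eventually_ge_atTop m] with i hi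
      rw [Ne, CharP.cast_eq_zero_iff (κ (s i)) (r (s i)), hr]
      exact Nat.not_dvd_of_pos_of_lt (Nat.pos_of_ne_zero hm) (hi.trans_lt (hpM i))
    let φ : ℚ[X] →+* Ultraproduct κ 𝓕 := eval₂RingHom (algebraMap ℚ _)
      (Ultraproduct.mk κ 𝓕 fun n => (q : κ n) ^ n)
    have hφX : φ X = Ultraproduct.mk κ 𝓕 fun n => (q : κ n) ^ n := eval₂_X _ _
    refine ⟨κ, inferInstance, inferInstance, 𝓕, φ, hzero, ?_, hφX, ?_⟩
    · intro i h
      have h1 : ∀ᶠ n in (𝓕 : Filter ℕ), n ≠ i := h𝓕 _ (by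
        filter_upwards [eventually_gt_atTop i] with n hn
        exact (hn.trans_le (hs.id_le n)).ne')
      rw [h] at h1
      exact h1 rfl
    · have hker : RingHom.ker (eval₂RingHom (algebraMap ℚ k) t) = Ideal.span {minpoly ℚ t} :=
        minpoly.ker_aeval_eq_span_minpoly ℚ t
      have hmax : (Ideal.span {minpoly ℚ t}).IsMaximal :=
        PrincipalIdealRing.isMaximal_of_irreducible (minpoly.irreducible hint)
      rw [hker]
      -- The ideal of the minimal polynomial is maximal, so it is enough that φ kills the minimal
      -- polynomial.
      refine (hmax.eq_of_le (RingHom.ker_ne_top φ) ?_).symm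
      rw [Ideal.span_singleton_le_iff_mem, RingHom.mem_ker]
      have h3 := map_intPolynomial_eq_mk hφX P
      rw [hP, map_mul] at h3
      have h4 : Ultraproduct.mk κ 𝓕 (fun n => ((P.eval ((q : ℤ) ^ n) : ℤ) : κ n)) = 0 := by
        refine Ultraproduct.mk_eq_zero.2 (h𝓕 _ (Eventually.of_forall fun i => ?_))
        rw [CharP.intCast_eq_zero_iff (κ (s i)) (r (s i)), hr]
        exact hpd i
      rw [h4, mul_eq_zero] at h3
      refine h3.resolve_left ?_
      rw [map_intCast, map_intCast]
      exact_mod_cast hD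
  · let κ : ℕ → Type := fun _ => AlgebraicClosure ℚ
    let 𝓕 : Ultrafilter ℕ := hyperfilter ℕ
    have hzero : CharZero (Ultraproduct κ 𝓕) :=
      Ultraproduct.charZero_of_eventually fun m hm => Eventually.of_forall fun i =>
        Nat.cast_ne_zero.2 hm
    let φ : ℚ[X] →+* Ultraproduct κ 𝓕 := eval₂RingHom (algebraMap ℚ _)
      (Ultraproduct.mk κ 𝓕 fun n => (q : κ n) ^ n)
    have hφX : φ X = Ultraproduct.mk κ 𝓕 fun n => (q : κ n) ^ n := eval₂_X _ _
    refine ⟨κ, inferInstance, inferInstance, 𝓕, φ, hzero, ?_, hφX, ?_⟩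
    · intro i h
      have h1 : ∀ᶠ n in (𝓕 : Filter ℕ), n ≠ i :=
        hyperfilter_le_cofinite (Set.finite_singleton i).compl_mem_cofinite
      rw [h] at h1
      exact h1 rfl
    · have h0 : RingHom.ker (eval₂RingHom (algebraMap ℚ k) t) = ⊥ := by
        rw [← RingHom.injective_iff_ker_eq_bot]
        exact transcendental_iff_injective.1 halg
      rw [h0, ← RingHom.injective_iff_ker_eq_bot, injective_iff_map_eq_zero]
      intro p hp
      obtain ⟨D, P, hD, hP⟩ := exists_integer_multiple p
      have h3 := map_intPolynomial_eq_mk hφX P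
      rw [hP, map_mul, hp, mul_zero, eq_comm, Ultraproduct.mk_eq_zero] at h3
      -- In the transcendental case φ must be injective: a nonzero polynomial cannot vanish at q^n
      -- for infinitely many n.
      have h4 : {n : ℕ | P.eval ((q : ℤ) ^ n) = 0}.Infinite := by
        intro hfin
        obtain ⟨n, h5, h6⟩ := (h3.and (hyperfilter_le_cofinite hfin.compl_mem_cofinite)).exists
        exact h6 (by exact_mod_cast h5)
      have hinj : Function.Injective fun n : ℕ => (q : ℤ) ^ n :=
        pow_right_injective₀ (by positivity) (by exact_mod_cast hq.ne')
      have h5 : P = 0 := Polynomial.eq_zero_of_infinite_isRoot P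
        ((h4.image hinj.injOn).mono (by rintro - ⟨n, hn, rfl⟩; exact hn))
      rw [h5, Polynomial.map_zero, eq_comm, mul_eq_zero, Polynomial.C_eq_zero] at hP
      exact hP.resolve_left (by exact_mod_cast hD)

end UltraproductMeasure

/-! ### Condition (Nil) for ultraproduct measures. -/

section UltraproductNil

variable {G Ω : Type u} [Group G] [MulAction G Ω]

/-- Two points fixed by `V` in the same orbit are related by an element normalizing `V`, if `G ⧸ V`
is homogeneous. -/
theorem exists_normalizing_smul_eq {V : Subgroup G} (hV : IsOpenSubgroup Ω V)
    (hΔ : IsHomogeneous (TransGSet.coset V hV)) {Y : Type u} [MulAction G Y] (hY : IsSmooth G Ω Y)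
    {y : Y} {g : G} (hy : V ≤ MulAction.stabilizer G y)
    (hgy : V ≤ MulAction.stabilizer G (g • y)) :
    ∃ h : G, (∀ x, x ∈ V ↔ h⁻¹ * x * h ∈ V) ∧ h • y = g • y := by
  have hi : V ≤ MulAction.stabilizer G (TransGSet.base (hY y)) := by
    rwa [TransGSet.stabilizer_base]
  have hj : V ≤ MulAction.stabilizer G (g • TransGSet.base (hY y)) := by
    rwa [MulAction.stabilizer_smul_eq_stabilizer_map_conj, TransGSet.stabilizer_base,
      ← MulAction.stabilizer_smul_eq_stabilizer_map_conj]
  obtain ⟨σ, hσ, h⟩ := hΔ (TransGSet.coset _ (hY y)) (cosetHom hV _ hi) (cosetHom hV _ hj)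
  obtain ⟨a, ha⟩ := TransGSet.exists_smul_base hV (σ (TransGSet.base hV))
  refine ⟨a, fun x => ?_, ?_⟩
  · have h1 : x • σ (TransGSet.base hV) = σ (TransGSet.base hV) ↔
        x • TransGSet.base hV = TransGSet.base hV := by
      rw [← map_smul, hσ.1.eq_iff]
    rw [← MulAction.mem_stabilizer_iff, ← MulAction.mem_stabilizer_iff, TransGSet.stabilizer_base,
      MulAction.mem_stabilizer_iff, ha, smul_smul, eq_comm, TransGSet.smul_base_eq_iff,
      ← mul_assoc] at h1
    exact h1.symm
  · have h1 : cosetHom hV _ hi (σ (TransGSet.base hV)) = cosetHom hV _ hj (TransGSet.base hV) :=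
      DFunLike.congr_fun h (TransGSet.base hV)
    rw [ha, cosetHom_smul_base, cosetHom_base, TransGSet.smul_base_eq_iff,
      MulAction.mem_stabilizer_iff, mul_smul, inv_smul_eq_iff] at h1
    exact h1.symm

theorem le_stabilizer_smul_iff {V : Subgroup G} {h : G} (hh : ∀ x, x ∈ V ↔ h⁻¹ * x * h ∈ V)
    {Y : Type u} [MulAction G Y] (y : Y) :
    V ≤ MulAction.stabilizer G (h • y) ↔ V ≤ MulAction.stabilizer G y := by
  constructor
  · intro H x hx
    have h1 := H ((hh (h * x * h⁻¹)).2 (by simpa [mul_assoc] using hx))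
    rw [MulAction.mem_stabilizer_iff, smul_smul, inv_mul_cancel_right, mul_smul,
      smul_left_cancel_iff] at h1
    exact h1
  · intro H x hx
    have h1 := H ((hh x).1 hx)
    rw [MulAction.mem_stabilizer_iff, mul_smul, mul_smul, inv_smul_eq_iff] at h1
    exact h1

variable {F : Type u} [Field F] [Finite F] {κ : ℕ → Type v} [∀ n, Field (κ n)] {𝓕 : Ultrafilter ℕ}
  {ν : Measure (GLInf F) (InfSpace F) (Ultraproduct κ 𝓕)}
  (hν : IsUltraproductMeasure (perfectEmbeddings F) κ 𝓕 ν)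
include hν

omit [Finite F] in
theorem IsUltraproductMeasure.eventually_le {U : Subgroup (GLInf F)}
    (hU : IsOpenSubgroup (InfSpace F) U) : ∀ᶠ n in (𝓕 : Filter ℕ), levelSubgroup F n ≤ U :=
  (Ultrafilter.le_cofinite_of_ne_pure hν.nonprincipal).trans_eq Nat.cofinite_eq_atTop
    (eventually_levelSubgroup_le hU)

variable {X : Type u} [MulAction (GLInf F) X] (hX : IsSmooth (GLInf F) (InfSpace F) X)
  (hfin : IsFinitary (GLInf F) X)
  [∀ n, Fintype {x : X // levelSubgroup F n ≤ MulAction.stabilizer (GLInf F) x}]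

-- Orbit measures are classes of fibre cardinalities, so the integral becomes coordinatewise the
-- finite sum over the points fixed by G(n), grouped by `U`-orbits.
include hfin in
theorem IsUltraproductMeasure.integral_eq_mk {U : Subgroup (GLInf F)}
    (hU : IsOpenSubgroup (InfSpace F) U) (a : X → ∀ n, κ n) (ha : ∀ g ∈ U, ∀ x, a (g • x) = a x) :
    ν.integral hX U hU (fun x => Ultraproduct.mk κ 𝓕 (a x)) = Ultraproduct.mk κ 𝓕 fun n =>
      ∑ x : {x : X // levelSubgroup F n ≤ MulAction.stabilizer (GLInf F) x}, a x n := by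
  have := finite_orbits_of_isFinitary hX hfin hU
  have := Fintype.ofFinite (MulAction.orbitRel.Quotient U X)
  rw [Measure.integral, finsum_eq_sum_of_fintype]
  have h1 : ∀ o : MulAction.orbitRel.Quotient U X, ν.orbit hX U hU o.out =
      Ultraproduct.mk κ 𝓕 fun n => (fibreCard (perfectEmbeddings F n)
        (cosetMap (hU.inf (hX o.out)) hU inf_le_left) : κ n) := fun o => hν.toFun_eq _
  simp only [h1, ← map_mul, ← map_sum]
  rw [Ultraproduct.mk_eq_mk]
  filter_upwards [hν.eventually_le hU] with n hn
  rw [sum_fixed_eq (isOpenSubgroup_levelSubgroup F n) hU hn (isHomogeneous_perfectEmbeddings n) hX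
    (fun x => a x n) (fun g hg y => congrFun (ha g hg y) n), finsum_eq_sum_of_fintype,
    Finset.sum_apply]
  rfl

omit hν [Finite F]
  [∀ n, Fintype {x : X // levelSubgroup F n ≤ MulAction.stabilizer (GLInf F) x}] in
include hX in
theorem isSmooth_prod_self : IsSmooth (GLInf F) (InfSpace F) (X × X) := fun p => by
  obtain ⟨S, hS, h⟩ := (hX p.1).inf (hX p.2)
  exact ⟨S, hS, h.trans fun g hg => Prod.ext hg.1 hg.2⟩

-- The element g need not preserve the set of points fixed by G(n). Homogeneity, used for the pair
-- (z, x) in X × X, replaces it by an element normalizing G(n) with the same effect on z and x; this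
-- one permutes the fixed points.
omit hν [Finite F] in
include hX in
theorem fixed_sum_smul_eq {n : ℕ} {R : Type*} [CommRing R] {a b : X → X → R}
    (ha : ∀ (g : GLInf F) x y, a (g • x) (g • y) = a x y)
    (hb : ∀ (g : GLInf F) x y, b (g • x) (g • y) = b x y) {z x : X} {g : GLInf F}
    (hz : levelSubgroup F n ≤ MulAction.stabilizer (GLInf F) z)
    (hx : levelSubgroup F n ≤ MulAction.stabilizer (GLInf F) x)
    (hgz : levelSubgroup F n ≤ MulAction.stabilizer (GLInf F) (g • z))
    (hgx : levelSubgroup F n ≤ MulAction.stabilizer (GLInf F) (g • x)) :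
    ∑ y : {y : X // levelSubgroup F n ≤ MulAction.stabilizer (GLInf F) y},
        a (g • z) y * b y (g • x) =
      ∑ y : {y : X // levelSubgroup F n ≤ MulAction.stabilizer (GLInf F) y}, a z y * b y x := by
  obtain ⟨h, hh, hhy⟩ := exists_normalizing_smul_eq (isOpenSubgroup_levelSubgroup F n)
    (isHomogeneous_perfectEmbeddings n) (isSmooth_prod_self hX) (y := (z, x)) (g := g)
    (fun s hs => Prod.ext (hz hs) (hx hs)) (fun s hs => Prod.ext (hgz hs) (hgx hs))
  have h1 : h • z = g • z := congrArg Prod.fst hhy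
  have h2 : h • x = g • x := congrArg Prod.snd hhy
  rw [← h1, ← h2]
  symm
  refine Fintype.sum_equiv ((MulAction.toPerm h).subtypeEquiv fun y =>
    (le_stabilizer_smul_iff hh y).symm) _ _ fun y => ?_
  change _ = a (h • z) (h • (y : X)) * b (h • (y : X)) (h • x)
  rw [ha, hb]

/-- A lift of a matrix with entries in an ultraproduct. -/
noncomputable def liftMatrix (A : X → X → Ultraproduct κ 𝓕) (x y : X) : ∀ n, κ n :=
  Function.surjInv Ultraproduct.mk_surjective (A x y)

omit hν [Finite F] [MulAction (GLInf F) X]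
  [∀ n, Fintype {x : X // levelSubgroup F n ≤ MulAction.stabilizer (GLInf F) x}] in
theorem mk_liftMatrix (A : X → X → Ultraproduct κ 𝓕) (x y : X) :
    Ultraproduct.mk κ 𝓕 (liftMatrix A x y) = A x y :=
  Function.surjInv_eq Ultraproduct.mk_surjective _

-- The lift depends only on the entry being lifted, so invariance holds at every index n and not
-- merely at almost all.
omit hν [Finite F]
  [∀ n, Fintype {x : X // levelSubgroup F n ≤ MulAction.stabilizer (GLInf F) x}] in
theorem liftMatrix_smul {A : X → X → Ultraproduct κ 𝓕}
    (hA : ∀ (g : GLInf F) (x y : X), A (g • x) (g • y) = A x y) (g : GLInf F) (x y : X) :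
    liftMatrix A (g • x) (g • y) = liftMatrix A x y := by
  rw [liftMatrix, hA, liftMatrix]

/-- The matrix of the entries at `n` between the points fixed by the `n`-th level subgroup. -/
noncomputable def levelMatrix (A : X → X → Ultraproduct κ 𝓕) (n : ℕ) :
    Matrix {x : X // levelSubgroup F n ≤ MulAction.stabilizer (GLInf F) x}
      {x : X // levelSubgroup F n ≤ MulAction.stabilizer (GLInf F) x} (κ n) :=
  Matrix.of fun x y => liftMatrix A x y n

include hfin in
theorem IsUltraproductMeasure.matMul_eq_mk {A B : X → X → Ultraproduct κ 𝓕}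
    (hA : ∀ (g : GLInf F) (x y : X), A (g • x) (g • y) = A x y)
    (hB : ∀ (g : GLInf F) (x y : X), B (g • x) (g • y) = B x y) (z x : X) :
    ν.matMul hX A B z x = Ultraproduct.mk κ 𝓕 fun n =>
      ∑ y : {y : X // levelSubgroup F n ≤ MulAction.stabilizer (GLInf F) y},
        liftMatrix A z y n * liftMatrix B y x n := by
  have h1 := hν.integral_eq_mk hX hfin ((hX z).inf (hX x))
    (fun y => liftMatrix A z y * liftMatrix B y x) (by
      intro g hg y
      have hz : g • z = z := hg.1
      have hx : g • x = x := hg.2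
      have h2 := liftMatrix_smul hA g z y
      have h3 := liftMatrix_smul hB g y x
      rw [hz] at h2
      rw [hx] at h3
      rw [h2, h3])
  simp only [map_mul, mk_liftMatrix] at h1
  exact h1

include hfin in
theorem IsUltraproductMeasure.matMul_smul {A B : X → X → Ultraproduct κ 𝓕}
    (hA : ∀ (g : GLInf F) (x y : X), A (g • x) (g • y) = A x y)
    (hB : ∀ (g : GLInf F) (x y : X), B (g • x) (g • y) = B x y) (g : GLInf F) (z x : X) :
    ν.matMul hX A B (g • z) (g • x) = ν.matMul hX A B z x := by
  rw [hν.matMul_eq_mk hX hfin hA hB, hν.matMul_eq_mk hX hfin hA hB, Ultraproduct.mk_eq_mk]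
  filter_upwards [hν.eventually_le (hX z), hν.eventually_le (hX x), hν.eventually_le (hX (g • z)),
    hν.eventually_le (hX (g • x))] with n h1 h2 h3 h4
  exact fixed_sum_smul_eq hX (a := fun x y => liftMatrix A x y n)
    (b := fun x y => liftMatrix B x y n) (fun g x y => congrFun (liftMatrix_smul hA g x y) n)
    (fun g x y => congrFun (liftMatrix_smul hB g x y) n) h1 h2 h3 h4

-- Every single entry agrees for almost all n. Finitely many orbits on X × X, together with
-- invariance, make one set of indices serve all entries.
include hfin in
theorem IsUltraproductMeasure.levelMatrix_matMul {A B : X → X → Ultraproduct κ 𝓕}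
    (hA : ∀ (g : GLInf F) (x y : X), A (g • x) (g • y) = A x y)
    (hB : ∀ (g : GLInf F) (x y : X), B (g • x) (g • y) = B x y) :
    ∀ᶠ n in (𝓕 : Filter ℕ),
      levelMatrix (F := F) (ν.matMul hX A B) n = levelMatrix (F := F) A n * levelMatrix (F := F) B n := by
  have hol := isOligomorphic_of_isFinitary hX hfin
  have := isFinitary_of_isOligomorphic (hol.prod hX hol)
  have h1 : ∀ o : MulAction.orbitRel.Quotient (GLInf F) (X × X), ∀ᶠ n in (𝓕 : Filter ℕ),
      levelSubgroup F n ≤ MulAction.stabilizer (GLInf F) o.out.1 ∧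
      levelSubgroup F n ≤ MulAction.stabilizer (GLInf F) o.out.2 ∧
      liftMatrix (ν.matMul hX A B) o.out.1 o.out.2 n =
        ∑ y : {y : X // levelSubgroup F n ≤ MulAction.stabilizer (GLInf F) y},
          liftMatrix A o.out.1 y n * liftMatrix B y o.out.2 n := by
    intro o
    refine (hν.eventually_le (hX _)).and ((hν.eventually_le (hX _)).and ?_)
    rw [← Ultraproduct.mk_eq_mk, mk_liftMatrix]
    exact hν.matMul_eq_mk hX hfin hA hB _ _
  have : Finite (MulAction.orbitRel.Quotient (GLInf F) (X × X)) := this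
  filter_upwards [eventually_all.2 h1] with n hn
  ext ⟨z, hz⟩ ⟨x, hx⟩
  obtain ⟨hz', hx', h2⟩ := hn (Quotient.mk'' (z, x))
  obtain ⟨g, hg⟩ : ∃ g : GLInf F,
      g • (Quotient.mk'' (z, x) : MulAction.orbitRel.Quotient (GLInf F) (X × X)).out = (z, x) := by
    obtain ⟨g, hg⟩ := Quotient.mk_out (s := MulAction.orbitRel (GLInf F) (X × X)) (z, x)
    exact ⟨g⁻¹, inv_smul_eq_iff.2 hg.symm⟩
  generalize (Quotient.mk'' (z, x) : MulAction.orbitRel.Quotient (GLInf F) (X × X)).out = p at *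
  obtain rfl : g • p.1 = z := congrArg Prod.fst hg
  obtain rfl : g • p.2 = x := congrArg Prod.snd hg
  rw [Matrix.mul_apply]
  change liftMatrix (ν.matMul hX A B) (g • p.1) (g • p.2) n =
    ∑ y : {y : X // levelSubgroup F n ≤ MulAction.stabilizer (GLInf F) y}, liftMatrix A (g • p.1) y n *
      liftMatrix B y (g • p.2) n
  rw [liftMatrix_smul (hν.matMul_smul hX hfin hA hB), h2]
  exact (fixed_sum_smul_eq hX (a := fun x y => liftMatrix A x y n)
    (b := fun x y => liftMatrix B x y n) (fun g x y => congrFun (liftMatrix_smul hA g x y) n)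
    (fun g x y => congrFun (liftMatrix_smul hB g x y) n) hz' hx' hz hx).symm

omit [∀ n, Fintype {x : X // levelSubgroup F n ≤ MulAction.stabilizer (GLInf F) x}] in
include hfin in
theorem IsUltraproductMeasure.trace_eq_zero {A : X → X → Ultraproduct κ 𝓕}
    (hA : ∀ (g : GLInf F) (x y : X), A (g • x) (g • y) = A x y) {N : ℕ}
    (hN : ∀ x y, ν.matPowSucc hX A N x y = 0) : ν.trace hX A = 0 := by
  classical
  have hfix : ∀ n, Finite {x : X // levelSubgroup F n ≤ MulAction.stabilizer (GLInf F) x} :=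
    fun n => finite_fixed (isOpenSubgroup_levelSubgroup F n) (finite_hom_perfectEmbeddings n) hX
      hfin
  have := fun n => Fintype.ofFinite
    {x : X // levelSubgroup F n ≤ MulAction.stabilizer (GLInf F) x}
  have hpow : ∀ j, (∀ (g : GLInf F) (x y : X),
      ν.matPowSucc hX A j (g • x) (g • y) = ν.matPowSucc hX A j x y) ∧
      ∀ᶠ n in (𝓕 : Filter ℕ), levelMatrix (F := F) (ν.matPowSucc hX A j) n = levelMatrix (F := F) A n ^ (j + 1) := by
    intro j
    induction j with
    | zero => exact ⟨hA, Eventually.of_forall fun n => by rw [zero_add, pow_one]; rfl⟩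
    | succ j ih =>
      refine ⟨hν.matMul_smul hX hfin hA ih.1, ?_⟩
      filter_upwards [ih.2, hν.levelMatrix_matMul hX hfin hA ih.1] with n h1 h2
      rw [pow_succ', ← h1, ← h2]
      rfl
  have h0 : ν.matPowSucc hX A N = fun _ _ => 0 := funext fun x => funext fun y => hN x y
  -- The chosen lift of 0 is only known to vanish for almost all n.
  have hzero : ∀ᶠ n in (𝓕 : Filter ℕ), Function.surjInv
      (Ultraproduct.mk_surjective (κ := κ) (𝓕 := 𝓕)) 0 n = 0 :=
    Ultraproduct.mk_eq_zero.1 (Function.surjInv_eq Ultraproduct.mk_surjective _)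
  have htr := hν.integral_eq_mk hX hfin (isOpenSubgroup_top (InfSpace F))
    (fun x => liftMatrix A x x) fun g _ x => liftMatrix_smul hA g x x
  simp only [mk_liftMatrix] at htr
  refine htr.trans (Ultraproduct.mk_eq_zero.2 ?_)
  filter_upwards [hzero, (hpow N).2] with n h1 h2
  have h3 : IsNilpotent (levelMatrix (F := F) A n) := by
    refine ⟨N + 1, ?_⟩
    rw [← h2, h0]
    ext x y
    exact h1
  exact (Matrix.isNilpotent_trace_of_isNilpotent h3).eq_zero

include hν in
theorem IsUltraproductMeasure.satisfiesNil : ν.SatisfiesNil :=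
  fun _ _ hX hfin _ hA ⟨_, hN⟩ => hν.trace_eq_zero hX hfin hA hN

end UltraproductNil

/-! ### Specialization by the Nullstellensatz. -/

section Specialization

/-- The Nullstellensatz: finitely generated algebras have points in algebraically closed fields. -/
theorem nonempty_algHom_of_finiteType (K : Type u) (A : Type v) (κ : Type w) [Field K] [CommRing A]
    [Nontrivial A] [Algebra K A] [Algebra.FiniteType K A] [Field κ] [IsAlgClosed κ] [Algebra K κ] :
    Nonempty (A →ₐ[K] κ) := by
  obtain ⟨m, hm⟩ := Ideal.exists_maximal A
  let _ : Field (A ⧸ m) := Ideal.Quotient.field m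
  have : Algebra.FiniteType K (A ⧸ m) :=
    Algebra.FiniteType.of_surjective (Ideal.Quotient.mkₐ K m) (Ideal.Quotient.mkₐ_surjective K m)
  have := finite_of_finite_type_of_isJacobsonRing K (A ⧸ m)
  exact ⟨(IsAlgClosed.lift (M := κ) (S := A ⧸ m) (R := K)).comp (Ideal.Quotient.mkₐ K m)⟩

/-- Homomorphisms to two fields with the same kernel, the second field being algebraically closed,
are related by a specialization defined on any finite set. -/
theorem exists_specialization {D : Type u} [CommRing D] {k : Type v} {κ : Type w} [Field k] [Field κ]
    [IsAlgClosed κ] (φ₁ : D →+* k) (φ₂ : D →+* κ) (hker : RingHom.ker φ₁ = RingHom.ker φ₂)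
    (S : Finset k) :
    ∃ R : Subring k, (S : Set k) ⊆ R ∧ ∃ (hD : ∀ d, φ₁ d ∈ R) (ψ : R →+* κ),
      ψ.comp (φ₁.codRestrict R hD) = φ₂ := by
  let E := D ⧸ RingHom.ker φ₁
  have : (RingHom.ker φ₁).IsPrime := RingHom.ker_isPrime φ₁
  let ι₁ : E →+* k := RingHom.kerLift φ₁
  have hι₁ : Function.Injective ι₁ := RingHom.kerLift_injective φ₁
  let ι₂ : E →+* κ := Ideal.Quotient.lift _ φ₂ fun a ha => by rwa [hker] at ha
  have hι₂ : Function.Injective ι₂ := by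
    refine (injective_iff_map_eq_zero _).2 fun a ha => ?_
    obtain ⟨a, rfl⟩ := Ideal.Quotient.mk_surjective a
    rw [Ideal.Quotient.eq_zero_iff_mem, hker]
    exact ha
  let K := FractionRing E
  -- Because the kernels agree, both fields contain the fraction field K of the common image of D.
  -- Any K-algebra map from K[S] to κ is then compatible with φ₁ and φ₂.
  let : Algebra K k := (IsFractionRing.lift (K := K) hι₁).toAlgebra
  let : Algebra K κ := (IsFractionRing.lift (K := K) hι₂).toAlgebra
  let toK : D →+* K := (algebraMap E K).comp (Ideal.Quotient.mk _)
  have h₁ : ∀ d, algebraMap K k (toK d) = φ₁ d := fun d =>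
    IsFractionRing.lift_algebraMap hι₁ _
  have h₂ : ∀ d, algebraMap K κ (toK d) = φ₂ d := fun d =>
    IsFractionRing.lift_algebraMap hι₂ _
  let R := Algebra.adjoin K (S : Set k)
  have hft : Algebra.FiniteType K R :=
    (Subalgebra.fg_iff_finiteType R).1 (Subalgebra.fg_adjoin_finset S)
  obtain ⟨ψ⟩ := nonempty_algHom_of_finiteType K R κ
  have hD : ∀ d, φ₁ d ∈ R := fun d => by
    rw [← h₁]
    exact R.algebraMap_mem _
  refine ⟨R.toSubring, Algebra.subset_adjoin, hD, ψ.toRingHom, RingHom.ext fun d => ?_⟩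
  rw [← h₂, ← ψ.commutes]
  exact congrArg ψ (Subtype.ext (h₁ d).symm)

end Specialization

/-! ### Transfer of (Nil) between measures with the same kernel. -/

section TransferNil

variable {F : Type u} [Field F] [Finite F] {R : Type v} {k : Type w} [CommRing R] [CommRing k]
  (φ : R →+* k) (μ : Measure (GLInf F) (InfSpace F) R)
  {X : Type u} [MulAction (GLInf F) X] (hX : IsSmooth (GLInf F) (InfSpace F) X)
  (hfin : IsFinitary (GLInf F) X)
include hfin

theorem Measure.map_matMul (A B : X → X → R) :
    (μ.map φ).matMul hX (fun x y => φ (A x y)) (fun x y => φ (B x y)) =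
      fun x y => φ (μ.matMul hX A B x y) := by
  funext z x
  have := finite_orbits_of_isFinitary hX hfin ((hX z).inf (hX x))
  have h := μ.map_integral φ hX _ ((hX z).inf (hX x)) fun y => A z y * B y x
  simp only [map_mul] at h
  exact h

theorem Measure.map_matPowSucc (A : X → X → R) (n : ℕ) :
    (μ.map φ).matPowSucc hX (fun x y => φ (A x y)) n =
      fun x y => φ (μ.matPowSucc hX A n x y) := by
  induction n with
  | zero => rfl
  | succ n ih =>
    rw [Measure.matPowSucc, ih, Measure.map_matMul φ μ hX hfin]
    rfl

theorem Measure.map_trace (A : X → X → R) :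
    (μ.map φ).trace hX (fun x y => φ (A x y)) = φ (μ.trace hX A) := by
  have := finite_orbits_of_isFinitary hX hfin (isOpenSubgroup_top (InfSpace F))
  exact μ.map_integral φ hX _ (isOpenSubgroup_top _) fun x => A x x

omit hfin in
/-- Condition (Nil) for the values of a measure in one field implies it for those in another. -/
theorem Measure.SatisfiesNil.of_ker_eq {D : Type*} [CommRing D] {k : Type v} {κ : Type w} [Field k]
    [Field κ] [IsAlgClosed κ] {μ : Measure (GLInf F) (InfSpace F) D} {φ₁ : D →+* k} {φ₂ : D →+* κ}
    (hker : RingHom.ker φ₁ = RingHom.ker φ₂) (h : (μ.map φ₂).SatisfiesNil) :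
    (μ.map φ₁).SatisfiesNil := by
  classical
  intro X _ hX hfin A hA ⟨N, hN⟩
  by_contra htr
  have hol := isOligomorphic_of_isFinitary hX hfin
  have : Finite (MulAction.orbitRel.Quotient (GLInf F) (X × X)) :=
    isFinitary_of_isOligomorphic (hol.prod hX hol)
  -- An invariant matrix is constant on the finitely many orbits of X × X, so its entries lie in a
  -- finitely generated algebra.
  have hAfin : (Set.range fun p : X × X => A p.1 p.2).Finite := by
    refine (Set.finite_range fun o : MulAction.orbitRel.Quotient (GLInf F) (X × X) =>
      A o.out.1 o.out.2).subset ?_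
    rintro - ⟨p, rfl⟩
    refine ⟨Quotient.mk'' p, ?_⟩
    obtain ⟨g, hg⟩ := Quotient.mk_out (s := MulAction.orbitRel (GLInf F) (X × X)) p
    exact (congrArg (fun p : X × X => A p.1 p.2) hg).symm.trans (hA g p.1 p.2)
  -- The inverse of the trace is adjoined so that the trace stays nonzero after specialization.
  obtain ⟨R, hS, hD, ψ, hψ⟩ := exists_specialization φ₁ φ₂ hker
    (insert ((μ.map φ₁).trace hX A)⁻¹ hAfin.toFinset)
  let A' : X → X → R := fun x y => ⟨A x y, hS (by simp)⟩
  let μ' := μ.map (φ₁.codRestrict R hD)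
  have e₂ : μ.map φ₂ = μ'.map ψ := by rw [← hψ]; rfl
  have hN' : ∀ x y, μ'.matPowSucc hX A' N x y = 0 := fun x y => by
    refine Subtype.ext ?_
    have := congrFun (congrFun (Measure.map_matPowSucc R.subtype μ' hX hfin A' N) x) y
    exact this.symm.trans (hN x y)
  have ht : (μ.map φ₁).trace hX A = R.subtype (μ'.trace hX A') :=
    Measure.map_trace R.subtype μ' hX hfin A'
  have hz := h X hX hfin (fun x y => ψ (A' x y))
    (fun g x y => congrArg ψ (Subtype.ext (hA g x y))) ⟨N, fun x y => by
      rw [e₂, Measure.map_matPowSucc ψ μ' hX hfin]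
      exact (congrArg ψ (hN' x y)).trans (map_zero ψ)⟩
  rw [e₂, Measure.map_trace ψ μ' hX hfin] at hz
  let s : R := ⟨((μ.map φ₁).trace hX A)⁻¹, hS (by simp)⟩
  have hs : s * μ'.trace hX A' = 1 := Subtype.ext (by
    change ((μ.map φ₁).trace hX A)⁻¹ * R.subtype (μ'.trace hX A') = 1
    rw [← ht, inv_mul_cancel₀ htr])
  have := congrArg ψ hs
  rw [map_mul, hz, mul_zero, map_one] at this
  exact zero_ne_one this

end TransferNil

/-! ### The measure μ_t and the main theorem. -/

section Main

variable {F : Type u} [Field F] [Finite F] {k : Type v} [Field k] [CharZero k]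

variable (F) in
/-- The measure on the infinite general linear group giving the even part measure `t`. -/
noncomputable def muParam (t : k) : Measure (GLInf F) (InfSpace F) k :=
  (polynomialMeasure F).map (eval₂RingHom (algebraMap ℚ k) t)

theorem isMuParam_muParam (t : k) : IsMuParam t (muParam F t) := by
  have := isMuParam_map (F := F) (eval₂RingHom (algebraMap ℚ k) t)
  rwa [coe_eval₂RingHom, eval₂_X] at this

theorem IsMuParam.eq_muParam {t : k} {μ : Measure (GLInf F) (InfSpace F) k} (h : IsMuParam t μ) :
    μ = muParam F t :=
  Measure.eq_of_value_evenPart_eq (h.trans (isMuParam_muParam t).symm)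

theorem exists_ultraproductMeasure {t : k} (ht : t ≠ 0) :
    (∃ (κ : ℕ → Type) (_ : ∀ n, Field (κ n)) (𝓕 : Ultrafilter ℕ)
        (ν : Measure (GLInf F) (InfSpace F) (Ultraproduct κ 𝓕)),
      CharZero (Ultraproduct κ 𝓕) ∧ IsUltraproductMeasure (perfectEmbeddings F) κ 𝓕 ν ∧
      (muParam F t).specPoint = ν.specPoint) ∧ (muParam F t).SatisfiesNil := by
  have hq : ∃ ℓ f : ℕ, ℓ.Prime ∧ f ≠ 0 ∧ Nat.card F = ℓ ^ f := by
    have := Fintype.ofFinite F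
    obtain ⟨ℓ, -, f, hℓ, h⟩ := FiniteField.card' F
    exact ⟨ℓ, f, hℓ, f.ne_zero, by rw [Nat.card_eq_fintype_card, h]⟩
  obtain ⟨κ, _, _, 𝓕, φ, hchar, hne, hφX, hker⟩ := exists_ultraproduct hq ht
  have hν := isUltraproductMeasure_map (F := F) hne φ hφX
  have := Ultraproduct.isAlgClosed (κ := κ) (𝓕 := 𝓕)
  refine ⟨⟨κ, inferInstance, 𝓕, _, hchar, hν, ?_⟩, hν.satisfiesNil.of_ker_eq hker.symm⟩
  refine PrimeSpectrum.ext ?_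
  -- Both points of the spectrum are pulled back from ℚ[X] along the homomorphism of
  -- `polynomialMeasure`, so equality of the kernels on ℚ[X] suffices.
  change RingHom.ker (muParam F t).toRingHom = RingHom.ker ((polynomialMeasure F).map φ).toRingHom
  rw [muParam, Measure.toRingHom_map, Measure.toRingHom_map, ← RingHom.comap_ker,
    ← RingHom.comap_ker, hker]

end Main

end Oligo

theorem mainTheorem6 {F : Type u} [Field F] [Finite F] {k : Type v} [Field k] [CharZero k]
    (t : k) (ht : t ≠ 0) :
    (∃! μ : Oligo.Measure (Oligo.GLInf F) (Oligo.InfSpace F) k, Oligo.IsMuParam t μ) ∧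
    ∀ μ : Oligo.Measure (Oligo.GLInf F) (Oligo.InfSpace F) k, Oligo.IsMuParam t μ →
      (∃ (κ : ℕ → Type) (_ : ∀ n, Field (κ n)) (𝓕 : Ultrafilter ℕ)
          (ν : Oligo.Measure (Oligo.GLInf F) (Oligo.InfSpace F) (Oligo.Ultraproduct κ 𝓕)),
        CharZero (Oligo.Ultraproduct κ 𝓕) ∧
        Oligo.IsUltraproductMeasure (Oligo.perfectEmbeddings F) κ 𝓕 ν ∧
        μ.specPoint = ν.specPoint) ∧
      μ.SatisfiesNil := by
  refine ⟨⟨Oligo.muParam F t, Oligo.isMuParam_muParam t, fun μ h => h.eq_muParam⟩, fun μ h => ?_⟩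
  rw [h.eq_muParam]
  exact Oligo.exists_ultraproductMeasure ht
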